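/- Setting (Fay--Herriot model). Fix $p\ge 0$, covariates $x_1,x_2,\ldots\in\mathbb R^p$, $\beta\in\mathbb R^p$, $A>0$ and known variances $D_1,D_2,\ldots$. For $j\ge 1$ let $y_j=x_j'\beta+u_j+e_j$, where $u_j\sim N(0,A)$ and $e_j\sim N(0,D_j)$ are all mutually independent. For $m$ areas put $y=(y_1,\ldots,y_m)'$, $X=(x_1,\ldots,x_m)'$, $V=V(A)=\mathrm{diag}(A+D_1,\ldots,A+D_m)$, $P=V^{-1}-V^{-1}X(X'V^{-1}X)^{-1}X'V^{-1}$ and let $$L_{RE}(A\mid y)=|X'V^{-1}X|^{-1/2}|V|^{-1/2}\exp\{-y'Py/2\}$$ be the residual likelihood. Assume, as $m\to\infty$: $\mathrm{rank}(X)=p$ for all large $m$; the entries of the $x_j$ are uniformly bounded and $\max_{j\le m}x_j'(X'X)^{-1}x_j=O(m^{-1})$; $0<\inf_jD_j\le\sup_jD_j<\infty$. For every $m\geq 1$ let $\tilde L_{add}=\tilde L_{add,m}:[0,\infty)\to[0,\infty)$ be a function, not depending on $y$, which is positive on $(0,\infty)$, satisfies $\tilde L_{add}(0)=0$ and is right-continuous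 at $0$, such that $\log\tilde L_{add}$ is four times continuously differentiable, strictly increasing and concave on $(0,\infty)$, $\tilde L_{add}<C'$ on $(0,\infty)$ with a constant $C'$ not depending on $m$, and for every $a>0$ and $k=0,1,2,3,4$, $\frac{\partial^k}{\partial a^k}\log\tilde L_{add}(a)=o(1)$ as $m\to\infty$. Fix an area $i$ and a constant $C>0$, and let $\hat A_i^N$ be the adjusted maximum likelihood estimator of $A$, $$\hat A_i^N\in\mathop{\rm arg\,max}_{0\le a<\infty}\;C(a+D_i)^2\,\tilde L_{add}(a)\,L_{RE}(a\mid y)$$ (any measurable function of $y$ that is a maximizer whenever a maximizer exists). Theorem 2. As $m\to\infty$, (i) $\displaystyle E[\hat A_i^N-A]=\frac{4}{\mathrm{tr}[V^{-2}]\,(A+D_i)}+o(m^{-1})$; (ii) $\displaystyle E[(\hat A_i^N-A)^2]=\frac{2}{\mathrm{tr}[V^{-2}]}+o(m^{-1})$, where for all large $m$ both expectations are those of integrable random variables; and (iii) for every $m>p+4$ with $m\ge i$ and $\mathrm{rank}(X)=p$, and for every $y\in\mathbb R^m$, a maximizer exists and $\hat A_i^N>0$. -/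

import Mathlib

open MeasureTheory ProbabilityTheory Filter Asymptotics Matrix

open scoped Topology

noncomputable section

namespace FayHerriot

/-- The `m × p` covariate matrix whose rows are the covariates of the first `m` areas. -/
def designMatrix {p : ℕ} (x : ℕ → Fin p → ℝ) (m : ℕ) : Matrix (Fin m) (Fin p) ℝ :=
  Matrix.of fun j => x j

/-- `V(a) = diag(a + D_1, …, a + D_m)`. -/
def covMatrix (D : ℕ → ℝ) (m : ℕ) (a : ℝ) : Matrix (Fin m) (Fin m) ℝ :=
  Matrix.diagonal fun j => a + D j

/-- `P(a) = V⁻¹ - V⁻¹ X (X' V⁻¹ X)⁻¹ X' V⁻¹`. -/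
def projMatrix {p : ℕ} (x : ℕ → Fin p → ℝ) (D : ℕ → ℝ) (m : ℕ) (a : ℝ) :
    Matrix (Fin m) (Fin m) ℝ :=
  (covMatrix D m a)⁻¹ -
    (covMatrix D m a)⁻¹ * designMatrix x m *
      ((designMatrix x m)ᵀ * (covMatrix D m a)⁻¹ * designMatrix x m)⁻¹ *
      (designMatrix x m)ᵀ * (covMatrix D m a)⁻¹

/-- The residual likelihood `|X' V⁻¹ X|^(-1/2) |V|^(-1/2) exp(-y' P y / 2)`. -/
def residualLikelihood {p : ℕ} (x : ℕ → Fin p → ℝ) (D : ℕ → ℝ) (m : ℕ)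
    (y : Fin m → ℝ) (a : ℝ) : ℝ :=
  ((designMatrix x m)ᵀ * (covMatrix D m a)⁻¹ * designMatrix x m).det ^ (-(1 / 2) : ℝ) *
    (covMatrix D m a).det ^ (-(1 / 2) : ℝ) *
    Real.exp (-(y ⬝ᵥ (projMatrix x D m a *ᵥ y)) / 2)

/-- The set of maximizers over `0 ≤ a < ∞` of the adjusted residual likelihood
`C (a + D_i)² L_add(a) L_RE(a | y)`; here `Ladd m` is the additional adjustment factor used when
there are `m` areas. -/
def adjustedArgmax {p : ℕ} (x : ℕ → Fin p → ℝ) (D : ℕ → ℝ) (C : ℝ) (Ladd : ℕ → ℝ → ℝ)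
    (i m : ℕ) (y : Fin m → ℝ) : Set ℝ :=
  {a | a ∈ Set.Ici 0 ∧
    IsMaxOn (fun b => C * (b + D i) ^ 2 * Ladd m b * residualLikelihood x D m y b)
      (Set.Ici 0) a}

/-- `Ahat m` is a version of the adjusted maximum likelihood estimator for area `i` from `m` areas:
a measurable function of the data which is a maximizer of the adjusted residual likelihood
whenever there is one. Existence of a maximizer is not part of this definition. -/
structure IsAdjustedEstimator {p : ℕ} (x : ℕ → Fin p → ℝ) (D : ℕ → ℝ) (C : ℝ)
    (Ladd : ℕ → ℝ → ℝ) (i : ℕ) (Ahat : (m : ℕ) → (Fin m → ℝ) → ℝ) : Prop where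
  measurable : ∀ m, Measurable (Ahat m)
  mem_argmax : ∀ m y, (adjustedArgmax x D C Ladd i m y).Nonempty →
    Ahat m y ∈ adjustedArgmax x D C Ladd i m y

/-- Regularity conditions on the covariates and the variances, as the number of areas grows:
full column rank for large `m`, uniformly bounded covariates,
leverages `x_j' (X'X)⁻¹ x_j` of order `O(1/m)` uniformly in `j ≤ m`,
sampling variances bounded away from `0` and `∞`, and `0 < A`. -/
structure Regular {p : ℕ} (x : ℕ → Fin p → ℝ) (D : ℕ → ℝ) (A : ℝ) : Prop where
  rank_eq : ∀ᶠ m in atTop, (designMatrix x m).rank = p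
  bounded : ∃ K : ℝ, ∀ j k, |x j k| ≤ K
  leverage : ∃ K : ℝ, ∀ᶠ m : ℕ in atTop, ∀ j : Fin m,
    x j ⬝ᵥ (((designMatrix x m)ᵀ * designMatrix x m)⁻¹ *ᵥ x j) ≤ K / m
  D_lower : ∃ d : ℝ, 0 < d ∧ ∀ j, d ≤ D j
  D_upper : ∃ d : ℝ, ∀ j, D j ≤ d
  A_pos : 0 < A

/-- The conditions on the additional adjustment factor `Ladd m` (one function of the variance
parameter for every number of areas `m ≥ 1`). The bound of the last field does not depend on `m`. -/
structure AddFactor (Ladd : ℕ → ℝ → ℝ) : Prop where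
  pos : ∀ m, 1 ≤ m → ∀ a, 0 < a → 0 < Ladd m a
  contDiffOn : ∀ m, 1 ≤ m → ContDiffOn ℝ 4 (fun a => Real.log (Ladd m a)) (Set.Ioi 0)
  tendsto : ∀ k : ℕ, k ≤ 4 → ∀ a : ℝ, 0 < a →
    Tendsto (fun m => iteratedDeriv k (fun b => Real.log (Ladd m b)) a) atTop (𝓝 0)
  strictMonoOn : ∀ m, 1 ≤ m → StrictMonoOn (fun a => Real.log (Ladd m a)) (Set.Ioi 0)
  concaveOn : ∀ m, 1 ≤ m → ConcaveOn ℝ (Set.Ioi 0) (fun a => Real.log (Ladd m a))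
  zero : ∀ m, 1 ≤ m → Ladd m 0 = 0
  continuous_zero : ∀ m, 1 ≤ m → ContinuousWithinAt (Ladd m) (Set.Ici 0) 0
  bounded : ∃ C : ℝ, 0 < C ∧ ∀ m, 1 ≤ m → ∀ a, 0 < a → Ladd m a < C

/-- The random effects `u_j ~ N(0, A)` and the sampling errors `e_j ~ N(0, D_j)`, all independent. -/
structure Errors {Ω : Type*} [MeasurableSpace Ω] (μ : Measure Ω) (D : ℕ → ℝ) (A : ℝ)
    (u e : ℕ → Ω → ℝ) : Prop where
  law_u : ∀ j, HasLaw (u j) (gaussianReal 0 A.toNNReal) μ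
  law_e : ∀ j, HasLaw (e j) (gaussianReal 0 (D j).toNNReal) μ
  indep : iIndepFun (Sum.elim u e) μ

/-- The data `y_j = x_j' β + u_j + e_j`, `j ≤ m`, of the model with `m` areas. -/
def data {Ω : Type*} {p : ℕ} (x : ℕ → Fin p → ℝ) (β : Fin p → ℝ) (u e : ℕ → Ω → ℝ) (m : ℕ)
    (ω : Ω) : Fin m → ℝ :=
  fun j => x j ⬝ᵥ β + u j ω + e j ω

end FayHerriot

end

/-! Write ε_j = u_j + e_j, v_j = A + D_j, ξ_j = ε_j² - v_j, Δ for the estimation error, and I = ½ Σ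
v_j⁻² = ½ tr V⁻². Factoring X = U B with U'U = 1 removes β: up to a factor free of a, the residual
likelihood is the exponential of `logLik`, a function of U and ε. For m > p + 4 the objective is
continuous, vanishes at 0 and decays at infinity, so a maximizer exists, is positive and solves the
score equation (`adjustedArgmax_nonempty`, `adjustedArgmax_pos`, `adjustedArgmax_stationary`). This
holds for every outcome, so no exceptional event has to be discarded.

Expanding the score equation around A gives I Δ = S + r + κ + N Δ + T Δ² + remainder, where S = ½ Σ
ξ_j/v_j², N = -Σ ξ_j/v_j³, T = Σ v_j⁻³, κ = 2/(A + D_i), and r is the part of the residual score at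
A caused by estimating β. Normality gives E S = 0, E S² = I and E[N S] = -T; moreover E r = 0
(`integral_scoreCorrection`). Since Δ ≈ S/I, the terms E[N Δ] ≈ -T/I and T E Δ² ≈ T/I cancel, so I E
Δ → κ. Likewise I² E Δ² = E S² + O(√m) = I + O(√m). This is `exists_abs_moment_sub_le`.

Expectations need remainders controlled in every L^q and for every a ≥ 0, not only near A. With c
the midpoint of the bounds d ≤ D_j ≤ d', one has a + D_j = (a + c)(1 - tη_j) with t in [0, 1] and
|η_j| ≤ θ < 1. A geometric expansion then bounds Σ X_j/(a + D_j)^k, uniformly in a, by countably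
many fixed sums with geometrically small weights (`seriesBound`), each of order √m in L^q by
exponential moment bounds. Multiplying the score equation by (a + c)² yields m|Δ| ≤ Γ W with W of
order √m (`exists_stationary_bounds`), so √m Δ is bounded in every L^q.

The score g of the additional factor is nonnegative and decreasing. It is at most its value at A/2,
which tends to 0, when a ≥ A/2; for smaller a the score equation itself bounds it. For a ≥ A,
concavity and the upper bound on the factor keep g(a)(a - A) bounded. -/

noncomputable section

/-! ### Calculus of random sequences bounded in every L^q. -/

namespace FayHerriot

/-- The sequence `Y` of random variables is bounded in every `L^q`, `q < ∞`, along `atTop`. -/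
def MomentBounded {Ω : Type*} [MeasurableSpace Ω] (μ : Measure Ω) (Y : ℕ → Ω → ℝ) : Prop :=
  (∀ᶠ m in atTop, AEStronglyMeasurable (Y m) μ) ∧
    ∀ q : ℕ, 1 ≤ q → ∃ C : ℝ, ∀ᶠ m in atTop, eLpNorm (Y m) q μ ≤ ENNReal.ofReal C

namespace MomentBounded

variable {Ω : Type*} [MeasurableSpace Ω] {μ : Measure Ω} {Y Z : ℕ → Ω → ℝ}

theorem mono (hZ : MomentBounded μ Z) (hY : ∀ᶠ m in atTop, AEStronglyMeasurable (Y m) μ)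
    (h : ∀ᶠ m in atTop, ∀ ω, |Y m ω| ≤ Z m ω) : MomentBounded μ Y := by
  refine ⟨hY, fun q hq => ?_⟩
  obtain ⟨C, hC⟩ := hZ.2 q hq
  refine ⟨C, ?_⟩
  filter_upwards [hC, h] with m h1 h2
  exact (eLpNorm_mono_real fun ω => by simpa using h2 ω).trans h1

theorem abs (hY : MomentBounded μ Y) : MomentBounded μ fun m ω => |Y m ω| := by
  refine ⟨hY.1.mono fun m h => by simpa using h.norm, fun q hq => ?_⟩
  obtain ⟨C, hC⟩ := hY.2 q hq
  refine ⟨C, hC.mono fun m h => ?_⟩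
  have := eLpNorm_norm (μ := μ) (p := q) (Y m)
  simp only [Real.norm_eq_abs] at this
  rwa [this]

theorem add (hY : MomentBounded μ Y) (hZ : MomentBounded μ Z) :
    MomentBounded μ fun m ω => Y m ω + Z m ω := by
  refine ⟨by filter_upwards [hY.1, hZ.1] with m h1 h2 using h1.add h2, fun q hq => ?_⟩
  obtain ⟨C, hC⟩ := hY.2 q hq
  obtain ⟨C', hC'⟩ := hZ.2 q hq
  refine ⟨max C 0 + max C' 0, ?_⟩
  filter_upwards [hC, hC', hY.1, hZ.1] with m h1 h2 h3 h4
  rw [ENNReal.ofReal_add (le_max_right _ _) (le_max_right _ _)]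
  refine (eLpNorm_add_le h3 h4 (by exact_mod_cast hq)).trans ?_
  gcongr
  · exact h1.trans (ENNReal.ofReal_le_ofReal (le_max_left _ _))
  · exact h2.trans (ENNReal.ofReal_le_ofReal (le_max_left _ _))

theorem mul (hY : MomentBounded μ Y) (hZ : MomentBounded μ Z) :
    MomentBounded μ fun m ω => Y m ω * Z m ω := by
  refine ⟨by filter_upwards [hY.1, hZ.1] with m h1 h2 using h1.mul h2, fun q hq => ?_⟩
  obtain ⟨C, hC⟩ := hY.2 (2 * q) (by omega)
  obtain ⟨C', hC'⟩ := hZ.2 (2 * q) (by omega)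
  refine ⟨max C 0 * max C' 0, ?_⟩
  filter_upwards [hC, hC', hY.1, hZ.1] with m h1 h2 h3 h4
  -- Hölder with exponents 2q, 2q, q: the product loses integrability, which is why all finite q are
  -- carried along.
  have : ENNReal.HolderTriple ((2 * q : ℕ) : ENNReal) ((2 * q : ℕ) : ENNReal) (q : ENNReal) := by
    constructor
    push_cast
    rw [ENNReal.mul_inv (by simp) (by simp), ← add_mul, ENNReal.inv_two_add_inv_two, one_mul]
  rw [ENNReal.ofReal_mul (le_max_right _ _)]
  refine (eLpNorm_smul_le_mul_eLpNorm (p := ((2 * q : ℕ) : ENNReal))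
    (q := ((2 * q : ℕ) : ENNReal)) h4 h3).trans ?_
  gcongr
  · exact h1.trans (ENNReal.ofReal_le_ofReal (le_max_left _ _))
  · exact h2.trans (ENNReal.ofReal_le_ofReal (le_max_left _ _))

theorem const [IsProbabilityMeasure μ] {c : ℕ → ℝ} {K : ℝ} (hc : ∀ᶠ m in atTop, |c m| ≤ K) :
    MomentBounded μ fun m _ => c m := by
  refine ⟨Eventually.of_forall fun m => aestronglyMeasurable_const, fun q hq => ⟨K, ?_⟩⟩
  filter_upwards [hc] with m h
  rw [eLpNorm_const _ (by positivity) (NeZero.ne μ)]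
  simpa [Real.enorm_eq_ofReal_abs] using ENNReal.ofReal_le_ofReal h

theorem sum [IsProbabilityMeasure μ] {ι : Type*} (s : Finset ι) {F : ι → ℕ → Ω → ℝ}
    (h : ∀ k ∈ s, MomentBounded μ (F k)) : MomentBounded μ fun m ω => ∑ k ∈ s, F k m ω := by
  classical
  induction s using Finset.induction_on with
  | empty => simpa using const (μ := μ) (c := fun _ => 0) (K := 0) (by simp)
  | insert a s ha ih =>
    simp only [Finset.sum_insert ha]
    exact (h a (Finset.mem_insert_self _ _)).add
      (ih fun k hk => h k (Finset.mem_insert_of_mem hk))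

theorem pow [IsProbabilityMeasure μ] (hY : MomentBounded μ Y) (k : ℕ) :
    MomentBounded μ fun m ω => Y m ω ^ k := by
  induction k with
  | zero => simpa using const (μ := μ) (c := fun _ => 1) (K := 1) (by simp)
  | succ k ih => simpa only [pow_succ] using ih.mul hY

theorem eventually_integrable (hY : MomentBounded μ Y) : ∀ᶠ m in atTop, Integrable (Y m) μ := by
  obtain ⟨C, hC⟩ := hY.2 1 le_rfl
  filter_upwards [hC, hY.1] with m h1 h2
  rw [← memLp_one_iff_integrable]
  exact ⟨h2, (by simpa using h1 : eLpNorm (Y m) 1 μ ≤ ENNReal.ofReal C).trans_lt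
    ENNReal.ofReal_lt_top⟩

theorem exists_abs_integral_le (hY : MomentBounded μ Y) :
    ∃ C : ℝ, 0 ≤ C ∧ ∀ᶠ m in atTop, |∫ ω, Y m ω ∂μ| ≤ C := by
  obtain ⟨C, hC⟩ := hY.2 1 le_rfl
  refine ⟨max C 0, le_max_right _ _, ?_⟩
  filter_upwards [hC, hY.1] with m h1 h2
  have h3 := norm_integral_le_lintegral_norm (μ := μ) (Y m)
  rw [Real.norm_eq_abs] at h3
  refine h3.trans (ENNReal.toReal_le_of_le_ofReal (le_max_right _ _) ?_)
  simp only [Nat.cast_one, eLpNorm_one_eq_lintegral_enorm] at h1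
  refine le_trans (le_of_eq ?_) (h1.trans (ENNReal.ofReal_le_ofReal (le_max_left _ _)))
  simp [Real.enorm_eq_ofReal_abs]

end MomentBounded

end FayHerriot

/-! ### Moments of weighted sums of independent subexponential variables. -/

namespace FayHerriot

/-- Keeping the linear term exact is the point: it integrates to 0 for a centred variable, leaving a
moment generating function of the form 1 + O(t²). -/
theorem exp_le_one_add_add_sq_mul_exp_abs (x : ℝ) :
    Real.exp x ≤ 1 + x + x ^ 2 * Real.exp |x| := by
  have h := Complex.norm_exp_sub_sum_le_norm_mul_exp (x : ℂ) 2
  have h1 : ‖Complex.exp x - ∑ m ∈ Finset.range 2, (x : ℂ) ^ m / m.factorial‖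
      = |Real.exp x - (1 + x)| := by
    rw [← Real.norm_eq_abs, ← Complex.norm_real]
    congr 1
    push_cast
    simp [Finset.sum_range_succ]
  rw [h1, Complex.norm_real, Real.norm_eq_abs, sq_abs] at h
  linarith [le_abs_self (Real.exp x - (1 + x))]

theorem abs_pow_le_factorial_mul_exp_add_exp {τ : ℝ} (hτ : 0 < τ) (q : ℕ) (y : ℝ) :
    |y| ^ q ≤ q.factorial / τ ^ q * (Real.exp (τ * y) + Real.exp (-τ * y)) := by
  have h1 : (τ * |y|) ^ q / q.factorial ≤ Real.exp (τ * |y|) :=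
    Real.pow_div_factorial_le_exp _ (by positivity) q
  have h2 : Real.exp (τ * |y|) ≤ Real.exp (τ * y) + Real.exp (-τ * y) := by
    rcases abs_cases y with ⟨h, _⟩ | ⟨h, _⟩ <;> rw [h]
    · linarith [Real.exp_pos (-τ * y)]
    · rw [show τ * -y = -τ * y by ring]
      linarith [Real.exp_pos (τ * y)]
  have hq : (0 : ℝ) < q.factorial := by positivity
  rw [mul_pow, div_le_iff₀ hq] at h1
  rw [div_mul_eq_mul_div, le_div_iff₀ (by positivity), mul_comm]
  nlinarith

variable {Ω : Type*} [MeasurableSpace Ω] {μ : Measure Ω}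

/-- `X` is a sequence of independent centred random variables with uniformly bounded
exponential moments near `0`. -/
structure IndepSubexponential (μ : Measure Ω) (X : ℕ → Ω → ℝ) (τ K : ℝ) : Prop where
  indep : iIndepFun X μ
  aemeasurable : ∀ j, AEMeasurable (X j) μ
  integral_eq_zero : ∀ j, ∫ ω, X j ω ∂μ = 0
  tau_pos : 0 < τ
  integrable_sq_mul_exp : ∀ j, Integrable (fun ω => X j ω ^ 2 * Real.exp (τ * |X j ω|)) μ
  integral_sq_mul_exp_le : ∀ j, ∫ ω, X j ω ^ 2 * Real.exp (τ * |X j ω|) ∂μ ≤ K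

namespace IndepSubexponential

variable {X : ℕ → Ω → ℝ} {τ K : ℝ}

theorem nonneg (h : IndepSubexponential μ X τ K) : 0 ≤ K :=
  (integral_nonneg fun ω => by positivity).trans (h.integral_sq_mul_exp_le 0)

theorem memLp_two (h : IndepSubexponential μ X τ K) (j : ℕ) : MemLp (X j) 2 μ := by
  rw [memLp_two_iff_integrable_sq (h.aemeasurable j).aestronglyMeasurable]
  refine (h.integrable_sq_mul_exp j).mono'
    ((h.aemeasurable j).pow_const 2).aestronglyMeasurable (ae_of_all _ fun ω => ?_)
  rw [Real.norm_eq_abs, abs_of_nonneg (sq_nonneg _)]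
  have : 1 ≤ Real.exp (τ * |X j ω|) :=
    Real.one_le_exp (mul_nonneg h.tau_pos.le (abs_nonneg _))
  nlinarith [sq_nonneg (X j ω)]

theorem integrable [IsProbabilityMeasure μ] (h : IndepSubexponential μ X τ K) (j : ℕ) :
    Integrable (X j) μ :=
  (h.memLp_two j).integrable (by norm_num)

theorem exp_mul_le (_h : IndepSubexponential μ X τ K) (j : ℕ) {t : ℝ} (ht : |t| ≤ τ) (ω : Ω) :
    Real.exp (t * X j ω) ≤
      1 + t * X j ω + t ^ 2 * (X j ω ^ 2 * Real.exp (τ * |X j ω|)) := by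
  refine (exp_le_one_add_add_sq_mul_exp_abs _).trans ?_
  rw [mul_pow, abs_mul, mul_assoc]
  gcongr

theorem integrable_exp_mul [IsProbabilityMeasure μ] (h : IndepSubexponential μ X τ K) (j : ℕ)
    {t : ℝ} (ht : |t| ≤ τ) : Integrable (fun ω => Real.exp (t * X j ω)) μ := by
  refine Integrable.mono' (g := fun ω => 1 + t * X j ω +
      t ^ 2 * (X j ω ^ 2 * Real.exp (τ * |X j ω|))) ?_ ?_ (ae_of_all _ fun ω => ?_)
  · exact ((integrable_const 1).add ((h.integrable j).const_mul t)).add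
      ((h.integrable_sq_mul_exp j).const_mul _)
  · exact ((h.aemeasurable j).const_mul t).exp.aestronglyMeasurable
  · rw [Real.norm_eq_abs, Real.abs_exp]
    exact h.exp_mul_le j ht ω

theorem mgf_le [IsProbabilityMeasure μ] (h : IndepSubexponential μ X τ K) (j : ℕ) {t : ℝ}
    (ht : |t| ≤ τ) : mgf (X j) μ t ≤ Real.exp (t ^ 2 * K) := by
  have h1 : mgf (X j) μ t ≤ ∫ ω, (1 + t * X j ω +
      t ^ 2 * (X j ω ^ 2 * Real.exp (τ * |X j ω|))) ∂μ :=
    integral_mono (h.integrable_exp_mul j ht)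
      (((integrable_const 1).add ((h.integrable j).const_mul t)).add
      ((h.integrable_sq_mul_exp j).const_mul _)) fun ω => h.exp_mul_le j ht ω
  have i1 : Integrable (fun ω => 1 + t * X j ω) μ :=
    (integrable_const 1).add ((h.integrable j).const_mul t)
  rw [integral_add i1 ((h.integrable_sq_mul_exp j).const_mul _),
    integral_add (integrable_const 1) ((h.integrable j).const_mul t), integral_const_mul,
    integral_const_mul, h.integral_eq_zero] at h1
  simp only [integral_const, probReal_univ, smul_eq_mul, mul_one, mul_zero, add_zero] at h1
  have h2 := mul_le_mul_of_nonneg_left (h.integral_sq_mul_exp_le j) (sq_nonneg t)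
  linarith [Real.add_one_le_exp (t ^ 2 * K)]

theorem mgf_sum_le [IsProbabilityMeasure μ] (h : IndepSubexponential μ X τ K) {m : ℕ}
    {t : ℝ} (w : Fin m → ℝ) (hw : ∀ j, |w j| ≤ 1) (ht : |t| ≤ τ) :
    Integrable (fun ω => Real.exp (t * ∑ j, w j * X j ω)) μ ∧
      mgf (fun ω => ∑ j, w j * X j ω) μ t ≤ Real.exp (m * (t ^ 2 * K)) := by
  have hind : iIndepFun (fun (j : Fin m) ω => w j * X j ω) μ :=
    (h.indep.precomp Fin.val_injective).comp (fun j x => w j * x)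
      fun j => measurable_const_mul _
  have hwt : ∀ j, |t * w j| ≤ τ := fun j => by
    rw [abs_mul]
    exact (mul_le_of_le_one_right (abs_nonneg _) (hw j)).trans ht
  have hm : ∀ j : Fin m, AEMeasurable (fun ω => w j * X j ω) μ :=
    fun j => (h.aemeasurable j).const_mul _
  have hfun : (fun ω => ∑ j, w j * X j ω) = ∑ j, fun ω => w j * X j ω := by
    ext ω
    simp
  have hmgf : ∀ j : Fin m, mgf (fun ω => w j * X j ω) μ t = mgf (X j) μ (t * w j) := fun j => by
    simp only [mgf, mul_assoc]
  have hprod := hind.mgf_sum₀ (t := t) hm Finset.univ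
  constructor
  -- A non-integrable exponential would give `mgf` the default value 0, whereas it is a product of
  -- positive factors.
  · by_contra hni
    have h0 : mgf (fun ω => ∑ j, w j * X j ω) μ t = 0 := integral_undef hni
    rw [hfun, hprod, Finset.prod_eq_zero_iff] at h0
    obtain ⟨j, -, hj⟩ := h0
    rw [hmgf] at hj
    exact (mgf_pos (h.integrable_exp_mul j (hwt j))).ne' hj
  · rw [hfun, hprod]
    calc ∏ j, mgf (fun ω => w j * X j ω) μ t ≤ ∏ j : Fin m, Real.exp (t ^ 2 * K) := by
          refine Finset.prod_le_prod (fun j _ => mgf_nonneg) fun j _ => ?_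
          rw [hmgf]
          refine (h.mgf_le j (hwt j)).trans (Real.exp_le_exp.2 ?_)
          refine mul_le_mul_of_nonneg_right ?_ h.nonneg
          rw [mul_pow]
          exact mul_le_of_le_one_right (sq_nonneg t) (by
            rw [← sq_abs]
            exact pow_le_one₀ (abs_nonneg _) (hw j))
      _ = _ := by
          rw [Finset.prod_const, Finset.card_univ, Fintype.card_fin, ← Real.exp_nat_mul]

/-- Sums of `m` terms with weights bounded by `1` are of order `√m` in every `L^q`. -/
theorem exists_eLpNorm_sum_le [IsProbabilityMeasure μ] (h : IndepSubexponential μ X τ K)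
    {q : ℕ} (hq : 1 ≤ q) :
    ∃ C : ℝ, 0 ≤ C ∧ ∀ (m : ℕ) (w : Fin m → ℝ), (∀ j, |w j| ≤ 1) →
      eLpNorm (fun ω => ∑ j, w j * X j ω) q μ ≤ ENNReal.ofReal (C * √m) := by
  -- Comes from |y|^q ≤ q!/τ^q (e^{τy} + e^{-τy}), each exponential of the normalized sum having
  -- mean at most e^{τ²K}.
  set M : ℝ := q.factorial / τ ^ q * (2 * Real.exp (τ ^ 2 * K)) with hM
  have hτ := h.tau_pos
  have hM0 : 0 ≤ M := by positivity
  refine ⟨M ^ ((q : ℝ)⁻¹), by positivity, fun m w hw => ?_⟩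
  rcases Nat.eq_zero_or_pos m with rfl | hm
  · simp
  have hsm : 0 < √(m : ℝ) := Real.sqrt_pos.2 (by exact_mod_cast hm)
  have hsm1 : 1 ≤ √(m : ℝ) := Real.one_le_sqrt.2 (by exact_mod_cast hm)
  set Y : Ω → ℝ := fun ω => (√(m : ℝ))⁻¹ * ∑ j, w j * X j ω with hY
  have hYm : AEMeasurable Y μ := by
    refine AEMeasurable.const_mul ?_ _
    exact Finset.aemeasurable_fun_sum _ fun j _ => (h.aemeasurable j).const_mul _
  have key : ∀ t : ℝ, |t| ≤ τ → Integrable (fun ω => Real.exp (t * Y ω)) μ ∧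
      ∫ ω, Real.exp (t * Y ω) ∂μ ≤ Real.exp (t ^ 2 * K) := by
    intro t ht
    have ht' : |t * (√(m : ℝ))⁻¹| ≤ τ := by
      rw [abs_mul, abs_of_pos (inv_pos.2 hsm)]
      exact (mul_le_of_le_one_right (abs_nonneg _) (inv_le_one_of_one_le₀ hsm1)).trans ht
    have h1 := h.mgf_sum_le w hw ht'
    -- Rescaling by 1/√m turns the exponent m t² K into t² K, free of m.
    have h2 : (m : ℝ) * ((t * (√(m : ℝ))⁻¹) ^ 2 * K) = t ^ 2 * K := by
      rw [mul_pow, inv_pow, Real.sq_sqrt (by positivity)]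
      field_simp
    rw [h2, mgf] at h1
    simpa only [hY, mul_assoc] using h1
  have hbound : ∫⁻ ω, ‖Y ω‖ₑ ^ (q : ℝ) ∂μ ≤ ENNReal.ofReal M := by
    obtain ⟨i1, b1⟩ := key τ (abs_of_pos hτ).le
    obtain ⟨i2, b2⟩ := key (-τ) (by rw [abs_neg, abs_of_pos hτ])
    rw [neg_sq] at b2
    calc ∫⁻ ω, ‖Y ω‖ₑ ^ (q : ℝ) ∂μ
        ≤ ∫⁻ ω, ENNReal.ofReal (q.factorial / τ ^ q *
            (Real.exp (τ * Y ω) + Real.exp (-τ * Y ω))) ∂μ := by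
          refine lintegral_mono fun ω => ?_
          dsimp only
          rw [Real.enorm_eq_ofReal_abs, ENNReal.rpow_natCast,
            ← ENNReal.ofReal_pow (abs_nonneg _)]
          exact ENNReal.ofReal_le_ofReal (abs_pow_le_factorial_mul_exp_add_exp hτ q _)
      _ = ENNReal.ofReal (∫ ω, q.factorial / τ ^ q *
            (Real.exp (τ * Y ω) + Real.exp (-τ * Y ω)) ∂μ) := by
          have i3 : Integrable (fun ω => q.factorial / τ ^ q *
              (Real.exp (τ * Y ω) + Real.exp (-τ * Y ω))) μ := (i1.add i2).const_mul _
          rw [ofReal_integral_eq_lintegral_ofReal i3 (ae_of_all _ fun ω => by positivity)]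
      _ ≤ ENNReal.ofReal M := by
          refine ENNReal.ofReal_le_ofReal ?_
          rw [integral_const_mul, integral_add i1 i2, hM]
          gcongr
          linarith
  have hq0 : (q : ENNReal) ≠ 0 := by
    simp only [ne_eq, Nat.cast_eq_zero]
    omega
  have hYq : eLpNorm Y q μ ≤ ENNReal.ofReal (M ^ ((q : ℝ)⁻¹)) := by
    rw [eLpNorm_eq_lintegral_rpow_enorm_toReal hq0 (by simp)]
    rw [← ENNReal.ofReal_rpow_of_nonneg hM0 (by positivity), ENNReal.toReal_natCast, one_div]
    exact ENNReal.rpow_le_rpow hbound (by positivity)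
  have hfun : (fun ω => ∑ j, w j * X j ω) = √(m : ℝ) • Y := by
    ext ω
    simp only [Pi.smul_apply, smul_eq_mul, hY]
    rw [mul_inv_cancel_left₀ hsm.ne']
  rw [hfun, eLpNorm_const_smul, Real.enorm_eq_ofReal hsm.le, mul_comm,
    ENNReal.ofReal_mul (by positivity)]
  gcongr

theorem integral_mul_eq_zero [IsProbabilityMeasure μ] (h : IndepSubexponential μ X τ K)
    {i j : ℕ} (hij : i ≠ j) : ∫ ω, X i ω * X j ω ∂μ = 0 := by
  have := (h.indep.indepFun hij).integral_mul_eq_mul_integral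
    (h.aemeasurable i).aestronglyMeasurable (h.aemeasurable j).aestronglyMeasurable
  simpa [h.integral_eq_zero] using this

theorem integral_sum_mul_sum [IsProbabilityMeasure μ] (h : IndepSubexponential μ X τ K)
    {m : ℕ} (α γ : Fin m → ℝ) :
    ∫ ω, (∑ j, α j * X j ω) * (∑ j, γ j * X j ω) ∂μ =
      ∑ j, α j * γ j * ∫ ω, X j ω ^ 2 ∂μ := by
  have hint : ∀ i j : ℕ, Integrable (fun ω => X i ω * X j ω) μ :=
    fun i j => (h.memLp_two i).integrable_mul (h.memLp_two j)
  have hint' : ∀ i j : Fin m, Integrable (fun ω => α i * X i ω * (γ j * X j ω)) μ := fun i j => by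
    have : ∀ ω, α i * X i ω * (γ j * X j ω) = α i * γ j * (X i ω * X j ω) := fun ω => by ring
    simp only [this]
    exact (hint i j).const_mul _
  simp only [Finset.sum_mul_sum]
  rw [integral_finsetSum _ fun i _ => integrable_finsetSum _ fun j _ => hint' i j]
  refine Finset.sum_congr rfl fun i _ => ?_
  rw [integral_finsetSum _ fun j _ => hint' i j, Finset.sum_eq_single i]
  · rw [← integral_const_mul]
    exact integral_congr_ae (ae_of_all _ fun ω => by ring)
  · intro j _ hji
    have : ∀ ω, α i * X i ω * (γ j * X j ω) = α i * γ j * (X i ω * X j ω) :=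
      fun ω => by ring
    simp only [this]
    rw [integral_const_mul,
      h.integral_mul_eq_zero fun hh => hji (Fin.val_injective hh).symm, mul_zero]
  · simp

theorem integral_sum_eq_zero [IsProbabilityMeasure μ] (h : IndepSubexponential μ X τ K)
    {m : ℕ} (α : Fin m → ℝ) : ∫ ω, ∑ j, α j * X j ω ∂μ = 0 := by
  have hint : ∀ j : Fin m, Integrable (fun ω => α j * X j ω) μ :=
    fun j => (h.integrable j).const_mul _
  rw [integral_finsetSum _ fun j _ => hint j]
  simp [integral_const_mul, h.integral_eq_zero]

end IndepSubexponential

end FayHerriot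

/-! ### Gaussian moments; the errors and their centred squares are subexponential. -/

namespace FayHerriot

theorem integrable_exp_sq_div_four_gaussianReal :
    Integrable (fun z : ℝ => Real.exp (z ^ 2 / 4)) (gaussianReal 0 1) := by
  rw [gaussianReal_of_var_ne_zero _ one_ne_zero,
    integrable_withDensity_iff_integrable_smul' (measurable_gaussianPDF 0 1)
      (ae_of_all _ fun _ => gaussianPDF_lt_top)]
  simp only [toReal_gaussianPDF, gaussianPDFReal, smul_eq_mul]
  have h := (integrable_exp_neg_mul_sq (b := 1 / 4) (by norm_num)).const_mul
    (√(2 * Real.pi * (1 : NNReal)))⁻¹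
  refine h.congr (ae_of_all _ fun z => ?_)
  simp only [mul_assoc, ← Real.exp_add]
  congr 2
  simp only [NNReal.coe_one]
  ring

/-- The fourth moment is the fourth derivative of e^{t²/2} at 0. It is what makes the variance of
ε_j² equal to 2 v_j². -/
theorem integral_pow_four_gaussianReal : ∫ z : ℝ, z ^ 4 ∂(gaussianReal 0 1) = 3 := by
  have h := iteratedDeriv_mgf_zero (X := id) (μ := gaussianReal 0 1)
    (by simp [integrableExpSet_id_gaussianReal]) 4
  simp only [Pi.pow_apply, id_eq] at h
  rw [← h, mgf_id_gaussianReal]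
  have h0 : (fun t : ℝ => Real.exp (0 * t + (1 : NNReal) * t ^ 2 / 2))
      = fun t => Real.exp (t ^ 2 / 2) := by
    ext t
    simp
  have hb : ∀ t : ℝ, HasDerivAt (fun t : ℝ => Real.exp (t ^ 2 / 2)) (t * Real.exp (t ^ 2 / 2)) t :=
    fun t => by
      have := ((hasDerivAt_pow 2 t).div_const 2).exp
      convert this using 1
      norm_num
      ring
  have hd : ∀ (P Q : ℝ → ℝ), (∀ t, HasDerivAt P (Q t) t) →
      deriv (fun t => P t * Real.exp (t ^ 2 / 2)) =
        fun t => (Q t + P t * t) * Real.exp (t ^ 2 / 2) := fun P Q hP => by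
    ext t
    exact ((hP t).mul (hb t)).deriv.trans (by ring)
  have e1 : deriv (fun t : ℝ => Real.exp (t ^ 2 / 2)) = fun t => t * Real.exp (t ^ 2 / 2) := by
    ext t
    exact (hb t).deriv
  have e2 := hd (fun t => t) (fun _ => 1) fun t => hasDerivAt_id t
  have e3 := hd (fun t => 1 + t * t) (fun t => 1 * t + t * 1) fun t =>
    ((hasDerivAt_id t).mul (hasDerivAt_id t)).const_add 1
  have e4 := hd (fun t => 1 * t + t * 1 + (1 + t * t) * t)
    (fun t => 1 * 1 + 1 * 1 + ((1 * t + t * 1) * t + (1 + t * t) * 1)) fun t =>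
      (((hasDerivAt_id t).const_mul 1).add ((hasDerivAt_id t).mul_const 1)).add
      ((((hasDerivAt_id t).mul (hasDerivAt_id t)).const_add 1).mul (hasDerivAt_id t))
  rw [h0, iteratedDeriv_succ, iteratedDeriv_succ, iteratedDeriv_succ, iteratedDeriv_one, e1, e2,
    e3, e4]
  norm_num

namespace Errors

variable {Ω : Type*} [MeasurableSpace Ω] {μ : Measure Ω} {D : ℕ → ℝ} {A : ℝ} {u e : ℕ → Ω → ℝ}

theorem aemeasurable_elim (h : Errors μ D A u e) (k : ℕ ⊕ ℕ) :
    AEMeasurable (Sum.elim u e k) μ := by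
  rcases k with k | k
  · exact (h.law_u k).aemeasurable
  · exact (h.law_e k).aemeasurable

theorem aemeasurable_add (h : Errors μ D A u e) (j : ℕ) :
    AEMeasurable (fun ω => u j ω + e j ω) μ :=
  (h.law_u j).aemeasurable.add (h.law_e j).aemeasurable

theorem hasLaw_add (h : Errors μ D A u e) (hA : 0 ≤ A) {j : ℕ} (hD : 0 ≤ D j) :
    HasLaw (fun ω => u j ω + e j ω) (gaussianReal 0 (A + D j).toNNReal) μ where
  aemeasurable := h.aemeasurable_add j
  map_eq := by
    have hi : IndepFun (u j) (e j) μ :=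
      h.indep.indepFun (i := Sum.inl j) (j := Sum.inr j) (by simp)
    have := gaussianReal_add_gaussianReal_of_indepFun hi (h.law_u j).map_eq (h.law_e j).map_eq
    rw [← Real.toNNReal_add hA hD, add_zero] at this
    exact this

/-- Induction over the areas: the pair of variables of a new area and the pairs of the previous
areas are disjoint blocks of one independent family, so functions of the two blocks are independent.
-/
theorem iIndepFun_add (h : Errors μ D A u e) : iIndepFun (fun j ω => u j ω + e j ω) μ := by
  classical
  have := h.indep.isProbabilityMeasure
  rw [iIndepFun_iff_measure_inter_preimage_eq_mul]
  intro S
  induction S using Finset.induction_on with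
  | empty => simp
  | insert a S ha ih =>
    intro B hB
    have hd : Disjoint ({Sum.inl a, Sum.inr a} : Finset (ℕ ⊕ ℕ)) (S.disjSum S) := by
      simp [Finset.disjoint_left, ha]
    have hi := h.indep.indepFun_finset₀ _ _ hd h.aemeasurable_elim
    have hφ : Measurable fun f : (({Sum.inl a, Sum.inr a} : Finset (ℕ ⊕ ℕ)) → ℝ) =>
        f ⟨Sum.inl a, by simp⟩ + f ⟨Sum.inr a, by simp⟩ := by fun_prop
    have hψ : Measurable fun (f : (S.disjSum S → ℝ)) (j : S) =>
        f ⟨Sum.inl j, by simp⟩ + f ⟨Sum.inr j, by simp⟩ := by fun_prop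
    have hi2 : IndepFun (fun ω => u a ω + e a ω) (fun ω (j : S) => u j ω + e j ω) μ :=
      hi.comp hφ hψ
    have hm := hi2.measure_inter_preimage_eq_mul (B a) (Set.univ.pi fun j : S => B j)
      (hB a (Finset.mem_insert_self _ _))
      (MeasurableSet.univ_pi fun j => hB j (Finset.mem_insert_of_mem j.2))
    have hset : (fun ω (j : S) => u j ω + e j ω) ⁻¹' (Set.univ.pi fun j : S => B j) =
        ⋂ j ∈ S, (fun ω => u j ω + e j ω) ⁻¹' B j := by
      ext ω
      simp
    rw [hset, ih fun j hj => hB j (Finset.mem_insert_of_mem hj)] at hm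
    rw [Finset.set_biInter_insert, hm, Finset.prod_insert ha]

theorem exists_standard (h : Errors μ D A u e) (hA : 0 < A) {j : ℕ} (hD : 0 < D j) :
    ∃ Z : Ω → ℝ, HasLaw Z (gaussianReal 0 1) μ ∧
      ∀ ω, u j ω + e j ω = √(A + D j) * Z ω := by
  have hv : 0 < A + D j := by positivity
  have hs : 0 < √(A + D j) := Real.sqrt_pos.2 hv
  refine ⟨fun ω => (√(A + D j))⁻¹ * (u j ω + e j ω), ?_, fun ω => by
    rw [mul_inv_cancel_left₀ hs.ne']⟩
  have := gaussianReal_const_mul (h.hasLaw_add hA.le hD.le) (√(A + D j))⁻¹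
  rw [mul_zero] at this
  convert this using 2
  ext
  push_cast
  rw [Real.coe_toNNReal _ hv.le, inv_pow, Real.sq_sqrt hv.le,
    inv_mul_cancel₀ hv.ne']

/-- Domination by e^{Z²/4} with Z standard normal gives a bound that is the same for all areas,
although the variances differ. -/
theorem indepSubexponential_comp [IsProbabilityMeasure μ] (h : Errors μ D A u e)
    {f : ℕ → ℝ → ℝ} (hf : ∀ j, Measurable (f j)) {τ K : ℝ} (hτ : 0 < τ)
    (h0 : ∀ j, ∫ ω, f j (u j ω + e j ω) ∂μ = 0)
    (hK : ∀ j, ∃ Z : Ω → ℝ, HasLaw Z (gaussianReal 0 1) μ ∧ ∀ ω,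
      f j (u j ω + e j ω) ^ 2 * Real.exp (τ * |f j (u j ω + e j ω)|) ≤
        K * Real.exp (Z ω ^ 2 / 4)) :
    IndepSubexponential μ (fun j ω => f j (u j ω + e j ω)) τ
      (K * ∫ z, Real.exp (z ^ 2 / 4) ∂(gaussianReal 0 1)) := by
  have hm : ∀ j, AEMeasurable (fun ω => f j (u j ω + e j ω)) μ :=
    fun j => (hf j).comp_aemeasurable (h.aemeasurable_add j)
  have hZi : ∀ Z : Ω → ℝ, HasLaw Z (gaussianReal 0 1) μ →
      Integrable (fun ω => Real.exp (Z ω ^ 2 / 4)) μ := fun Z hZ => by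
    have := integrable_exp_sq_div_four_gaussianReal
    rw [← hZ.map_eq, integrable_map_measure (by fun_prop) hZ.aemeasurable] at this
    exact this
  have hi : ∀ j, Integrable (fun ω => f j (u j ω + e j ω) ^ 2 *
      Real.exp (τ * |f j (u j ω + e j ω)|)) μ := fun j => by
    obtain ⟨Z, hZ, hb⟩ := hK j
    refine ((hZi Z hZ).const_mul K).mono' ?_ (ae_of_all _ fun ω => ?_)
    · have := hm j
      exact ((this.pow_const 2).mul ((measurable_norm.comp_aemeasurable this).const_mul
        τ).exp).aestronglyMeasurable
    · rw [Real.norm_eq_abs, abs_of_nonneg (by positivity)]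
      exact hb ω
  refine ⟨h.iIndepFun_add.comp f hf, hm, h0, hτ, hi, fun j => ?_⟩
  obtain ⟨Z, hZ, hb⟩ := hK j
  have h1 : ∫ ω, Real.exp (Z ω ^ 2 / 4) ∂μ = ∫ z, Real.exp (z ^ 2 / 4) ∂(gaussianReal 0 1) :=
    hZ.integral_comp (f := fun z => Real.exp (z ^ 2 / 4)) (by fun_prop)
  rw [← h1, ← integral_const_mul]
  exact integral_mono (hi j) ((hZi Z hZ).const_mul K) hb

theorem integral_add_eq_zero (h : Errors μ D A u e) (hA : 0 < A) {j : ℕ} (hD : 0 < D j) :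
    ∫ ω, (u j ω + e j ω) ∂μ = 0 := by
  rw [(h.hasLaw_add hA.le hD.le).integral_eq, integral_id_gaussianReal]

theorem integral_add_sq (h : Errors μ D A u e) (hA : 0 < A) {j : ℕ} (hD : 0 < D j) :
    ∫ ω, (u j ω + e j ω) ^ 2 ∂μ = A + D j := by
  have hl := h.hasLaw_add hA.le hD.le
  have := hl.isProbabilityMeasure
  have hvar := hl.variance_eq
  rw [variance_id_gaussianReal, variance_eq_integral hl.aemeasurable,
    h.integral_add_eq_zero hA hD, Real.coe_toNNReal _ (by positivity)] at hvar
  simpa using hvar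

theorem integral_sq_sub_eq_zero (h : Errors μ D A u e) (hA : 0 < A) {j : ℕ} (hD : 0 < D j) :
    ∫ ω, ((u j ω + e j ω) ^ 2 - (A + D j)) ∂μ = 0 := by
  have hl := h.hasLaw_add hA.le hD.le
  have := hl.isProbabilityMeasure
  have hi : Integrable (fun ω => (u j ω + e j ω) ^ 2) μ := by
    by_contra hni
    have h0 := h.integral_add_sq hA hD
    rw [integral_undef hni] at h0
    linarith
  rw [integral_sub hi (integrable_const _), h.integral_add_sq hA hD]
  simp

theorem integral_sq_sub_sq (h : Errors μ D A u e) (hA : 0 < A) {j : ℕ} (hD : 0 < D j) :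
    ∫ ω, ((u j ω + e j ω) ^ 2 - (A + D j)) ^ 2 ∂μ = 2 * (A + D j) ^ 2 := by
  obtain ⟨Z, hZ, hz⟩ := h.exists_standard hA hD
  have hv : 0 ≤ A + D j := by positivity
  have h1 : ∀ ω, ((u j ω + e j ω) ^ 2 - (A + D j)) ^ 2 =
      (fun z : ℝ => (A + D j) ^ 2 * (z ^ 4 - 2 * z ^ 2 + 1)) (Z ω) := fun ω => by
    simp only
    rw [hz, mul_pow, Real.sq_sqrt hv]
    ring
  simp only [h1]
  have hc := hZ.integral_comp (f := fun z : ℝ => (A + D j) ^ 2 * (z ^ 4 - 2 * z ^ 2 + 1))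
    (by fun_prop)
  simp only [Function.comp_def] at hc
  have hp : ∀ n : ℕ, n ≠ 0 → Integrable (fun z : ℝ => z ^ n) (gaussianReal 0 1) := fun n hn =>
    ((memLp_id_gaussianReal (μ := 0) (v := 1) n).integrable_norm_pow hn).mono'
      (by fun_prop) (ae_of_all _ fun z => by simp)
  have h2 : ∫ z : ℝ, z ^ 2 ∂(gaussianReal 0 1) = 1 := by
    have hvar := variance_id_gaussianReal (μ := 0) (v := 1)
    rw [variance_eq_integral (by fun_prop)] at hvar
    simpa using hvar
  have i2 : Integrable (fun z : ℝ => 2 * z ^ 2) (gaussianReal 0 1) :=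
    (hp 2 (by norm_num)).const_mul 2
  have i3 : Integrable (fun z : ℝ => z ^ 4 - 2 * z ^ 2) (gaussianReal 0 1) :=
    (hp 4 (by norm_num)).sub i2
  rw [hc, integral_const_mul, integral_add i3 (integrable_const _),
    integral_sub (hp 4 (by norm_num)) i2, integral_const_mul, integral_pow_four_gaussianReal, h2]
  simp
  ring

/-- The errors `u_j + e_j` are independent, centred and uniformly subexponential. -/
theorem exists_indepSubexponential [IsProbabilityMeasure μ] (h : Errors μ D A u e) (hA : 0 < A)
    (hD : ∀ j, 0 < D j) {d : ℝ} (hd : ∀ j, D j ≤ d) :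
    ∃ τ K, IndepSubexponential μ (fun j ω => u j ω + e j ω) τ K := by
  have hV : 0 < A + d := by linarith [hD 0, hd 0]
  refine ⟨1, _, h.indepSubexponential_comp (f := fun _ x => x) (K := 2 * Real.exp (4 * (A + d)))
    (fun _ => measurable_id) one_pos (fun j => h.integral_add_eq_zero hA (hD j)) fun j => ?_⟩
  obtain ⟨Z, hZ, hz⟩ := h.exists_standard hA (hD j)
  refine ⟨Z, hZ, fun ω => ?_⟩
  have hv : 0 < A + D j := by linarith [hD j]
  rw [one_mul]
  generalize hx : u j ω + e j ω = x
  have hx2 : x ^ 2 = (A + D j) * Z ω ^ 2 := by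
    rw [← hx, hz, mul_pow, Real.sq_sqrt hv.le]
  have h1 : x ^ 2 ≤ 2 * Real.exp |x| := by
    have := Real.pow_div_factorial_le_exp |x| (abs_nonneg x) 2
    rw [sq_abs] at this
    norm_num at this
    linarith
  -- The inequality 2|x| ≤ 4V + x²/(4V) with V = A + d, combined with x² ≤ V Z².
  have h2 : 2 * |x| ≤ 4 * (A + d) + Z ω ^ 2 / 4 := by
    have h3 : x ^ 2 ≤ (A + d) * Z ω ^ 2 := by
      rw [hx2]
      gcongr
      exact hd j
    have h4 : 0 ≤ (4 * (A + d) - |x|) ^ 2 := sq_nonneg _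
    have h5 : |x| ^ 2 = x ^ 2 := sq_abs x
    by_contra hcon
    push Not at hcon
    nlinarith [mul_lt_mul_of_pos_left hcon hV]
  calc x ^ 2 * Real.exp |x| ≤ 2 * Real.exp |x| * Real.exp |x| := by gcongr
    _ = 2 * Real.exp (2 * |x|) := by rw [mul_assoc, ← Real.exp_add, two_mul |x|]
    _ ≤ 2 * Real.exp (4 * (A + d) + Z ω ^ 2 / 4) := by gcongr
    _ = _ := by rw [Real.exp_add, mul_assoc]

theorem exists_indepSubexponential_sq_sub [IsProbabilityMeasure μ] (h : Errors μ D A u e)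
    (hA : 0 < A) (hD : ∀ j, 0 < D j) {d : ℝ} (hd : ∀ j, D j ≤ d) :
    ∃ τ K, IndepSubexponential μ (fun j ω => (u j ω + e j ω) ^ 2 - (A + D j)) τ K := by
  have hV : 0 < A + d := by linarith [hD 0, hd 0]
  -- So small that 2τ|y| ≤ (Z² + 1)/8, which leaves room below Z²/4.
  set τ : ℝ := 1 / (16 * (A + d)) with hτ
  have hτ0 : 0 < τ := by positivity
  refine ⟨τ, _, h.indepSubexponential_comp (f := fun j x => x ^ 2 - (A + D j))
    (K := 2 / τ ^ 2 * Real.exp 1) (fun j => by fun_prop) hτ0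
    (fun j => h.integral_sq_sub_eq_zero hA (hD j)) fun j => ?_⟩
  obtain ⟨Z, hZ, hz⟩ := h.exists_standard hA (hD j)
  refine ⟨Z, hZ, fun ω => ?_⟩
  have hv : 0 < A + D j := by linarith [hD j]
  have hx : (u j ω + e j ω) ^ 2 - (A + D j) = (A + D j) * (Z ω ^ 2 - 1) := by
    rw [hz, mul_pow, Real.sq_sqrt hv.le]
    ring
  rw [hx]
  generalize hy : (A + D j) * (Z ω ^ 2 - 1) = y
  have h1 : y ^ 2 ≤ 2 / τ ^ 2 * Real.exp (τ * |y|) := by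
    have := Real.pow_div_factorial_le_exp (τ * |y|) (by positivity) 2
    rw [mul_pow, sq_abs] at this
    norm_num at this
    rw [div_mul_eq_mul_div, le_div_iff₀ (by positivity)]
    linarith
  have h2 : 2 * (τ * |y|) ≤ 1 + Z ω ^ 2 / 4 := by
    have h3 : |y| ≤ (A + d) * (Z ω ^ 2 + 1) := by
      rw [← hy, abs_mul, abs_of_pos hv]
      gcongr
      · exact hd j
      · rw [abs_le]
        constructor <;> nlinarith [sq_nonneg (Z ω)]
    have h4 : τ * |y| ≤ τ * ((A + d) * (Z ω ^ 2 + 1)) := by gcongr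
    have h5 : τ * ((A + d) * (Z ω ^ 2 + 1)) = (Z ω ^ 2 + 1) / 16 := by
      rw [hτ]
      field_simp
    nlinarith [sq_nonneg (Z ω)]
  calc y ^ 2 * Real.exp (τ * |y|)
      ≤ 2 / τ ^ 2 * Real.exp (τ * |y|) * Real.exp (τ * |y|) := by gcongr
    _ = 2 / τ ^ 2 * Real.exp (2 * (τ * |y|)) := by rw [mul_assoc, ← Real.exp_add, ← two_mul]
    _ ≤ 2 / τ ^ 2 * Real.exp (1 + Z ω ^ 2 / 4) := by gcongr
    _ = _ := by rw [Real.exp_add, mul_assoc]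

end Errors

end FayHerriot

/-! ### Bounds for rational weighted sums, uniform in the variance parameter, by truncated geometric
series. -/

namespace FayHerriot

theorem sq_mul_sum_succ_mul_pow (u : ℝ) (N : ℕ) :
    (1 - u) ^ 2 * ∑ n ∈ Finset.range N, ((n : ℝ) + 1) * u ^ n + u ^ N * (N + 1 - N * u) = 1 := by
  induction N with
  | zero => simp
  | succ N ih =>
    rw [Finset.sum_range_succ]
    push_cast
    linear_combination ih

theorem one_sub_mul_sum_pow (u : ℝ) (N : ℕ) :
    (1 - u) * ∑ n ∈ Finset.range N, u ^ n + u ^ N = 1 := by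
  linarith [mul_neg_geom_sum u N]

/-- A bound for `|∑ X_j / (1 - t η_j) ^ k|`, `k = 1, 2`, that is uniform in `t ∈ [0, 1]`. -/
def seriesBound (θ : ℝ) {m : ℕ} (η X : Fin m → ℝ) : ℝ :=
  ∑ n ∈ Finset.range m, ((n : ℝ) + 1) * |∑ j, X j * η j ^ n| +
    (2 * m + 1) * θ ^ m / (1 - θ) ^ 2 * ∑ j, |X j|

section seriesBound

variable {θ : ℝ} {m : ℕ} {η X : Fin m → ℝ}

theorem seriesBound_nonneg (hθ : 0 ≤ θ) : 0 ≤ seriesBound θ η X := by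
  unfold seriesBound
  positivity

/-- The coefficients do not depend on j, so the two sums can be exchanged: t enters only through t^n
≤ 1 and the inner sums Σ X_j η_j^n are free of t. Truncating after m terms, the number of summands,
makes the remainder geometrically small in m. -/
theorem abs_sum_le_seriesBound {t : ℝ} (ht0 : 0 ≤ t)
    (ht1 : t ≤ 1) (a R : ℕ → ℝ → ℝ) (ha : ∀ n s, |a n s| ≤ n + 1)
    (ha' : ∀ n s s', a n s = a n s') {φ : ℝ → ℝ}
    (hφ : ∀ j, φ (t * η j) = ∑ n ∈ Finset.range m, a n (t * η j) * (t * η j) ^ n + R m (t * η j))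
    (hR : ∀ j, |R m (t * η j)| ≤ (2 * m + 1) * θ ^ m / (1 - θ) ^ 2) :
    |∑ j, X j * φ (t * η j)| ≤ seriesBound θ η X := by
  have h1 : ∑ j, X j * φ (t * η j) =
      ∑ n ∈ Finset.range m, a n 0 * t ^ n * ∑ j, X j * η j ^ n + ∑ j, X j * R m (t * η j) := by
    simp only [hφ, mul_add, Finset.sum_add_distrib, Finset.mul_sum]
    rw [Finset.sum_comm]
    congr 1
    refine Finset.sum_congr rfl fun n _ => Finset.sum_congr rfl fun j _ => ?_
    rw [ha' n (t * η j) 0, mul_pow]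
    ring
  rw [h1, seriesBound]
  refine (abs_add_le _ _).trans (add_le_add ?_ ?_)
  · refine (Finset.abs_sum_le_sum_abs _ _).trans (Finset.sum_le_sum fun n _ => ?_)
    rw [abs_mul, abs_mul, abs_of_nonneg (pow_nonneg ht0 n)]
    gcongr
    calc |a n 0| * t ^ n ≤ (n + 1) * 1 :=
          mul_le_mul (ha n 0) (pow_le_one₀ ht0 ht1) (pow_nonneg ht0 n) (by positivity)
      _ = n + 1 := mul_one _
  · rw [Finset.mul_sum]
    refine (Finset.abs_sum_le_sum_abs _ _).trans (Finset.sum_le_sum fun j _ => ?_)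
    rw [abs_mul, mul_comm]
    gcongr
    exact hR j

theorem abs_mul_le_of_le (hη : ∀ j, |η j| ≤ θ) {t : ℝ} (ht0 : 0 ≤ t) (ht1 : t ≤ 1) (j : Fin m) :
    |t * η j| ≤ θ := by
  rw [abs_mul, abs_of_nonneg ht0]
  exact (mul_le_of_le_one_left (abs_nonneg _) ht1).trans (hη j)

theorem abs_sum_div_sq_le (hθ0 : 0 ≤ θ) (hθ1 : θ < 1) (hη : ∀ j, |η j| ≤ θ) {t : ℝ}
    (ht0 : 0 ≤ t) (ht1 : t ≤ 1) :
    |∑ j, X j * ((1 - t * η j) ^ 2)⁻¹| ≤ seriesBound θ η X := by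
  have hu : ∀ j, |t * η j| ≤ θ := abs_mul_le_of_le hη ht0 ht1
  have hpos : ∀ j, 1 - θ ≤ 1 - t * η j := fun j => by linarith [(abs_le.1 (hu j)).2]
  refine abs_sum_le_seriesBound ht0 ht1 (fun n _ => n + 1)
    (fun N u => u ^ N * (N + 1 - N * u) / (1 - u) ^ 2)
    (fun n _ => (abs_of_nonneg (by positivity)).le) (fun _ _ _ => rfl)
    (φ := fun u => ((1 - u) ^ 2)⁻¹) (fun j => ?_) fun j => ?_
  · have h1 : (1 - t * η j) ≠ 0 := by linarith [hpos j]
    have h2 := sq_mul_sum_succ_mul_pow (t * η j) m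
    have h3 : (1 - t * η j) ^ 2 ≠ 0 := pow_ne_zero 2 h1
    rw [inv_eq_one_div, div_eq_iff h3, add_mul, div_mul_cancel₀ _ h3,
      mul_comm _ ((1 - t * η j) ^ 2)]
    exact h2.symm
  · have h1θ : 0 < 1 - θ := by linarith
    have h4 : |(m : ℝ) + 1 - m * (t * η j)| ≤ 2 * m + 1 := by
      have h5 := abs_le.1 (hu j)
      rw [abs_le]
      constructor <;> nlinarith [(Nat.cast_nonneg m : (0 : ℝ) ≤ m)]
    rw [abs_div, abs_mul, abs_pow, abs_of_nonneg (sq_nonneg (1 - t * η j)), mul_comm]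
    gcongr
    · exact hu j
    · exact (le_abs_self _).trans (hu j)

theorem abs_sum_div_le (hθ0 : 0 ≤ θ) (hθ1 : θ < 1) (hη : ∀ j, |η j| ≤ θ) {t : ℝ}
    (ht0 : 0 ≤ t) (ht1 : t ≤ 1) :
    |∑ j, X j * (1 - t * η j)⁻¹| ≤ seriesBound θ η X := by
  have hu : ∀ j, |t * η j| ≤ θ := abs_mul_le_of_le hη ht0 ht1
  have hpos : ∀ j, 1 - θ ≤ 1 - t * η j := fun j => by linarith [(abs_le.1 (hu j)).2]
  refine abs_sum_le_seriesBound ht0 ht1 (fun n _ => 1) (fun N u => u ^ N / (1 - u))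
    (fun n _ => by simp) (fun _ _ _ => rfl) (φ := fun u => (1 - u)⁻¹) (fun j => ?_) fun j => ?_
  · have h1 : (1 - t * η j) ≠ 0 := by linarith [hpos j]
    have h2 := one_sub_mul_sum_pow (t * η j) m
    simp only [one_mul]
    rw [inv_eq_one_div, div_eq_iff h1, add_mul, div_mul_cancel₀ _ h1, mul_comm _ (1 - t * η j)]
    exact h2.symm
  · have h1θ : 0 < 1 - θ := by linarith
    have h2 : 0 < 1 - t * η j := h1θ.trans_le (hpos j)
    rw [abs_div, abs_pow, abs_of_pos h2]
    calc |t * η j| ^ m / (1 - t * η j) ≤ θ ^ m / (1 - θ) := by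
          gcongr
          · exact hu j
          · exact (le_abs_self _).trans (hu j)
      _ ≤ θ ^ m / (1 - θ) ^ 2 := by
          gcongr
          nlinarith
      _ ≤ (2 * m + 1) * θ ^ m / (1 - θ) ^ 2 := by
          gcongr
          exact le_mul_of_one_le_left (by positivity)
            (by linarith [(Nat.cast_nonneg m : (0 : ℝ) ≤ m)])

end seriesBound

variable {Ω : Type*} [MeasurableSpace Ω] {μ : Measure Ω} [IsProbabilityMeasure μ]

/-- The n-th inner sum has weights of size W θ^n, hence L^q norm at most W θ^n C √m; these are
summable against n + 1. The truncation error carries θ^m, which beats its polynomial factors. -/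
theorem IndepSubexponential.momentBounded_seriesBound {X : ℕ → Ω → ℝ} {τ K : ℝ}
    (h : IndepSubexponential μ X τ K) {θ : ℝ} (hθ0 : 0 ≤ θ) (hθ1 : θ < 1) {η : ℕ → ℝ}
    (hη : ∀ j, |η j| ≤ θ) {W : ℝ} (hW0 : 0 ≤ W) {w : ∀ m, Fin m → ℝ}
    (hW : ∀ᶠ m in atTop, ∀ j, |w m j| ≤ W) :
    MomentBounded μ fun m ω =>
      (√(m : ℝ))⁻¹ * seriesBound θ (fun j : Fin m => η j) fun j => w m j * X j ω := by
  have hsm : ∀ m (a : Fin m → ℝ), AEStronglyMeasurable (fun ω => ∑ j, a j * X j ω) μ :=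
    fun m a => (Finset.aemeasurable_fun_sum (f := fun (j : Fin m) ω => a j * X j ω) _ fun j _ =>
      (h.aemeasurable j).const_mul _).aestronglyMeasurable
  have habs : ∀ m (a : Fin m → ℝ),
      AEStronglyMeasurable (fun ω => ∑ j, |a j * X j ω|) μ :=
    fun m a => (Finset.aemeasurable_fun_sum (f := fun (j : Fin m) ω => |a j * X j ω|) _ fun j _ =>
      measurable_norm.comp_aemeasurable ((h.aemeasurable j).const_mul _)).aestronglyMeasurable
  have hs1 : ∀ m, AEStronglyMeasurable (fun ω => ∑ n ∈ Finset.range m,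
      ((n : ℝ) + 1) * |∑ j, w m j * X j ω * η j ^ n|) μ := fun m => by
    refine Finset.aestronglyMeasurable_fun_sum _ fun n _ => AEStronglyMeasurable.const_mul ?_ _
    have := (hsm m fun j => w m j * η j ^ n).norm
    simp only [Real.norm_eq_abs] at this
    refine this.congr (ae_of_all _ fun ω => ?_)
    simp only [mul_right_comm]
  have hs2 : ∀ m, AEStronglyMeasurable (fun ω => (2 * m + 1) * θ ^ m / (1 - θ) ^ 2 *
      ∑ j, |w m j * X j ω|) μ := fun m => (habs m (w m)).const_mul _
  refine ⟨Eventually.of_forall fun m => ((hs1 m).add (hs2 m)).const_mul _, fun q hq => ?_⟩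
  have hq' : (1 : ENNReal) ≤ q := by exact_mod_cast hq
  obtain ⟨C, hC0, hC⟩ := h.exists_eLpNorm_sum_le hq
  -- The bound for weights at most 1, extended by homogeneity to weights at most b; b = 0 is
  -- separate because the scaling divides by b.
  have hCb : ∀ m (a : Fin m → ℝ) (b : ℝ), 0 ≤ b → (∀ j, |a j| ≤ b) →
      eLpNorm (fun ω => ∑ j, a j * X j ω) q μ ≤ ENNReal.ofReal (b * (C * √m)) := by
    intro m a b hb hab
    rcases hb.eq_or_lt with rfl | hb
    · have : ∀ j, a j = 0 := fun j => by simpa using hab j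
      simp [this]
    · have h1 := hC m (fun j => b⁻¹ * a j) fun j => by
        rw [abs_mul, abs_of_pos (inv_pos.2 hb), inv_mul_le_iff₀ hb, mul_one]
        exact hab j
      have h2 : (fun ω => ∑ j, a j * X j ω) = b • fun ω => ∑ j, b⁻¹ * a j * X j ω := by
        ext ω
        simp only [Pi.smul_apply, smul_eq_mul, Finset.mul_sum]
        refine Finset.sum_congr rfl fun j _ => ?_
        field_simp
      rw [h2, eLpNorm_const_smul, Real.enorm_eq_ofReal hb.le, ENNReal.ofReal_mul hb.le]
      gcongr
  have hX : ∀ m (j : Fin m), eLpNorm (X j) q μ ≤ ENNReal.ofReal (C * √m) := fun m j => by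
    have := hCb m (Pi.single j 1) 1 zero_le_one fun k => by
      by_cases hk : k = j
      · subst hk
        simp
      · simp [hk]
    simpa [Pi.single_apply, ite_mul] using this
  -- The last factor m counts the summands of Σ |X_j| in the truncation error.
  have hlim : ∀ᶠ m : ℕ in atTop, (2 * (m : ℝ) + 1) * θ ^ m * m ≤ 1 := by
    have t1 := tendsto_pow_const_mul_const_pow_of_abs_lt_one 2 (abs_lt.2 ⟨by linarith, hθ1⟩)
    have t2 := tendsto_pow_const_mul_const_pow_of_abs_lt_one 1 (abs_lt.2 ⟨by linarith, hθ1⟩)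
    have t3 := (t1.const_mul 2).add t2
    rw [mul_zero, add_zero] at t3
    filter_upwards [t3.eventually_le_const (show (0 : ℝ) < 1 by norm_num)] with m hm
    refine le_trans (le_of_eq ?_) hm
    ring
  have h1θ : 0 < 1 - θ := by linarith
  refine ⟨W * C / (1 - θ) ^ 2 + W * C / (1 - θ) ^ 2, ?_⟩
  filter_upwards [hW, hlim, eventually_ge_atTop 1] with m hWm hlm hm1
  have hsq : 0 < √(m : ℝ) := Real.sqrt_pos.2 (by exact_mod_cast hm1)
  have b1 : eLpNorm (fun ω => ∑ n ∈ Finset.range m,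
      ((n : ℝ) + 1) * |∑ j, w m j * X j ω * η j ^ n|) q μ ≤
      ENNReal.ofReal (√m * (W * C / (1 - θ) ^ 2)) := by
    have hfun : (fun ω => ∑ n ∈ Finset.range m, ((n : ℝ) + 1) * |∑ j, w m j * X j ω * η j ^ n|)
        = ∑ n ∈ Finset.range m, ((n : ℝ) + 1) • fun ω => |∑ j, w m j * η j ^ n * X j ω| := by
      ext ω
      simp only [Finset.sum_apply, Pi.smul_apply, smul_eq_mul, mul_right_comm]
    rw [hfun]
    calc _ ≤ ∑ n ∈ Finset.range m, eLpNorm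
          (((n : ℝ) + 1) • fun ω => |∑ j, w m j * η j ^ n * X j ω|) q μ :=
          eLpNorm_sum_le (fun n _ => ((hsm m fun j => w m j * η j ^ n).norm.const_smul _)) hq'
      _ ≤ ∑ n ∈ Finset.range m, ENNReal.ofReal ((n + 1) * (W * θ ^ n * (C * √m))) := by
          refine Finset.sum_le_sum fun n _ => ?_
          rw [eLpNorm_const_smul, Real.enorm_eq_ofReal (by positivity),
            ENNReal.ofReal_mul (by positivity)]
          gcongr
          have hn := eLpNorm_norm (μ := μ) (p := q) (fun ω => ∑ j, w m j * η j ^ n * X j ω)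
          simp only [Real.norm_eq_abs] at hn
          rw [hn]
          refine hCb m _ _ (by positivity) fun j => ?_
          rw [abs_mul, abs_pow]
          gcongr
          · exact hWm j
          · exact hη j
      _ = ENNReal.ofReal (∑ n ∈ Finset.range m, (n + 1) * (W * θ ^ n * (C * √m))) :=
          (ENNReal.ofReal_sum_of_nonneg fun n _ => by positivity).symm
      _ ≤ _ := by
          refine ENNReal.ofReal_le_ofReal ?_
          have e1 : ∑ n ∈ Finset.range m, ((n : ℝ) + 1) * (W * θ ^ n * (C * √m)) =
              √m * (W * C) * ∑ n ∈ Finset.range m, ((n : ℝ) + 1) * θ ^ n := by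
            rw [Finset.mul_sum]
            exact Finset.sum_congr rfl fun n _ => by ring
          -- Partial sums of Σ (n + 1) θ^n = 1/(1 - θ)²; the exact remainder is nonnegative.
          have e2 : ∑ n ∈ Finset.range m, ((n : ℝ) + 1) * θ ^ n ≤ 1 / (1 - θ) ^ 2 := by
            rw [le_div_iff₀ (by positivity), mul_comm]
            have e3 := sq_mul_sum_succ_mul_pow θ m
            have e4 : 0 ≤ θ ^ m * (m + 1 - m * θ) :=
              mul_nonneg (by positivity)
                (by nlinarith [(Nat.cast_nonneg m : (0 : ℝ) ≤ m)])
            linarith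
          rw [e1]
          calc _ ≤ √m * (W * C) * (1 / (1 - θ) ^ 2) := by gcongr
            _ = _ := by ring
  have b2 : eLpNorm (fun ω => (2 * m + 1) * θ ^ m / (1 - θ) ^ 2 *
      ∑ j, |w m j * X j ω|) q μ ≤ ENNReal.ofReal (√m * (W * C / (1 - θ) ^ 2)) := by
    have hfun : (fun ω => (2 * m + 1) * θ ^ m / (1 - θ) ^ 2 * ∑ j, |w m j * X j ω|) =
        ((2 * m + 1) * θ ^ m / (1 - θ) ^ 2) • ∑ j, fun ω => |w m j * X j ω| := by
      ext ω
      simp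
    rw [hfun, eLpNorm_const_smul, Real.enorm_eq_ofReal (by positivity)]
    calc _ ≤ ENNReal.ofReal ((2 * m + 1) * θ ^ m / (1 - θ) ^ 2) *
          ∑ j : Fin m, ENNReal.ofReal (W * (C * √m)) := by
          gcongr
          refine (eLpNorm_sum_le (fun j _ => ?_) hq').trans (Finset.sum_le_sum fun j _ => ?_)
          · exact ((h.aemeasurable j).const_mul _).aestronglyMeasurable.norm
          · have hn := eLpNorm_norm (μ := μ) (p := q) (w m j • X j)
            simp only [Real.norm_eq_abs, Pi.smul_apply, smul_eq_mul] at hn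
            rw [hn, eLpNorm_const_smul, Real.enorm_eq_ofReal_abs, ENNReal.ofReal_mul hW0]
            gcongr
            · exact hWm j
            · exact hX m j
      _ = ENNReal.ofReal ((2 * m + 1) * θ ^ m * m * (√m * (W * C / (1 - θ) ^ 2))) := by
          rw [Finset.sum_const, Finset.card_univ, Fintype.card_fin, nsmul_eq_mul,
            ← ENNReal.ofReal_natCast, ← ENNReal.ofReal_mul (by positivity),
            ← ENNReal.ofReal_mul (by positivity)]
          congr 1
          ring
      _ ≤ _ := ENNReal.ofReal_le_ofReal (mul_le_of_le_one_left (by positivity) hlm)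
  have hfin : (fun ω => (√(m : ℝ))⁻¹ *
      seriesBound θ (fun j : Fin m => η j) fun j => w m j * X j ω) =
      (√(m : ℝ))⁻¹ • ((fun ω => ∑ n ∈ Finset.range m,
        ((n : ℝ) + 1) * |∑ j, w m j * X j ω * η j ^ n|) +
        fun ω => (2 * m + 1) * θ ^ m / (1 - θ) ^ 2 * ∑ j, |w m j * X j ω|) := by
    ext ω
    simp [seriesBound]
  rw [hfin, eLpNorm_const_smul, Real.enorm_eq_ofReal (by positivity)]
  calc _ ≤ ENNReal.ofReal (√(m : ℝ))⁻¹ * (ENNReal.ofReal (√m * (W * C / (1 - θ) ^ 2)) +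
        ENNReal.ofReal (√m * (W * C / (1 - θ) ^ 2))) := by
        gcongr
        exact (eLpNorm_add_le (hs1 m) (hs2 m) hq').trans (add_le_add b1 b2)
    _ = _ := by
        rw [← ENNReal.ofReal_add (by positivity) (by positivity),
          ← ENNReal.ofReal_mul (by positivity), ← mul_add, inv_mul_cancel_left₀ hsq.ne']

end FayHerriot

/-! ### Derivative of the residual log-likelihood in an orthonormal design. -/

namespace FayHerriot

/-- Jacobi's formula: the Leibniz expansion is differentiated one column at a time, and Cramer's
rule identifies each determinant with a replaced column as a diagonal entry of adj(M) M'. -/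
theorem hasDerivAt_det {n : Type*} [Fintype n] [DecidableEq n] {M : ℝ → Matrix n n ℝ}
    {M' : Matrix n n ℝ} {a : ℝ} (h : ∀ k l, HasDerivAt (fun b => M b k l) (M' k l) a) :
    HasDerivAt (fun b => (M b).det) ((M a).adjugate * M').trace a := by
  have h1 : HasDerivAt (fun b => (M b).det) (∑ σ : Equiv.Perm n, ((Equiv.Perm.sign σ : ℤ) : ℝ) *
      ∑ i, (∏ j ∈ Finset.univ.erase i, M a (σ j) j) * M' (σ i) i) a := by
    simp only [Matrix.det_apply']
    refine HasDerivAt.fun_sum fun σ _ => HasDerivAt.const_mul _ ?_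
    simpa using HasDerivAt.fun_finsetProd (u := Finset.univ)
      (f := fun j b => M b (σ j) j) fun i _ => h (σ i) i
  convert h1 using 1
  have h2 : ∀ i, ((M a).adjugate * M') i i = ((M a).updateCol i fun k => M' k i).det := fun i => by
    rw [← Matrix.cramer_apply, Matrix.cramer_eq_adjugate_mulVec]
    rfl
  simp only [Matrix.trace, Matrix.diag_apply, h2, Matrix.det_apply']
  rw [Finset.sum_comm]
  refine Finset.sum_congr rfl fun σ _ => ?_
  rw [Finset.mul_sum]
  refine Finset.sum_congr rfl fun i _ => ?_
  congr 1
  rw [← Finset.mul_prod_erase _ _ (Finset.mem_univ i), mul_comm, Matrix.updateCol_self]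
  congr 1
  refine Finset.prod_congr rfl fun j hj => ?_
  rw [Matrix.updateCol_ne (Finset.ne_of_mem_erase hj)]

variable {m p : ℕ}

/-- `U' V(a)⁻ⁿ U`. -/
def gram (U : Matrix (Fin m) (Fin p) ℝ) (D : ℕ → ℝ) (n : ℕ) (a : ℝ) : Matrix (Fin p) (Fin p) ℝ :=
  Matrix.of fun k l => ∑ j, U j k * U j l / (a + D j) ^ n

/-- `U' V(a)⁻ⁿ y`. -/
def loading (U : Matrix (Fin m) (Fin p) ℝ) (D : ℕ → ℝ) (y : Fin m → ℝ) (n : ℕ) (a : ℝ) :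
    Fin p → ℝ :=
  fun k => ∑ j, U j k * y j / (a + D j) ^ n

/-- The generalized least squares estimator `(U' V(a)⁻¹ U)⁻¹ U' V(a)⁻¹ y`. -/
def gls (U : Matrix (Fin m) (Fin p) ℝ) (D : ℕ → ℝ) (y : Fin m → ℝ) (a : ℝ) : Fin p → ℝ :=
  (gram U D 1 a)⁻¹ *ᵥ loading U D y 1 a

/-- The part of the residual score that is due to the estimation of the regression parameter. -/
def scoreCorrection (U : Matrix (Fin m) (Fin p) ℝ) (D : ℕ → ℝ) (y : Fin m → ℝ) (a : ℝ) : ℝ :=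
  1 / 2 * ((gram U D 1 a)⁻¹ * gram U D 2 a).trace - loading U D y 2 a ⬝ᵥ gls U D y a +
    1 / 2 * (gls U D y a ⬝ᵥ gram U D 2 a *ᵥ gls U D y a)

/-- The logarithm of the residual likelihood, up to an additive constant. -/
def logLik (U : Matrix (Fin m) (Fin p) ℝ) (D : ℕ → ℝ) (y : Fin m → ℝ) (a : ℝ) : ℝ :=
  -(1 / 2) * Real.log (gram U D 1 a).det - 1 / 2 * ∑ j : Fin m, Real.log (a + D j) -
    1 / 2 * (∑ j : Fin m, y j ^ 2 / (a + D j) - loading U D y 1 a ⬝ᵥ gls U D y a)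

section

variable {U : Matrix (Fin m) (Fin p) ℝ} {D : ℕ → ℝ} {y : Fin m → ℝ} {a d d' : ℝ}

theorem gram_comm (n : ℕ) (k l : Fin p) : gram U D n a k l = gram U D n a l k := by
  simp only [gram, Matrix.of_apply, mul_comm]

theorem gram_transpose (n : ℕ) : (gram U D n a)ᵀ = gram U D n a := by
  ext k l
  exact gram_comm n l k

theorem hasDerivAt_div_add {c D a : ℝ} (h : a + D ≠ 0) :
    HasDerivAt (fun b => c / (b + D)) (-(c / (a + D) ^ 2)) a := by
  have := (hasDerivAt_const a c).div ((hasDerivAt_id a).add_const D) h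
  refine this.congr_deriv ?_
  simp [neg_div]

theorem hasDerivAt_gram (h : ∀ j : Fin m, a + D j ≠ 0) (k l : Fin p) :
    HasDerivAt (fun b => gram U D 1 b k l) (-gram U D 2 a k l) a := by
  simp only [gram, Matrix.of_apply, pow_one, ← Finset.sum_neg_distrib]
  exact HasDerivAt.fun_sum fun j _ => hasDerivAt_div_add (h j)

theorem hasDerivAt_loading (h : ∀ j : Fin m, a + D j ≠ 0) (k : Fin p) :
    HasDerivAt (fun b => loading U D y 1 b k) (-loading U D y 2 a k) a := by
  simp only [loading, pow_one, ← Finset.sum_neg_distrib]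
  exact HasDerivAt.fun_sum fun j _ => hasDerivAt_div_add (h j)

theorem sum_sq_mulVec (hU : Uᵀ * U = 1) (v : Fin p → ℝ) :
    ∑ j, (U *ᵥ v) j ^ 2 = ∑ k, v k ^ 2 := by
  have h1 : (U *ᵥ v) ⬝ᵥ (U *ᵥ v) = v ⬝ᵥ v := by
    rw [Matrix.dotProduct_mulVec, Matrix.vecMul_mulVec, hU, Matrix.vecMul_one]
  simpa only [dotProduct, ← sq] using h1

theorem dotProduct_gram_mulVec (n : ℕ) (v : Fin p → ℝ) :
    v ⬝ᵥ gram U D n a *ᵥ v = ∑ j, (U *ᵥ v) j ^ 2 / (a + D j) ^ n := by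
  simp only [dotProduct, Matrix.mulVec, gram, Matrix.of_apply, Finset.mul_sum, Finset.sum_mul]
  rw [Finset.sum_comm' (t' := Finset.univ) (s' := fun _ => Finset.univ) (by simp)]
  simp only [sq, Finset.sum_mul_sum, Finset.sum_div]
  have : ∀ l : Fin p, ∑ k, ∑ j, v k * (U j k * U j l / (a + D j) ^ n * v l) =
      ∑ j, ∑ k, v k * (U j k * U j l / (a + D j) ^ n * v l) := fun l => Finset.sum_comm
  simp only [this]
  rw [Finset.sum_comm]
  refine Finset.sum_congr rfl fun j _ => Finset.sum_congr rfl fun l _ =>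
    Finset.sum_congr rfl fun k _ => ?_
  ring

/-- In quadratic form order U'V⁻¹U ≥ (a + d')⁻¹ U'U, and U'U = 1. Invertibility and all bounds on
the inverse follow from this. -/
theorem sum_sq_le_mul_dotProduct_gram (hU : Uᵀ * U = 1) (hD : ∀ j : Fin m, 0 < a + D j)
    (hd' : ∀ j, D j ≤ d') (v : Fin p → ℝ) :
    ∑ k, v k ^ 2 ≤ (a + d') * (v ⬝ᵥ gram U D 1 a *ᵥ v) := by
  rw [← sum_sq_mulVec hU, dotProduct_gram_mulVec, Finset.mul_sum]
  refine Finset.sum_le_sum fun j _ => ?_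
  rw [pow_one, mul_div_assoc', le_div_iff₀ (hD j), mul_comm]
  gcongr
  exact hd' j

theorem isUnit_det_gram (hU : Uᵀ * U = 1) (hD : ∀ j : Fin m, 0 < a + D j)
    (hd' : ∀ j, D j ≤ d') : IsUnit (gram U D 1 a).det := by
  rw [isUnit_iff_ne_zero]
  intro h0
  obtain ⟨v, hv, hv0⟩ := Matrix.exists_mulVec_eq_zero_iff.2 h0
  have h1 := sum_sq_le_mul_dotProduct_gram hU hD hd' v
  rw [hv0, dotProduct_zero, mul_zero] at h1
  apply hv
  ext k
  have := (Finset.sum_eq_zero_iff_of_nonneg fun k _ => sq_nonneg (v k)).1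
    (le_antisymm h1 (Finset.sum_nonneg fun k _ => sq_nonneg (v k))) k (Finset.mem_univ k)
  simpa using this

/-- For the column w = G⁻¹ e_l one has w'Gw = w_l, so coercivity gives |w|² ≤ (a + d') w_l. This
bounds w_l first and then every entry. -/
theorem abs_inv_gram_le (hU : Uᵀ * U = 1) (hD : ∀ j : Fin m, 0 < a + D j)
    (hd' : ∀ j, D j ≤ d') (hd0 : 0 < a + d') (k l : Fin p) :
    |(gram U D 1 a)⁻¹ k l| ≤ a + d' := by
  have hu := isUnit_det_gram hU hD hd'
  set w : Fin p → ℝ := (gram U D 1 a)⁻¹ *ᵥ Pi.single l 1 with hw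
  have hwk : ∀ k, (gram U D 1 a)⁻¹ k l = w k := fun k => by
    rw [hw, Matrix.mulVec_single_one]
    rfl
  have h1 := sum_sq_le_mul_dotProduct_gram hU hD hd' w
  have h2 : w ⬝ᵥ gram U D 1 a *ᵥ w = w l := by
    rw [hw, Matrix.mulVec_mulVec, Matrix.mul_nonsing_inv _ hu, Matrix.one_mulVec, ← hw]
    simp
  rw [h2] at h1
  have h3 : ∀ k, w k ^ 2 ≤ (a + d') * w l := fun k =>
    (Finset.single_le_sum (f := fun k => w k ^ 2) (fun k _ => sq_nonneg _)
      (Finset.mem_univ k)).trans h1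
  have h4 : w l ≤ a + d' := by
    by_contra hcon
    push Not at hcon
    nlinarith [h3 l]
  rw [hwk]
  refine abs_le_of_sq_le_sq ((h3 k).trans ?_) hd0.le
  nlinarith

theorem inv_gram_comm (k l : Fin p) : (gram U D 1 a)⁻¹ k l = (gram U D 1 a)⁻¹ l k := by
  have := Matrix.transpose_nonsing_inv (gram U D 1 a)
  rw [gram_transpose] at this
  exact congrFun (congrFun this l) k

theorem continuousAt_inv_gram (hU : Uᵀ * U = 1) (hD : ∀ j : Fin m, 0 < a + D j)
    (hd' : ∀ j, D j ≤ d') :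
    ContinuousAt (fun b => (gram U D 1 b)⁻¹) a := by
  have hc : ContinuousAt (fun b => gram U D 1 b) a :=
    continuousAt_pi.2 fun k => continuousAt_pi.2 fun l =>
      (hasDerivAt_gram (fun j => (hD j).ne') k l).continuousAt
  have hu := isUnit_det_gram hU hD hd'
  simp only [Matrix.inv_def, Ring.inverse_eq_inv']
  exact (((continuous_id.matrix_det).continuousAt.comp hc).inv₀ hu.ne_zero).smul
    ((continuous_id.matrix_adjugate).continuousAt.comp hc)

theorem gram_mulVec_gls (hu : IsUnit (gram U D 1 a).det) :
    gram U D 1 a *ᵥ gls U D y a = loading U D y 1 a := by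
  rw [gls, Matrix.mulVec_mulVec, Matrix.mul_nonsing_inv _ hu, Matrix.one_mulVec]

theorem continuousAt_gls (hU : Uᵀ * U = 1) (hD : ∀ j : Fin m, 0 < a + D j)
    (hd' : ∀ j, D j ≤ d') : ContinuousAt (fun b => gls U D y b) a := by
  have hb : ContinuousAt (fun b => loading U D y 1 b) a :=
    continuousAt_pi.2 fun k => (hasDerivAt_loading (fun j => (hD j).ne') k).continuousAt
  have hH := continuousAt_inv_gram hU hD hd'
  refine continuousAt_pi.2 fun k => ?_
  simp only [gls, Matrix.mulVec, dotProduct]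
  refine tendsto_finsetSum _ fun l _ => ?_
  exact ((continuousAt_pi.1 (continuousAt_pi.1 hH k)) l).mul (continuousAt_pi.1 hb l)

/-- For b'G⁻¹b with G symmetric, the difference quotient is an exact combination of difference
quotients of b and G with the least squares vectors at the two points. Only continuity of the latter
is needed, not a derivative of the inverse matrix. -/
theorem hasDerivAt_loading_dotProduct_gls (hU : Uᵀ * U = 1) (hD : ∀ j : Fin m, 0 < a + D j)
    (hd' : ∀ j, D j ≤ d') :
    HasDerivAt (fun b => loading U D y 1 b ⬝ᵥ gls U D y b)
      (-2 * (loading U D y 2 a ⬝ᵥ gls U D y a) +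
        gls U D y a ⬝ᵥ gram U D 2 a *ᵥ gls U D y a) a := by
  have hne : ∀ j : Fin m, a + D j ≠ 0 := fun j => (hD j).ne'
  have hev : ∀ᶠ b in 𝓝 a, IsUnit (gram U D 1 b).det := by
    have hdet : ContinuousAt (fun b => (gram U D 1 b).det) a :=
      (hasDerivAt_det fun k l => (hasDerivAt_gram hne k l)).continuousAt
    filter_upwards [hdet.eventually_ne (isUnit_det_gram hU hD hd').ne_zero] with b hb
    exact isUnit_iff_ne_zero.2 hb
  have hkey : ∀ᶠ b in 𝓝 a, b ≠ a → slope (fun b => loading U D y 1 b ⬝ᵥ gls U D y b) a b =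
      ∑ k, slope (fun b => loading U D y 1 b k) a b * gls U D y b k +
      ∑ k, gls U D y a k * slope (fun b => loading U D y 1 b k) a b -
      ∑ k, gls U D y a k * ∑ l, slope (fun b => gram U D 1 b k l) a b * gls U D y b l := by
    filter_upwards [hev] with b hb hba
    -- Together with `e2`, symmetry and the normal equations make the mixed terms cancel.
    have e1 : loading U D y 1 a ⬝ᵥ gls U D y b =
        gls U D y a ⬝ᵥ gram U D 1 a *ᵥ gls U D y b := by
      rw [← gram_mulVec_gls (y := y) hev.self_of_nhds, dotProduct_comm, Matrix.dotProduct_mulVec,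
        ← Matrix.mulVec_transpose, gram_transpose, dotProduct_comm]
    have e2 : gls U D y a ⬝ᵥ loading U D y 1 b =
        gls U D y a ⬝ᵥ gram U D 1 b *ᵥ gls U D y b := by rw [gram_mulVec_gls hb]
    have e3 : loading U D y 1 a ⬝ᵥ gls U D y a = gls U D y a ⬝ᵥ loading U D y 1 a :=
      dotProduct_comm _ _
    simp only [dotProduct, Matrix.mulVec] at e1 e2 e3
    have hs : b - a ≠ 0 := sub_ne_zero.2 hba
    simp only [slope_def_field, dotProduct, div_mul_eq_mul_div, mul_div_assoc',
      ← Finset.sum_div, ← sub_div, ← add_div, sub_mul, mul_sub, Finset.sum_sub_distrib]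
    congr 1
    linarith
  rw [hasDerivAt_iff_tendsto_slope]
  have hlim : Tendsto (fun b => ∑ k, slope (fun b => loading U D y 1 b k) a b * gls U D y b k +
      ∑ k, gls U D y a k * slope (fun b => loading U D y 1 b k) a b -
      ∑ k, gls U D y a k * ∑ l, slope (fun b => gram U D 1 b k l) a b * gls U D y b l)
      (𝓝[≠] a) (𝓝 (∑ k, -loading U D y 2 a k * gls U D y a k +
      ∑ k, gls U D y a k * -loading U D y 2 a k -
      ∑ k, gls U D y a k * ∑ l, -gram U D 2 a k l * gls U D y a l)) := by
    have tg : ∀ k, Tendsto (fun b => gls U D y b k) (𝓝[≠] a) (𝓝 (gls U D y a k)) := fun k =>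
      (continuousAt_pi.1 (continuousAt_gls hU hD hd') k).tendsto.mono_left nhdsWithin_le_nhds
    have tb := fun k => hasDerivAt_iff_tendsto_slope.1
      (hasDerivAt_loading (U := U) (y := y) hne k)
    have tG := fun k l => hasDerivAt_iff_tendsto_slope.1 (hasDerivAt_gram (U := U) hne k l)
    refine ((tendsto_finsetSum _ fun k _ => (tb k).mul (tg k)).add
      (tendsto_finsetSum _ fun k _ => (tb k).const_mul _)).sub
      (tendsto_finsetSum _ fun k _ => (tendsto_finsetSum _ fun l _ =>
        (tG k l).mul (tg l)).const_mul _)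
  have hval : -2 * (loading U D y 2 a ⬝ᵥ gls U D y a) +
      gls U D y a ⬝ᵥ gram U D 2 a *ᵥ gls U D y a = ∑ k, -loading U D y 2 a k * gls U D y a k +
      ∑ k, gls U D y a k * -loading U D y 2 a k -
      ∑ k, gls U D y a k * ∑ l, -gram U D 2 a k l * gls U D y a l := by
    simp only [dotProduct, Matrix.mulVec, neg_mul, mul_neg, Finset.sum_neg_distrib,
      mul_comm (gls U D y a _) (loading U D y 2 a _)]
    ring
  rw [hval]
  refine hlim.congr' ?_
  rw [Filter.EventuallyEq, eventually_nhdsWithin_iff]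
  filter_upwards [hkey] with b hb hba
  exact (hb hba).symm

theorem hasDerivAt_log_det_gram (hU : Uᵀ * U = 1) (hD : ∀ j : Fin m, 0 < a + D j)
    (hd' : ∀ j, D j ≤ d') :
    HasDerivAt (fun b => Real.log (gram U D 1 b).det)
      (-((gram U D 1 a)⁻¹ * gram U D 2 a).trace) a := by
  have hu := (isUnit_det_gram hU hD hd').ne_zero
  have h1 := (hasDerivAt_det (M' := -gram U D 2 a) fun k l =>
    hasDerivAt_gram (U := U) (fun j => (hD j).ne') k l).log hu
  convert h1 using 1
  rw [Matrix.inv_def, Ring.inverse_eq_inv', Matrix.smul_mul, Matrix.trace_smul, Matrix.mul_neg,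
    Matrix.trace_neg, smul_eq_mul]
  field_simp

theorem hasDerivAt_logLik (hU : Uᵀ * U = 1) (hD : ∀ j : Fin m, 0 < a + D j)
    (hd' : ∀ j, D j ≤ d') :
    HasDerivAt (logLik U D y)
      (1 / 2 * ∑ j, y j ^ 2 / (a + D j) ^ 2 - 1 / 2 * ∑ j : Fin m, (a + D j)⁻¹ +
        scoreCorrection U D y a) a := by
  have h1 := (hasDerivAt_log_det_gram hU hD hd').const_mul (-(1 / 2))
  have h2 : HasDerivAt (fun b => ∑ j : Fin m, Real.log (b + D j))
      (∑ j : Fin m, (a + D j)⁻¹) a := by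
    refine HasDerivAt.fun_sum fun j _ => ?_
    simpa using ((hasDerivAt_id a).add_const (D j)).log (hD j).ne'
  have h3 : HasDerivAt (fun b => ∑ j : Fin m, y j ^ 2 / (b + D j))
      (∑ j : Fin m, -(y j ^ 2 / (a + D j) ^ 2)) a :=
    HasDerivAt.fun_sum fun j _ => hasDerivAt_div_add (hD j).ne'
  have h4 := hasDerivAt_loading_dotProduct_gls (y := y) hU hD hd'
  have h5 := (h1.sub (h2.const_mul (1 / 2))).sub ((h3.sub h4).const_mul (1 / 2))
  refine h5.congr_deriv ?_
  rw [scoreCorrection, Finset.sum_neg_distrib]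
  ring

end

end FayHerriot

/-! ### Orthonormal factorization of the design and reduction of the residual likelihood. -/

namespace FayHerriot

section

open scoped MatrixOrder Matrix.Norms.L2Operator

theorem exists_eq_transpose_mul_self {p : ℕ} {G : Matrix (Fin p) (Fin p) ℝ} (hG : G.PosSemidef) :
    ∃ B : Matrix (Fin p) (Fin p) ℝ, G = Bᵀ * B := by
  obtain ⟨B, h⟩ := CStarAlgebra.nonneg_iff_eq_star_mul_self.mp hG.nonneg
  exact ⟨B, by rw [h, star_eq_conjTranspose, conjTranspose_eq_transpose_of_trivial]⟩

end

theorem isUnit_det_of_rank_eq {p : ℕ} {G : Matrix (Fin p) (Fin p) ℝ} (hG : G.rank = p) :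
    IsUnit G.det := by
  rw [← Matrix.isUnit_iff_isUnit_det, ← Matrix.mulVec_surjective_iff_isUnit]
  have h : LinearMap.range G.mulVecLin = ⊤ := by
    apply Submodule.eq_top_of_finrank_eq
    rw [← Matrix.rank, hG]
    simp
  intro v
  obtain ⟨w, hw⟩ := LinearMap.range_eq_top.1 h v
  exact ⟨w, by simpa using hw⟩

/-- A matrix of full column rank is `U B` with `U' U = 1` and `B` invertible; the squared lengths of
the rows of `U` are the leverages. -/
theorem exists_orthonormal_factor {m p : ℕ} (X : Matrix (Fin m) (Fin p) ℝ) (hX : X.rank = p) :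
    ∃ (U : Matrix (Fin m) (Fin p) ℝ) (B : Matrix (Fin p) (Fin p) ℝ), X = U * B ∧
      IsUnit B.det ∧ Uᵀ * U = 1 ∧
      ∀ j, ∑ k, U j k ^ 2 = X j ⬝ᵥ ((Xᵀ * X)⁻¹ *ᵥ X j) := by
  obtain ⟨B, hB⟩ := exists_eq_transpose_mul_self (G := Xᵀ * X) (by
    simpa [conjTranspose_eq_transpose_of_trivial] using
      Matrix.posSemidef_conjTranspose_mul_self X)
  have hdet : IsUnit (Xᵀ * X).det :=
    isUnit_det_of_rank_eq (by rw [Matrix.rank_transpose_mul_self, hX])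
  have hBu : IsUnit B.det := by
    rw [hB, Matrix.det_mul, Matrix.det_transpose] at hdet
    exact isUnit_of_mul_isUnit_left hdet
  have hBt : IsUnit Bᵀ.det := by rwa [Matrix.det_transpose]
  refine ⟨X * B⁻¹, B, ?_, hBu, ?_, fun j => ?_⟩
  · rw [Matrix.mul_assoc, Matrix.nonsing_inv_mul _ hBu, Matrix.mul_one]
  · rw [Matrix.transpose_mul, Matrix.mul_assoc, ← Matrix.mul_assoc Xᵀ, hB,
      Matrix.transpose_nonsing_inv, Matrix.mul_assoc Bᵀ, Matrix.mul_nonsing_inv _ hBu,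
      Matrix.mul_one, Matrix.nonsing_inv_mul _ hBt]
  · rw [hB, Matrix.mul_inv_rev, ← Matrix.transpose_nonsing_inv, ← Matrix.mulVec_mulVec,
      Matrix.dotProduct_mulVec, ← Matrix.mulVec_transpose]
    simp only [dotProduct, sq]
    refine Finset.sum_congr rfl fun k _ => ?_
    have : (X * B⁻¹) j k = (B⁻¹ᵀ *ᵥ X j) k := by
      simp only [Matrix.mul_apply, Matrix.mulVec, dotProduct, Matrix.transpose_apply, mul_comm]
    rw [this]

variable {m p : ℕ}

theorem covMatrix_inv {D : ℕ → ℝ} {a : ℝ} (h : ∀ j : Fin m, a + D j ≠ 0) :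
    (covMatrix D m a)⁻¹ = Matrix.diagonal fun j : Fin m => (a + D j)⁻¹ := by
  refine Matrix.inv_eq_left_inv ?_
  rw [covMatrix, Matrix.diagonal_mul_diagonal, ← Matrix.diagonal_one]
  congr 1
  ext j
  exact inv_mul_cancel₀ (h j)

theorem gram_one_eq {U : Matrix (Fin m) (Fin p) ℝ} {D : ℕ → ℝ} {a : ℝ} :
    gram U D 1 a = Uᵀ * (Matrix.diagonal fun j : Fin m => (a + D j)⁻¹) * U := by
  ext k l
  rw [Matrix.mul_apply]
  simp only [gram, Matrix.of_apply, pow_one, Matrix.mul_diagonal, Matrix.transpose_apply]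
  exact Finset.sum_congr rfl fun j _ => by rw [div_eq_mul_inv, mul_right_comm]

theorem loading_one_eq {U : Matrix (Fin m) (Fin p) ℝ} {D : ℕ → ℝ} {y : Fin m → ℝ} {a : ℝ} :
    loading U D y 1 a = Uᵀ *ᵥ (Matrix.diagonal fun j : Fin m => (a + D j)⁻¹) *ᵥ y := by
  ext k
  simp only [loading, pow_one, Matrix.mulVec, dotProduct, Matrix.transpose_apply,
    Matrix.diagonal_apply, ite_mul, zero_mul, Finset.sum_ite_eq, Finset.mem_univ, if_true]
  exact Finset.sum_congr rfl fun j _ => by rw [div_eq_mul_inv]; ring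

/-- P depends on the design only through its column space, so B cancels; it annihilates that space
from both sides, so β drops out. -/
theorem dotProduct_projMatrix_mulVec {x : ℕ → Fin p → ℝ} {U : Matrix (Fin m) (Fin p) ℝ}
    {B : Matrix (Fin p) (Fin p) ℝ} {D : ℕ → ℝ} {a : ℝ} (hX : designMatrix x m = U * B)
    (hB : IsUnit B.det) (hD : ∀ j : Fin m, a + D j ≠ 0) (hu : IsUnit (gram U D 1 a).det)
    (β : Fin p → ℝ) (ε : Fin m → ℝ) :
    (designMatrix x m *ᵥ β + ε) ⬝ᵥ
        (projMatrix x D m a *ᵥ (designMatrix x m *ᵥ β + ε)) =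
      ∑ j, ε j ^ 2 / (a + D j) - loading U D ε 1 a ⬝ᵥ gls U D ε a := by
  set W : Matrix (Fin m) (Fin m) ℝ := Matrix.diagonal fun j : Fin m => (a + D j)⁻¹ with hW
  set G := gram U D 1 a with hG
  have hGW : G = Uᵀ * W * U := gram_one_eq
  have hWt : Wᵀ = W := Matrix.diagonal_transpose _
  have hBt : IsUnit Bᵀ.det := by rwa [Matrix.det_transpose]
  have hP : projMatrix x D m a = W - W * U * G⁻¹ * Uᵀ * W := by
    have h1 : (U * B)ᵀ * W * (U * B) = Bᵀ * G * B := by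
      rw [hGW, Matrix.transpose_mul]
      simp only [Matrix.mul_assoc]
    rw [projMatrix, covMatrix_inv hD, ← hW, hX, h1, Matrix.mul_inv_rev, Matrix.mul_inv_rev,
      Matrix.transpose_mul]
    congr 1
    calc W * (U * B) * (B⁻¹ * (G⁻¹ * Bᵀ⁻¹)) * (Bᵀ * Uᵀ) * W
        = W * U * (B * B⁻¹) * G⁻¹ * (Bᵀ⁻¹ * Bᵀ) * Uᵀ * W := by simp only [Matrix.mul_assoc]
      _ = _ := by
        rw [Matrix.mul_nonsing_inv _ hB, Matrix.nonsing_inv_mul _ hBt, Matrix.mul_one,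
          Matrix.mul_one]
  set P := projMatrix x D m a with hPdef
  have hPU : P * U = 0 := by
    rw [hP, Matrix.sub_mul, sub_eq_zero]
    calc W * U = W * U * (G⁻¹ * G) := by rw [Matrix.nonsing_inv_mul _ hu, Matrix.mul_one]
      _ = _ := by rw [hGW]; simp only [Matrix.mul_assoc]
  have hUP : Uᵀ * P = 0 := by
    rw [hP, Matrix.mul_sub, sub_eq_zero]
    calc Uᵀ * W = (G * G⁻¹) * (Uᵀ * W) := by rw [Matrix.mul_nonsing_inv _ hu, Matrix.one_mul]
      _ = Uᵀ * W * U * G⁻¹ * (Uᵀ * W) := by rw [← hGW]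
      _ = _ := by simp only [Matrix.mul_assoc]
  have hy : P *ᵥ (designMatrix x m *ᵥ β + ε) = P *ᵥ ε := by
    rw [Matrix.mulVec_add, hX, ← Matrix.mulVec_mulVec, Matrix.mulVec_mulVec, hPU,
      Matrix.zero_mulVec, zero_add]
  have hy2 : (designMatrix x m *ᵥ β) ⬝ᵥ (P *ᵥ ε) = 0 := by
    rw [hX, ← Matrix.mulVec_mulVec, dotProduct_comm, Matrix.dotProduct_mulVec,
      ← Matrix.mulVec_transpose, Matrix.mulVec_mulVec, hUP, Matrix.zero_mulVec, zero_dotProduct]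
  rw [hy, add_dotProduct, hy2, zero_add, hP, Matrix.sub_mulVec, dotProduct_sub]
  congr 1
  · simp only [dotProduct, hW, Matrix.mulVec_diagonal]
    exact Finset.sum_congr rfl fun j _ => by rw [div_eq_mul_inv]; ring
  · have e1 : (W * U * G⁻¹ * Uᵀ * W) *ᵥ ε = (W * U) *ᵥ gls U D ε a := by
      rw [gls, loading_one_eq]
      simp only [Matrix.mulVec_mulVec, Matrix.mul_assoc]
      rfl
    rw [e1, loading_one_eq, ← hW, Matrix.mulVec_mulVec, Matrix.dotProduct_mulVec,
      ← Matrix.mulVec_transpose, Matrix.transpose_mul, hWt]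

theorem det_gram_pos {U : Matrix (Fin m) (Fin p) ℝ} {D : ℕ → ℝ} {a d' : ℝ} (hU : Uᵀ * U = 1)
    (hD : ∀ j : Fin m, 0 < a + D j) (hd' : ∀ j, D j ≤ d') : 0 < (gram U D 1 a).det := by
  have hps : (gram U D 1 a).PosSemidef := by
    refine Matrix.PosSemidef.of_dotProduct_mulVec_nonneg ?_ fun v => ?_
    · rw [Matrix.IsHermitian, conjTranspose_eq_transpose_of_trivial, gram_transpose]
    · rw [star_trivial, dotProduct_gram_mulVec]
      exact Finset.sum_nonneg fun j _ => div_nonneg (sq_nonneg _) (pow_nonneg (hD j).le _)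
  exact lt_of_le_of_ne hps.det_nonneg (isUnit_det_gram hU hD hd').ne_zero.symm

/-- The determinant of X'V⁻¹X is |B|² times that of U'V⁻¹U, so the constant is |B|⁻¹ in absolute
value: it depends on none of a, β, ε and does not affect maximization. -/
theorem exists_residualLikelihood_eq {x : ℕ → Fin p → ℝ} {U : Matrix (Fin m) (Fin p) ℝ}
    {B : Matrix (Fin p) (Fin p) ℝ} {D : ℕ → ℝ} (hX : designMatrix x m = U * B)
    (hB : IsUnit B.det) (hU : Uᵀ * U = 1) (hD : ∀ j, 0 < D j) {d' : ℝ} (hd' : ∀ j, D j ≤ d') :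
    ∃ c : ℝ, 0 < c ∧ ∀ (β : Fin p → ℝ) (ε : Fin m → ℝ) (a : ℝ), 0 ≤ a →
      residualLikelihood x D m (designMatrix x m *ᵥ β + ε) a =
        c * Real.exp (logLik U D ε a) := by
  have hB2 : 0 < B.det ^ 2 := by
    have := hB.ne_zero
    positivity
  refine ⟨(B.det ^ 2) ^ (-(1 / 2) : ℝ), Real.rpow_pos_of_pos hB2 _, fun β ε a ha => ?_⟩
  have hpos : ∀ j : Fin m, 0 < a + D j := fun j => by linarith [hD j]
  have hne : ∀ j : Fin m, a + D j ≠ 0 := fun j => (hpos j).ne'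
  have hu := isUnit_det_gram hU hpos hd'
  have hdet := det_gram_pos hU hpos hd'
  have h1 : ((designMatrix x m)ᵀ * (covMatrix D m a)⁻¹ * designMatrix x m).det =
      B.det ^ 2 * (gram U D 1 a).det := by
    rw [covMatrix_inv hne, hX, gram_one_eq, Matrix.transpose_mul]
    have : Bᵀ * Uᵀ * (Matrix.diagonal fun j : Fin m => (a + D j)⁻¹) * (U * B) =
      Bᵀ * (Uᵀ * (Matrix.diagonal fun j : Fin m => (a + D j)⁻¹) * U) * B := by
      simp only [Matrix.mul_assoc]
    rw [this, Matrix.det_mul, Matrix.det_mul, Matrix.det_transpose]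
    ring
  have h2 : (covMatrix D m a).det = Real.exp (∑ j : Fin m, Real.log (a + D j)) := by
    rw [covMatrix, Matrix.det_diagonal, Real.exp_sum]
    exact Finset.prod_congr rfl fun j _ => (Real.exp_log (hpos j)).symm
  rw [residualLikelihood, dotProduct_projMatrix_mulVec hX hB hne hu, h1, h2,
    Real.mul_rpow hB2.le hdet.le, ← Real.exp_mul, Real.rpow_def_of_pos hdet, mul_assoc, mul_assoc,
    ← Real.exp_add, ← Real.exp_add, logLik]
  congr 2
  ring

end FayHerriot

/-! ### Existence, positivity and stationarity of the maximizer. -/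

namespace FayHerriot

variable {m p : ℕ}

/-- As a grows, log|V| contributes -(m/2) log(a + d), the determinant of the inverse Gram matrix at
most +(p/2) log(a + d), and the quadratic form stays bounded. Ratios (a + d')/(a + d) are absorbed
by d'/d. -/
theorem exists_logLik_le {U : Matrix (Fin m) (Fin p) ℝ} {D : ℕ → ℝ} {d d' : ℝ}
    (hU : Uᵀ * U = 1) (hd0 : 0 < d) (hd : ∀ j, d ≤ D j) (hd' : ∀ j, D j ≤ d') (y : Fin m → ℝ) :
    ∃ K : ℝ, ∀ a, 0 ≤ a → logLik U D y a ≤ K - ((m : ℝ) - p) / 2 * Real.log (a + d) := by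
  have hdd' : d ≤ d' := (hd 0).trans (hd' 0)
  set L : Fin p → ℝ := fun k => ∑ j, |U j k * y j| with hL
  have hL0 : ∀ k, 0 ≤ L k := fun k => Finset.sum_nonneg fun j _ => abs_nonneg _
  refine ⟨1 / 2 * Real.log (p.factorial) + p / 2 * Real.log (d' / d) +
    1 / 2 * ∑ k, L k / d * ∑ l, d' / d * L l, fun a ha => ?_⟩
  have had : 0 < a + d := by linarith
  have had' : 0 < a + d' := by linarith
  have hpos : ∀ j : Fin m, 0 < a + D j := fun j => by linarith [hd j]
  have hu := isUnit_det_gram hU hpos hd'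
  have hratio : (a + d') / (a + d) ≤ d' / d := by
    rw [div_le_div_iff₀ had hd0]
    nlinarith
  have h1 : -(1 / 2) * Real.log (gram U D 1 a).det ≤
      1 / 2 * Real.log p.factorial + p / 2 * (Real.log (d' / d) + Real.log (a + d)) := by
    have e1 : Real.log (gram U D 1 a)⁻¹.det = -Real.log (gram U D 1 a).det := by
      rw [Matrix.det_nonsing_inv, Ring.inverse_eq_inv', Real.log_inv]
    have e2 : |(gram U D 1 a)⁻¹.det| ≤ p.factorial * (a + d') ^ p := by
      have := Matrix.det_le (A := (gram U D 1 a)⁻¹) (abv := AbsoluteValue.abs)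
        fun k l => abs_inv_gram_le hU hpos hd' had' k l
      simpa using this
    have e3 : (gram U D 1 a)⁻¹.det ≠ 0 := by
      rw [Matrix.det_nonsing_inv, Ring.inverse_eq_inv']
      exact inv_ne_zero hu.ne_zero
    have e4 : Real.log (gram U D 1 a)⁻¹.det ≤ Real.log p.factorial + p * Real.log (a + d') := by
      rw [← Real.log_abs, ← Real.log_pow, ← Real.log_mul (by positivity) (by positivity)]
      exact Real.log_le_log (abs_pos.2 e3) e2
    have e5 : Real.log (a + d') ≤ Real.log (d' / d) + Real.log (a + d) := by
      rw [← Real.log_mul (div_pos (by linarith) hd0).ne' had.ne']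
      exact Real.log_le_log had' (by rwa [div_le_iff₀ had] at hratio)
    have e6 : (p : ℝ) * Real.log (a + d') ≤ p * (Real.log (d' / d) + Real.log (a + d)) := by
      gcongr
    linarith
  have h2 : (m : ℝ) * Real.log (a + d) ≤ ∑ j : Fin m, Real.log (a + D j) := by
    calc (m : ℝ) * Real.log (a + d) = ∑ j : Fin m, Real.log (a + d) := by simp
      _ ≤ _ := Finset.sum_le_sum fun j _ => Real.log_le_log had (by linarith [hd j])
  have h3 : 0 ≤ ∑ j : Fin m, y j ^ 2 / (a + D j) :=
    Finset.sum_nonneg fun j _ => div_nonneg (sq_nonneg _) (hpos j).le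
  have hb : ∀ k, |loading U D y 1 a k| ≤ L k / (a + d) := fun k => by
    simp only [loading, pow_one, hL, Finset.sum_div]
    refine (Finset.abs_sum_le_sum_abs _ _).trans (Finset.sum_le_sum fun j _ => ?_)
    rw [abs_div, abs_of_pos (hpos j)]
    gcongr
    exact hd j
  -- The inverse Gram matrix grows like a + d' while the loading decays like 1/(a + d); their
  -- product is bounded in a.
  have hg : ∀ k, |gls U D y a k| ≤ ∑ l, d' / d * L l := fun k => by
    simp only [gls, Matrix.mulVec, dotProduct]
    refine (Finset.abs_sum_le_sum_abs _ _).trans (Finset.sum_le_sum fun l _ => ?_)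
    rw [abs_mul]
    calc _ ≤ (a + d') * (L l / (a + d)) :=
          mul_le_mul (abs_inv_gram_le hU hpos hd' had' k l) (hb l) (abs_nonneg _) had'.le
      _ = (a + d') / (a + d) * L l := by ring
      _ ≤ _ := by gcongr
  have h4 : loading U D y 1 a ⬝ᵥ gls U D y a ≤ ∑ k, L k / d * ∑ l, d' / d * L l := by
    refine Finset.sum_le_sum fun k _ => (le_abs_self _).trans ?_
    rw [abs_mul]
    refine mul_le_mul ((hb k).trans ?_) (hg k) (abs_nonneg _) (div_nonneg (hL0 k) hd0.le)
    exact div_le_div_of_nonneg_left (hL0 k) hd0 (by linarith)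
  rw [logLik]
  have h5 : (p : ℝ) / 2 * (Real.log (d' / d) + Real.log (a + d)) =
      p / 2 * Real.log (d' / d) + p / 2 * Real.log (a + d) := by ring
  linarith

theorem AddFactor.eq_exp {Ladd : ℕ → ℝ → ℝ} (h : AddFactor Ladd) (hm : 1 ≤ m) {a : ℝ}
    (ha : 0 < a) : Ladd m a = Real.exp (Real.log (Ladd m a)) :=
  (Real.exp_log (h.pos m hm a ha)).symm

theorem AddFactor.differentiableAt {Ladd : ℕ → ℝ → ℝ} (h : AddFactor Ladd) (hm : 1 ≤ m) {a : ℝ}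
    (ha : 0 < a) : DifferentiableAt ℝ (fun b => Real.log (Ladd m b)) a :=
  ((h.contDiffOn m hm).differentiableOn (by norm_num)).differentiableAt (Ioi_mem_nhds ha)

theorem AddFactor.continuousOn {Ladd : ℕ → ℝ → ℝ} (h : AddFactor Ladd) (hm : 1 ≤ m) :
    ContinuousOn (Ladd m) (Set.Ici 0) := by
  intro a ha
  rcases (Set.mem_Ici.1 ha).eq_or_lt with rfl | ha
  · exact h.continuous_zero m hm
  · refine ContinuousAt.continuousWithinAt ?_
    refine (Real.continuous_exp.continuousAt.comp (h.differentiableAt hm ha).continuousAt).congr ?_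
    filter_upwards [Ioi_mem_nhds ha] with b hb
    exact (h.eq_exp hm hb).symm

section

variable {x : ℕ → Fin p → ℝ} {U : Matrix (Fin m) (Fin p) ℝ} {B : Matrix (Fin p) (Fin p) ℝ}
  {D : ℕ → ℝ} {d d' C : ℝ} {Ladd : ℕ → ℝ → ℝ} {i : ℕ}

/-- The objective vanishes at 0, because the additional factor does, but is positive at 1. -/
theorem adjustedArgmax_pos (hC : 0 < C) (hL : AddFactor Ladd) (hm : 1 ≤ m)
    (hX : (designMatrix x m).rank = p) (hd0 : 0 < d) (hd : ∀ j, d ≤ D j) (hd' : ∀ j, D j ≤ d')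
    (y : Fin m → ℝ) {a : ℝ} (ha : a ∈ adjustedArgmax x D C Ladd i m y) : 0 < a := by
  obtain ⟨U, B, hUB, hB, hU, -⟩ := exists_orthonormal_factor _ hX
  obtain ⟨c, hc, hres⟩ := exists_residualLikelihood_eq hUB hB hU (fun j => hd0.trans_le (hd j)) hd'
  obtain ⟨ha0, hmax⟩ := ha
  refine lt_of_le_of_ne ha0 fun h0 => ?_
  have h1 := hmax (show (1 : ℝ) ∈ Set.Ici 0 from Set.mem_Ici.2 zero_le_one)
  have h2 := hres 0 y 1 zero_le_one
  rw [Matrix.mulVec_zero, zero_add] at h2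
  simp only [Set.mem_ofPred_eq, ← h0, hL.zero m hm, mul_zero, zero_mul, h2] at h1
  have h3 : 0 < 1 + D i := by linarith [hd i]
  have h4 := hL.pos m hm 1 one_pos
  have : 0 < C * (1 + D i) ^ 2 * Ladd m 1 * (c * Real.exp (logLik U D y 1)) := by positivity
  linarith

theorem adjustedArgmax_nonempty (hC : 0 < C) (hL : AddFactor Ladd) (hm : p + 4 < m)
    (hX : (designMatrix x m).rank = p) (hd0 : 0 < d) (hd : ∀ j, d ≤ D j) (hd' : ∀ j, D j ≤ d')
    (y : Fin m → ℝ) : (adjustedArgmax x D C Ladd i m y).Nonempty := by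
  have hm1 : 1 ≤ m := by omega
  obtain ⟨U, B, hUB, hB, hU, -⟩ := exists_orthonormal_factor _ hX
  obtain ⟨c, hc, hres'⟩ := exists_residualLikelihood_eq hUB hB hU (fun j => hd0.trans_le (hd j)) hd'
  have hres : ∀ a, 0 ≤ a → residualLikelihood x D m y a = c * Real.exp (logLik U D y a) :=
    fun a ha => by
      have := hres' 0 y a ha
      rwa [Matrix.mulVec_zero, zero_add] at this
  obtain ⟨K, hK⟩ := exists_logLik_le hU hd0 hd hd' y
  obtain ⟨C', hC', hLC⟩ := hL.bounded
  set f : ℝ → ℝ := fun b => C * (b + D i) ^ 2 * Ladd m b * residualLikelihood x D m y b with hf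
  have hcont : ContinuousOn f (Set.Ici 0) := by
    have h1 : ContinuousOn (fun b => C * (b + D i) ^ 2 * Ladd m b *
        (c * Real.exp (logLik U D y b))) (Set.Ici 0) := by
      refine ((Continuous.continuousOn (by fun_prop)).mul (hL.continuousOn hm1)).mul
        (continuousOn_const.mul (Real.continuous_exp.comp_continuousOn fun a ha => ?_))
      exact (hasDerivAt_logLik hU (fun j => by
        linarith [hd j, Set.mem_Ici.1 ha]) hd').continuousAt.continuousWithinAt
    exact h1.congr fun b hb => by simp only [hf, hres b hb]
  have hf1 : 0 < f 1 := by
    have h3 : 0 < 1 + D i := by linarith [hd i]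
    have h4 := hL.pos m hm1 1 one_pos
    simp only [hf, hres 1 zero_le_one]
    positivity
  -- The decay exponent: (m - p)/2 from the likelihood less 2 from the factor (a + D_i)². Positivity
  -- is exactly m > p + 4.
  set γ : ℝ := ((m : ℝ) - p) / 2 - 2 with hγ
  have hγ0 : 0 < γ := by
    have : (p : ℝ) + 4 < m := by exact_mod_cast hm
    rw [hγ]
    linarith
  have hbound : ∀ a, 0 < a → f a ≤
      C * (d' / d) ^ 2 * C' * c * Real.exp (K + -γ * Real.log (a + d)) := fun a ha => by
    have had : 0 < a + d := by linarith
    have hDi : 0 < a + D i := by linarith [hd i]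
    have h1 : a + D i ≤ d' / d * (a + d) := by
      have := hd' i
      have h2 := (hd i).trans this
      rw [div_mul_eq_mul_div, le_div_iff₀ hd0]
      nlinarith
    have hd'0 : 0 ≤ d' / d := by
      have := (hd i).trans (hd' i)
      exact div_nonneg (by linarith) hd0.le
    simp only [hf, hres a ha.le]
    calc C * (a + D i) ^ 2 * Ladd m a * (c * Real.exp (logLik U D y a))
        ≤ C * (d' / d * (a + d)) ^ 2 * C' *
          (c * Real.exp (K - ((m : ℝ) - p) / 2 * Real.log (a + d))) := by
          gcongr
          · exact (hL.pos m hm1 a ha).le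
          · exact (hLC m hm1 a ha).le
          · exact hK a ha.le
      _ = C * (d' / d) ^ 2 * C' * c * (Real.exp (2 * Real.log (a + d)) *
          Real.exp (K - ((m : ℝ) - p) / 2 * Real.log (a + d))) := by
          rw [two_mul, Real.exp_add, Real.exp_log had]
          ring
      _ = _ := by
          rw [← Real.exp_add, hγ]
          congr 2
          ring
  have hlim : Tendsto (fun a => C * (d' / d) ^ 2 * C' * c *
      Real.exp (K + -γ * Real.log (a + d))) atTop (𝓝 0) := by
    have h1 : Tendsto (fun a : ℝ => Real.log (a + d)) atTop atTop :=
      Real.tendsto_log_atTop.comp (tendsto_atTop_add_const_right _ d tendsto_id)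
    have h2 : Tendsto (fun a : ℝ => K + -γ * Real.log (a + d)) atTop atBot :=
      tendsto_atBot_add_const_left _ K (h1.const_mul_atTop_of_neg (neg_neg_of_pos hγ0))
    simpa using (Real.tendsto_exp_atBot.comp h2).const_mul (C * (d' / d) ^ 2 * C' * c)
  obtain ⟨a, ha, hmax⟩ := hcont.exists_isMaxOn' isClosed_Ici
    (show (1 : ℝ) ∈ Set.Ici 0 from Set.mem_Ici.2 zero_le_one) (by
      rw [eventually_inf_principal, cocompact_eq_atBot_atTop, eventually_sup]
      refine ⟨?_, ?_⟩
      · filter_upwards [eventually_lt_atBot 0] with b hb hb'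
        exact absurd hb (not_lt.2 hb')
      · filter_upwards [hlim.eventually_le_const hf1, eventually_gt_atTop 0] with b hb hb0 _
        exact (hbound b hb0).trans hb)
  exact ⟨a, ha, hmax⟩

/-- Fermat's rule applied to the logarithm of the objective at an interior maximizer. -/
theorem adjustedArgmax_stationary (hC : 0 < C) (hL : AddFactor Ladd) (hm : 1 ≤ m)
    (hX : designMatrix x m = U * B) (hB : IsUnit B.det) (hU : Uᵀ * U = 1)
    (hd0 : 0 < d) (hd : ∀ j, d ≤ D j) (hd' : ∀ j, D j ≤ d') (β : Fin p → ℝ) (ε : Fin m → ℝ)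
    {a : ℝ} (ha0 : 0 < a)
    (ha : a ∈ adjustedArgmax x D C Ladd i m (designMatrix x m *ᵥ β + ε)) :
    2 / (a + D i) + deriv (fun b => Real.log (Ladd m b)) a +
      (1 / 2 * ∑ j, ε j ^ 2 / (a + D j) ^ 2 - 1 / 2 * ∑ j : Fin m, (a + D j)⁻¹ +
        scoreCorrection U D ε a) = 0 := by
  have hD : ∀ j, 0 < D j := fun j => hd0.trans_le (hd j)
  obtain ⟨c, hc, hres⟩ := exists_residualLikelihood_eq hX hB hU hD hd'
  have hderiv : HasDerivAt (fun b => 2 * Real.log (b + D i) + Real.log (Ladd m b) +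
      logLik U D ε b) (2 / (a + D i) + deriv (fun b => Real.log (Ladd m b)) a +
      (1 / 2 * ∑ j, ε j ^ 2 / (a + D j) ^ 2 - 1 / 2 * ∑ j : Fin m, (a + D j)⁻¹ +
        scoreCorrection U D ε a)) a := by
    refine HasDerivAt.add (HasDerivAt.add ?_ (hL.differentiableAt hm ha0).hasDerivAt)
      (hasDerivAt_logLik hU (fun j => by linarith [hD j]) hd')
    have := (((hasDerivAt_id a).add_const (D i)).log
      (by simp only [id]; linarith [hD i])).const_mul 2
    refine this.congr_deriv ?_
    simp [div_eq_mul_inv]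
  refine IsLocalMax.hasDerivAt_eq_zero ?_ hderiv
  have hform : ∀ b, 0 < b → C * (b + D i) ^ 2 * Ladd m b *
      residualLikelihood x D m (designMatrix x m *ᵥ β + ε) b = C * c *
      Real.exp (2 * Real.log (b + D i) + Real.log (Ladd m b) + logLik U D ε b) := fun b hb => by
    have hbi : 0 < b + D i := by linarith [hD i]
    rw [hres β ε b hb.le, Real.exp_add, Real.exp_add, ← hL.eq_exp hm hb, two_mul, Real.exp_add,
      Real.exp_log hbi]
    ring
  filter_upwards [Ioi_mem_nhds ha0] with b hb
  have h1 := ha.2 (show b ∈ Set.Ici 0 from Set.mem_Ici.2 (le_of_lt hb))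
  simp only [Set.mem_ofPred_eq] at h1
  rw [hform b hb, hform a ha0] at h1
  exact Real.exp_le_exp.1 (le_of_mul_le_mul_left h1 (by positivity))

end

end FayHerriot

/-! ### Deterministic perturbation bounds for the score correction. -/

namespace FayHerriot

variable {m p : ℕ}

theorem abs_sum_mul_le {x y : Fin p → ℝ} {X Y : ℝ} (hX : ∀ k, |x k| ≤ X) (hY : ∀ k, |y k| ≤ Y) :
    |∑ k, x k * y k| ≤ p * (X * Y) := by
  calc |∑ k, x k * y k| ≤ ∑ k, |x k * y k| := Finset.abs_sum_le_sum_abs _ _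
    _ ≤ ∑ _k : Fin p, X * Y := Finset.sum_le_sum fun k _ => by
        rw [abs_mul]
        exact mul_le_mul (hX k) (hY k) (abs_nonneg _) ((abs_nonneg _).trans (hX k))
    _ = p * (X * Y) := by simp

theorem abs_sum_mul_sub_sum_mul_le {x y x₀ y₀ : Fin p → ℝ} {X Y α γ : ℝ}
    (hα : ∀ k, |x k - x₀ k| ≤ α) (hY : ∀ k, |y k| ≤ Y) (hX : ∀ k, |x₀ k| ≤ X)
    (hγ : ∀ k, |y k - y₀ k| ≤ γ) :
    |∑ k, x k * y k - ∑ k, x₀ k * y₀ k| ≤ p * (α * Y) + p * (X * γ) := by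
  have h : ∑ k, x k * y k - ∑ k, x₀ k * y₀ k =
      ∑ k, (x k - x₀ k) * y k + ∑ k, x₀ k * (y k - y₀ k) := by
    rw [← Finset.sum_sub_distrib, ← Finset.sum_add_distrib]
    exact Finset.sum_congr rfl fun k _ => by ring
  rw [h]
  exact (abs_add_le _ _).trans (add_le_add (abs_sum_mul_le hα hY) (abs_sum_mul_le hX hγ))

theorem abs_sum_le_card_mul {x : Fin p → ℝ} {X : ℝ} (hX : ∀ k, |x k| ≤ X) :
    |∑ k, x k| ≤ p * X := by
  simpa using abs_sum_mul_le hX (y := fun _ => 1) (Y := 1) (by simp)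

theorem abs_quadratic_le {H G : Matrix (Fin p) (Fin p) ℝ} {b b₂ : Fin p → ℝ} {s κ E : ℝ}
    (hs : 0 < s) (hH : ∀ k l, |H k l| ≤ 2 * s) (hG : ∀ k l, |G k l| ≤ κ / s ^ 2)
    (hb : ∀ k, |b k| ≤ E / s) (hb₂ : ∀ k, |b₂ k| ≤ E / s ^ 2) :
    s ^ 2 * |1 / 2 * (H * G).trace - b₂ ⬝ᵥ (H *ᵥ b) + 1 / 2 * ((H *ᵥ b) ⬝ᵥ G *ᵥ (H *ᵥ b))| ≤
      p ^ 2 * κ * s + (2 * p ^ 2 + 2 * p ^ 4 * κ) * E ^ 2 := by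
  have h1 : |(H * G).trace| ≤ p * (p * (2 * s * (κ / s ^ 2))) :=
    abs_sum_le_card_mul fun k => abs_sum_mul_le (fun l => hH k l) fun l => hG l k
  have hh : ∀ k, |(H *ᵥ b) k| ≤ p * (2 * s * (E / s)) := fun k =>
    abs_sum_mul_le (fun l => hH k l) hb
  have h2 : |b₂ ⬝ᵥ (H *ᵥ b)| ≤ p * (E / s ^ 2 * (p * (2 * s * (E / s)))) :=
    abs_sum_mul_le hb₂ hh
  have h3 : |(H *ᵥ b) ⬝ᵥ G *ᵥ (H *ᵥ b)| ≤
      p * (p * (2 * s * (E / s)) * (p * (κ / s ^ 2 * (p * (2 * s * (E / s)))))) :=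
    abs_sum_mul_le hh fun k => abs_sum_mul_le (fun l => hG k l) hh
  have h4 : |1 / 2 * (H * G).trace - b₂ ⬝ᵥ (H *ᵥ b) + 1 / 2 * ((H *ᵥ b) ⬝ᵥ G *ᵥ (H *ᵥ b))| ≤
      1 / 2 * (p * (p * (2 * s * (κ / s ^ 2)))) + p * (E / s ^ 2 * (p * (2 * s * (E / s)))) +
      1 / 2 * (p * (p * (2 * s * (E / s)) * (p * (κ / s ^ 2 * (p * (2 * s * (E / s))))))) := by
    rw [abs_le] at h1 h2 h3 ⊢
    constructor <;> linarith
  calc _ ≤ s ^ 2 * _ := mul_le_mul_of_nonneg_left h4 (sq_nonneg s)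
    _ = _ := by field_simp; ring

/-- Products are telescoped one factor at a time, and the inverse is compared through the resolvent
identity. There the growth 2s of H cancels the decay 1/s of F - F₀, so Γ does not depend on s. -/
theorem exists_abs_quadratic_sub_le (p : ℕ) {κ : ℝ} (hκ : 0 ≤ κ) :
    ∃ Γ : ℝ, 0 ≤ Γ ∧ ∀ {H H₀ G G₀ F F₀ : Matrix (Fin p) (Fin p) ℝ} {b b₀ b₂ b₂₀ : Fin p → ℝ}
      {s δ E : ℝ}, 0 < s → 0 ≤ δ → 0 ≤ E → H - H₀ = -(H * (F - F₀) * H₀) →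
      (∀ k l, |H k l| ≤ 2 * s) → (∀ k l, |H₀ k l| ≤ κ) → (∀ k, |b k| ≤ E / s) →
      (∀ k, |b k| ≤ κ * E) → (∀ k, |b₀ k| ≤ κ * E) → (∀ k, |b₂₀ k| ≤ κ * E) →
      (∀ k l, |G k l| ≤ κ) → (∀ k l, |G₀ k l| ≤ κ) →
      (∀ k l, |F k l - F₀ k l| ≤ δ * κ / s) → (∀ k l, |G k l - G₀ k l| ≤ δ * κ) →
      (∀ k, |b k - b₀ k| ≤ δ * κ * E) → (∀ k, |b₂ k - b₂₀ k| ≤ δ * κ * E) →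
      |(1 / 2 * (H * G).trace - b₂ ⬝ᵥ (H *ᵥ b) + 1 / 2 * ((H *ᵥ b) ⬝ᵥ G *ᵥ (H *ᵥ b))) -
        (1 / 2 * (H₀ * G₀).trace - b₂₀ ⬝ᵥ (H₀ *ᵥ b₀) +
          1 / 2 * ((H₀ *ᵥ b₀) ⬝ᵥ G₀ *ᵥ (H₀ *ᵥ b₀)))| ≤ Γ * (1 + E ^ 2) * δ := by
  set lam : ℝ := p * (2 * p ^ 2 * κ ^ 2 * κ) + p * (κ * κ) with hlam
  have hlam0 : 0 ≤ lam := by positivity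
  set c₁ : ℝ := 1 / 2 * (p * (p * (2 * p ^ 2 * κ ^ 2 * κ) + p * (κ * κ))) with hc₁
  set c₂ : ℝ := (p * (κ * (2 * p)) + p * (κ * lam)) +
    1 / 2 * (p * (lam * (p * (κ * (2 * p)))) +
      p * (p * (κ * κ) * (p * (κ * (2 * p)) + p * (κ * lam)))) with hc₂
  have hc₁0 : 0 ≤ c₁ := by positivity
  have hc₂0 : 0 ≤ c₂ := by positivity
  refine ⟨c₁ + c₂, by positivity, ?_⟩
  intro H H₀ G G₀ F F₀ b b₀ b₂ b₂₀ s δ E hs hδ hE hres hH hH₀ hbs hb hb₀ hb₂₀ hG hG₀ hF hdG hdb hdb₂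
  have hdH : ∀ k l, |H k l - H₀ k l| ≤ 2 * p ^ 2 * κ ^ 2 * δ := fun k l => by
    have h1 : H k l - H₀ k l = -(H * (F - F₀) * H₀) k l := by
      rw [← Matrix.sub_apply, hres, Matrix.neg_apply]
    rw [h1, abs_neg]
    have h2 : |(H * (F - F₀) * H₀) k l| ≤ p * (p * (2 * s * (δ * κ / s)) * κ) :=
      abs_sum_mul_le (fun n => abs_sum_mul_le (fun q => hH k q) fun q => hF q n) fun n => hH₀ n l
    refine h2.trans (le_of_eq ?_)
    field_simp
  have hh : ∀ k, |(H *ᵥ b) k| ≤ 2 * p * E := fun k => by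
    have : |(H *ᵥ b) k| ≤ p * (2 * s * (E / s)) := abs_sum_mul_le (fun l => hH k l) hbs
    refine this.trans (le_of_eq ?_)
    field_simp
  have hh₀ : ∀ k, |(H₀ *ᵥ b₀) k| ≤ p * (κ * (κ * E)) := fun k =>
    abs_sum_mul_le (fun l => hH₀ k l) hb₀
  have hdh : ∀ k, |(H *ᵥ b) k - (H₀ *ᵥ b₀) k| ≤ lam * δ * E := fun k => by
    have : |(H *ᵥ b) k - (H₀ *ᵥ b₀) k| ≤
        p * (2 * p ^ 2 * κ ^ 2 * δ * (κ * E)) + p * (κ * (δ * κ * E)) :=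
      abs_sum_mul_sub_sum_mul_le (fun l => hdH k l) hb (fun l => hH₀ k l) hdb
    refine this.trans (le_of_eq ?_)
    rw [hlam]
    ring
  have h1 : |(H * G).trace - (H₀ * G₀).trace| ≤
      p * (p * (2 * p ^ 2 * κ ^ 2 * δ * κ) + p * (κ * (δ * κ))) := by
    simp only [Matrix.trace, Matrix.diag_apply, ← Finset.sum_sub_distrib]
    exact abs_sum_le_card_mul fun k => abs_sum_mul_sub_sum_mul_le (fun l => hdH k l)
      (fun l => hG l k) (fun l => hH₀ k l) fun l => hdG l k
  have h2 : |b₂ ⬝ᵥ (H *ᵥ b) - b₂₀ ⬝ᵥ (H₀ *ᵥ b₀)| ≤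
      p * (δ * κ * E * (2 * p * E)) + p * (κ * E * (lam * δ * E)) :=
    abs_sum_mul_sub_sum_mul_le hdb₂ hh hb₂₀ hdh
  have hw : ∀ k, |(G *ᵥ (H *ᵥ b)) k| ≤ p * (κ * (2 * p * E)) := fun k =>
    abs_sum_mul_le (fun l => hG k l) hh
  have hdw : ∀ k, |(G *ᵥ (H *ᵥ b)) k - (G₀ *ᵥ (H₀ *ᵥ b₀)) k| ≤
      p * (δ * κ * (2 * p * E)) + p * (κ * (lam * δ * E)) := fun k =>
    abs_sum_mul_sub_sum_mul_le (fun l => hdG k l) hh (fun l => hG₀ k l) hdh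
  have h3 : |(H *ᵥ b) ⬝ᵥ G *ᵥ (H *ᵥ b) - (H₀ *ᵥ b₀) ⬝ᵥ G₀ *ᵥ (H₀ *ᵥ b₀)| ≤
      p * (lam * δ * E * (p * (κ * (2 * p * E)))) +
      p * (p * (κ * (κ * E)) * (p * (δ * κ * (2 * p * E)) + p * (κ * (lam * δ * E)))) :=
    abs_sum_mul_sub_sum_mul_le hdh hw hh₀ hdw
  have h4 : |(1 / 2 * (H * G).trace - b₂ ⬝ᵥ (H *ᵥ b) + 1 / 2 * ((H *ᵥ b) ⬝ᵥ G *ᵥ (H *ᵥ b))) -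
        (1 / 2 * (H₀ * G₀).trace - b₂₀ ⬝ᵥ (H₀ *ᵥ b₀) +
          1 / 2 * ((H₀ *ᵥ b₀) ⬝ᵥ G₀ *ᵥ (H₀ *ᵥ b₀)))| ≤ δ * (c₁ + c₂ * E ^ 2) := by
    have h5 : δ * (c₁ + c₂ * E ^ 2) =
      1 / 2 * (p * (p * (2 * p ^ 2 * κ ^ 2 * δ * κ) + p * (κ * (δ * κ)))) +
      (p * (δ * κ * E * (2 * p * E)) + p * (κ * E * (lam * δ * E))) +
      1 / 2 * (p * (lam * δ * E * (p * (κ * (2 * p * E)))) +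
      p * (p * (κ * (κ * E)) * (p * (δ * κ * (2 * p * E)) + p * (κ * (lam * δ * E))))) := by
      rw [hc₁, hc₂]
      ring
    rw [h5, abs_le]
    rw [abs_le] at h1 h2 h3
    constructor <;> linarith
  refine h4.trans ?_
  have h6 : (c₁ + c₂) * (1 + E ^ 2) * δ = δ * (c₁ + c₂ * E ^ 2) + δ * (c₁ * E ^ 2 + c₂) := by ring
  rw [h6]
  exact le_add_of_nonneg_right (by positivity)

/-- The signed distance from `D j` to the midpoint of `[d, d']`, relative to the midpoint. -/
def relPos (d d' : ℝ) (D : ℕ → ℝ) (j : ℕ) : ℝ :=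
  ((d + d') / 2 - D j) / ((d + d') / 2)

section

variable {U : Matrix (Fin m) (Fin p) ℝ} {D : ℕ → ℝ} {a d d' : ℝ}

theorem abs_relPos_le (hd0 : 0 < d) (hd : ∀ j, d ≤ D j) (hd' : ∀ j, D j ≤ d') (j : ℕ) :
    |relPos d d' D j| ≤ (d' - d) / (d' + d) := by
  have h1 := hd j
  have h2 := hd' j
  have hc : 0 < (d + d') / 2 := by linarith
  rw [relPos, abs_div, abs_of_pos hc, div_le_div_iff₀ hc (by linarith)]
  have h3 : |(d + d') / 2 - D j| ≤ (d' - d) / 2 := by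
    rw [abs_le]
    constructor <;> linarith
  calc _ ≤ (d' - d) / 2 * (d' + d) := by
        gcongr
        linarith
    _ = _ := by ring

theorem theta_nonneg (hd0 : 0 < d) (hdd' : d ≤ d') : 0 ≤ (d' - d) / (d' + d) :=
  div_nonneg (by linarith) (by linarith)

theorem theta_lt_one (hd0 : 0 < d) (hdd' : d ≤ d') : (d' - d) / (d' + d) < 1 := by
  rw [div_lt_one (by linarith)]
  linarith

/-- The bound `seriesBound` with the parameters that belong to the variances `D j ∈ [d, d']`. -/
def unifBound (d d' : ℝ) (D : ℕ → ℝ) (X : Fin m → ℝ) : ℝ :=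
  seriesBound ((d' - d) / (d' + d)) (fun j : Fin m => relPos d d' D j) X

theorem unifBound_nonneg (hd0 : 0 < d) (hdd' : d ≤ d') (X : Fin m → ℝ) :
    0 ≤ unifBound d d' D X :=
  seriesBound_nonneg (theta_nonneg hd0 hdd')

/-- This is the substitution t = c/(a + c), c the midpoint of [d, d'], which maps a in [0, ∞) into
(0, 1] and keeps |t η_j| ≤ θ < 1. -/
theorem add_eq_mul_one_sub (hd0 : 0 < d) (hdd' : d ≤ d') (ha : 0 ≤ a) (j : ℕ) :
    a + D j = (a + (d + d') / 2) *
      (1 - (d + d') / 2 / (a + (d + d') / 2) * relPos d d' D j) := by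
  have hc : 0 < (d + d') / 2 := by linarith
  have hs : 0 < a + (d + d') / 2 := by linarith
  rw [relPos]
  generalize (d + d') / 2 = c at hc hs
  field_simp
  ring

theorem abs_sum_div_add_le (hd0 : 0 < d) (hd : ∀ j, d ≤ D j) (hd' : ∀ j, D j ≤ d') (ha : 0 ≤ a)
    (X : Fin m → ℝ) :
    |∑ j, X j / (a + D j)| ≤ unifBound d d' D X / (a + (d + d') / 2) := by
  have hdd' := (hd 0).trans (hd' 0)
  have hc : 0 < (d + d') / 2 := by linarith
  have hs : 0 < a + (d + d') / 2 := by linarith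
  have h := abs_sum_div_le (X := X) (theta_nonneg hd0 hdd') (theta_lt_one hd0 hdd')
    (fun j : Fin m => abs_relPos_le hd0 hd hd' j) (t := (d + d') / 2 / (a + (d + d') / 2))
    (by positivity) (by rw [div_le_one hs]; linarith)
  rw [le_div_iff₀ hs]
  refine le_trans (le_of_eq ?_) h
  have habs : ∀ S t : ℝ, 0 < t → |S| * t = |S * t| := fun S t ht => by
    rw [abs_mul, abs_of_pos ht]
  rw [habs _ _ (by positivity), Finset.sum_mul]
  congr 1
  refine Finset.sum_congr rfl fun j _ => ?_
  rw [add_eq_mul_one_sub hd0 hdd' ha (D := D) j]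
  generalize 1 - (d + d') / 2 / (a + (d + d') / 2) * relPos d d' D j = w
  generalize a + (d + d') / 2 = s at hs
  field_simp

theorem abs_sum_div_add_sq_le (hd0 : 0 < d) (hd : ∀ j, d ≤ D j) (hd' : ∀ j, D j ≤ d')
    (ha : 0 ≤ a) (X : Fin m → ℝ) :
    |∑ j, X j / (a + D j) ^ 2| ≤ unifBound d d' D X / (a + (d + d') / 2) ^ 2 := by
  have hdd' := (hd 0).trans (hd' 0)
  have hc : 0 < (d + d') / 2 := by linarith
  have hs : 0 < a + (d + d') / 2 := by linarith
  have hs2 : 0 < (a + (d + d') / 2) ^ 2 := by positivity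
  have h := abs_sum_div_sq_le (X := X) (theta_nonneg hd0 hdd') (theta_lt_one hd0 hdd')
    (fun j : Fin m => abs_relPos_le hd0 hd hd' j) (t := (d + d') / 2 / (a + (d + d') / 2))
    (by positivity) (by rw [div_le_one hs]; linarith)
  rw [le_div_iff₀ hs2]
  refine le_trans (le_of_eq ?_) h
  have habs : ∀ S t : ℝ, 0 < t → |S| * t = |S * t| := fun S t ht => by
    rw [abs_mul, abs_of_pos ht]
  rw [habs _ _ (by positivity), Finset.sum_mul]
  congr 1
  refine Finset.sum_congr rfl fun j _ => ?_
  rw [add_eq_mul_one_sub hd0 hdd' ha (D := D) j]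
  generalize 1 - (d + d') / 2 / (a + (d + d') / 2) * relPos d d' D j = w
  generalize a + (d + d') / 2 = s at hs
  field_simp

/-- A bound, uniform in `a ≥ 0`, for the vectors `loading U D ε n a`, `n = 1, 2`, and their
difference quotients at `A`. -/
def loadingBound (d d' : ℝ) (U : Matrix (Fin m) (Fin p) ℝ) (D : ℕ → ℝ) (A : ℝ) (ε : Fin m → ℝ) :
    ℝ :=
  ∑ k, (unifBound d d' D (fun j => U j k * ε j) +
    unifBound d d' D (fun j => U j k * (A + D j)⁻¹ * ε j) +
    unifBound d d' D (fun j => U j k * ((A + D j) ^ 2)⁻¹ * ε j))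

theorem sum_abs_mul_le_one (hU : Uᵀ * U = 1) (k l : Fin p) : ∑ j, |U j k * U j l| ≤ 1 := by
  have h : ∀ k, ∑ j, U j k ^ 2 = 1 := fun k => by
    have := congrFun (congrFun hU k) k
    simpa [Matrix.mul_apply, ← sq] using this
  calc ∑ j, |U j k * U j l| ≤ ∑ j, (1 / 2 * U j k ^ 2 + 1 / 2 * U j l ^ 2) := by
        refine Finset.sum_le_sum fun j _ => ?_
        rw [abs_mul, ← sq_abs (U j k), ← sq_abs (U j l)]
        nlinarith [sq_nonneg (|U j k| - |U j l|)]
    _ = 1 := by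
        rw [Finset.sum_add_distrib, ← Finset.mul_sum, ← Finset.mul_sum, h, h]
        norm_num

/-- The columns of U are unit vectors, so by Cauchy–Schwarz the weights U_jk U_jl have total mass at
most 1. Gram entries are thus bounded independently of m. -/
theorem abs_sum_mul_mul_le (hU : Uᵀ * U = 1) (k l : Fin p) {f : Fin m → ℝ} {K : ℝ}
    (hf : ∀ j, |f j| ≤ K) : |∑ j, U j k * U j l * f j| ≤ K := by
  -- With no rows U'U = 1 cannot hold, as an index k exists; a row is needed to see that K ≥ 0.
  rcases isEmpty_or_nonempty (Fin m) with hm | ⟨⟨j₀⟩⟩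
  · have h := congrFun (congrFun hU k) k
    simp [Matrix.mul_apply] at h
  have hK : 0 ≤ K := (abs_nonneg _).trans (hf j₀)
  calc |∑ j, U j k * U j l * f j| ≤ ∑ j, |U j k * U j l| * K := by
        refine (Finset.abs_sum_le_sum_abs _ _).trans (Finset.sum_le_sum fun j _ => ?_)
        rw [abs_mul]
        gcongr
        exact hf j
    _ = (∑ j, |U j k * U j l|) * K := by rw [Finset.sum_mul]
    _ ≤ 1 * K := by
        gcongr
        exact sum_abs_mul_le_one hU k l
    _ = K := one_mul K

theorem inv_sub_inv_eq {x v δ : ℝ} (hx : x ≠ 0) (hv : v ≠ 0) (h : x = v + δ) :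
    x⁻¹ - v⁻¹ = -δ * (v⁻¹ / x) := by
  subst h
  field_simp
  ring

theorem inv_sq_sub_inv_sq_eq {x v δ : ℝ} (hx : x ≠ 0) (hv : v ≠ 0) (h : x = v + δ) :
    (x ^ 2)⁻¹ - (v ^ 2)⁻¹ = -δ * ((v ^ 2)⁻¹ / x + v⁻¹ / x ^ 2) := by
  subst h
  field_simp
  ring

end

end FayHerriot

/-! ### Size and increments of loadings and Gram matrices, and the score correction. -/

namespace FayHerriot

variable {m p : ℕ}

section

variable {U : Matrix (Fin m) (Fin p) ℝ} {D : ℕ → ℝ} {ε : Fin m → ℝ} {a d d' A : ℝ}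

theorem unifBound_le_loadingBound (hd0 : 0 < d) (hdd' : d ≤ d') (k : Fin p) :
    unifBound d d' D (fun j => U j k * ε j) +
    unifBound d d' D (fun j => U j k * (A + D j)⁻¹ * ε j) +
    unifBound d d' D (fun j => U j k * ((A + D j) ^ 2)⁻¹ * ε j) ≤ loadingBound d d' U D A ε :=
  Finset.single_le_sum (f := fun k => unifBound d d' D (fun j => U j k * ε j) +
    unifBound d d' D (fun j => U j k * (A + D j)⁻¹ * ε j) +
    unifBound d d' D (fun j => U j k * ((A + D j) ^ 2)⁻¹ * ε j))
    (fun _ _ => add_nonneg (add_nonneg (unifBound_nonneg hd0 hdd' _)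
      (unifBound_nonneg hd0 hdd' _)) (unifBound_nonneg hd0 hdd' _)) (Finset.mem_univ k)

theorem loadingBound_nonneg (hd0 : 0 < d) (hdd' : d ≤ d') : 0 ≤ loadingBound d d' U D A ε :=
  Finset.sum_nonneg fun _ _ => add_nonneg (add_nonneg (unifBound_nonneg hd0 hdd' _)
      (unifBound_nonneg hd0 hdd' _)) (unifBound_nonneg hd0 hdd' _)

theorem abs_loading_one_le (hd0 : 0 < d) (hd : ∀ j, d ≤ D j) (hd' : ∀ j, D j ≤ d') (ha : 0 ≤ a)
    (k : Fin p) :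
    |loading U D ε 1 a k| ≤ loadingBound d d' U D A ε / (a + (d + d') / 2) := by
  have hdd' := (hd 0).trans (hd' 0)
  have hs : 0 < a + (d + d') / 2 := by linarith
  have h := abs_sum_div_add_le hd0 hd hd' ha fun j => U j k * ε j
  simp only [loading, pow_one]
  refine h.trans ?_
  gcongr
  linarith [unifBound_le_loadingBound (U := U) (D := D) (ε := ε) (A := A) hd0 hdd' k,
    unifBound_nonneg hd0 hdd' (D := D) fun j => U j k * (A + D j)⁻¹ * ε j,
    unifBound_nonneg hd0 hdd' (D := D) fun j => U j k * ((A + D j) ^ 2)⁻¹ * ε j]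

theorem abs_loading_two_le (hd0 : 0 < d) (hd : ∀ j, d ≤ D j) (hd' : ∀ j, D j ≤ d') (ha : 0 ≤ a)
    (k : Fin p) :
    |loading U D ε 2 a k| ≤ loadingBound d d' U D A ε / (a + (d + d') / 2) ^ 2 := by
  have hdd' := (hd 0).trans (hd' 0)
  have hs : 0 < a + (d + d') / 2 := by linarith
  have h := abs_sum_div_add_sq_le hd0 hd hd' ha fun j => U j k * ε j
  simp only [loading]
  refine h.trans ?_
  gcongr
  linarith [unifBound_le_loadingBound (U := U) (D := D) (ε := ε) (A := A) hd0 hdd' k,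
    unifBound_nonneg hd0 hdd' (D := D) fun j => U j k * (A + D j)⁻¹ * ε j,
    unifBound_nonneg hd0 hdd' (D := D) fun j => U j k * ((A + D j) ^ 2)⁻¹ * ε j]

theorem abs_loading_one_sub_le (hd0 : 0 < d) (hd : ∀ j, d ≤ D j) (hd' : ∀ j, D j ≤ d')
    (ha : 0 ≤ a) (hA : 0 ≤ A) (k : Fin p) :
    |loading U D ε 1 a k - loading U D ε 1 A k| ≤
      |a - A| * (loadingBound d d' U D A ε / (a + (d + d') / 2)) := by
  have hdd' := (hd 0).trans (hd' 0)
  have hs : 0 < a + (d + d') / 2 := by linarith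
  -- The increment is again a rational sum in a, with the extra fixed weight (A + D_j)⁻¹; the
  -- weighted terms of `loadingBound` are there for this.
  have h1 : loading U D ε 1 a k - loading U D ε 1 A k =
      -(a - A) * ∑ j, U j k * (A + D j)⁻¹ * ε j / (a + D j) := by
    simp only [loading, pow_one, ← Finset.sum_sub_distrib, Finset.mul_sum]
    refine Finset.sum_congr rfl fun j _ => ?_
    have := inv_sub_inv_eq (x := a + D j) (v := A + D j) (δ := a - A)
      (by linarith [hd j]) (by linarith [hd j]) (by ring)
    rw [div_eq_mul_inv, div_eq_mul_inv, ← mul_sub, this]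
    ring
  rw [h1, abs_mul, abs_neg]
  gcongr
  refine (abs_sum_div_add_le hd0 hd hd' ha _).trans ?_
  gcongr
  linarith [unifBound_le_loadingBound (U := U) (D := D) (ε := ε) (A := A) hd0 hdd' k,
    unifBound_nonneg hd0 hdd' (D := D) fun j => U j k * ε j,
    unifBound_nonneg hd0 hdd' (D := D) fun j => U j k * ((A + D j) ^ 2)⁻¹ * ε j]

theorem abs_loading_two_sub_le (hd0 : 0 < d) (hd : ∀ j, d ≤ D j) (hd' : ∀ j, D j ≤ d')
    (ha : 0 ≤ a) (hA : 0 ≤ A) (k : Fin p) :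
    |loading U D ε 2 a k - loading U D ε 2 A k| ≤
      |a - A| * (loadingBound d d' U D A ε / (a + (d + d') / 2) +
        loadingBound d d' U D A ε / (a + (d + d') / 2) ^ 2) := by
  have hdd' := (hd 0).trans (hd' 0)
  have hs : 0 < a + (d + d') / 2 := by linarith
  have h1 : loading U D ε 2 a k - loading U D ε 2 A k =
      -(a - A) * (∑ j, U j k * ((A + D j) ^ 2)⁻¹ * ε j / (a + D j) +
        ∑ j, U j k * (A + D j)⁻¹ * ε j / (a + D j) ^ 2) := by
    simp only [loading, ← Finset.sum_sub_distrib, ← Finset.sum_add_distrib, Finset.mul_sum]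
    refine Finset.sum_congr rfl fun j _ => ?_
    have := inv_sq_sub_inv_sq_eq (x := a + D j) (v := A + D j) (δ := a - A)
      (by linarith [hd j]) (by linarith [hd j]) (by ring)
    rw [div_eq_mul_inv, div_eq_mul_inv, ← mul_sub, this]
    ring
  rw [h1, abs_mul, abs_neg]
  gcongr
  refine (abs_add_le _ _).trans (add_le_add ((abs_sum_div_add_le hd0 hd hd' ha _).trans ?_)
    ((abs_sum_div_add_sq_le hd0 hd hd' ha _).trans ?_))
  · gcongr
    linarith [unifBound_le_loadingBound (U := U) (D := D) (ε := ε) (A := A) hd0 hdd' k,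
      unifBound_nonneg hd0 hdd' (D := D) fun j => U j k * ε j,
      unifBound_nonneg hd0 hdd' (D := D) fun j => U j k * (A + D j)⁻¹ * ε j]
  · gcongr
    linarith [unifBound_le_loadingBound (U := U) (D := D) (ε := ε) (A := A) hd0 hdd' k,
      unifBound_nonneg hd0 hdd' (D := D) fun j => U j k * ε j,
      unifBound_nonneg hd0 hdd' (D := D) fun j => U j k * ((A + D j) ^ 2)⁻¹ * ε j]

theorem inv_add_le_div (hd0 : 0 < d) (hd : ∀ j, d ≤ D j) (hd' : ∀ j, D j ≤ d') (ha : 0 ≤ a)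
    (j : ℕ) : (a + D j)⁻¹ ≤ (d + d') / 2 / d / (a + (d + d') / 2) := by
  have hdd' := (hd 0).trans (hd' 0)
  have hs : 0 < a + (d + d') / 2 := by linarith
  have hj := hd j
  rw [div_div, inv_eq_one_div, div_le_div_iff₀ (by linarith) (by positivity)]
  nlinarith

theorem abs_gram_two_le (hU : Uᵀ * U = 1) (hd0 : 0 < d) (hd : ∀ j, d ≤ D j)
    (ha : 0 ≤ a) {K : ℝ} (hK : ∀ j, (a + D j)⁻¹ ≤ K) (k l : Fin p) :
    |gram U D 2 a k l| ≤ K ^ 2 := by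
  simp only [gram, Matrix.of_apply, div_eq_mul_inv]
  refine abs_sum_mul_mul_le hU k l fun j => ?_
  have : 0 < a + D j := by linarith [hd j]
  rw [abs_of_pos (by positivity), ← inv_pow]
  gcongr
  exact hK j

theorem abs_gram_one_sub_le (hU : Uᵀ * U = 1) (hd0 : 0 < d) (hd : ∀ j, d ≤ D j)
    (ha : 0 ≤ a) (hA : 0 ≤ A) {K : ℝ} (hK : ∀ j, (a + D j)⁻¹ ≤ K) (k l : Fin p) :
    |gram U D 1 a k l - gram U D 1 A k l| ≤ |a - A| * (d⁻¹ * K) := by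
  simp only [gram, Matrix.of_apply, div_eq_mul_inv, ← Finset.sum_sub_distrib, ← mul_sub, pow_one]
  refine abs_sum_mul_mul_le hU k l fun j => ?_
  have h1 : 0 < a + D j := by linarith [hd j]
  have h2 : d ≤ A + D j := by linarith [hd j]
  have h3 : 0 < A + D j := by linarith
  rw [inv_sub_inv_eq (δ := a - A) h1.ne' h3.ne' (by ring), abs_mul, abs_neg, abs_of_pos
    (a := (A + D j)⁻¹ / (a + D j)) (by positivity), div_eq_mul_inv]
  gcongr
  exact hK j

theorem abs_gram_two_sub_le (hU : Uᵀ * U = 1) (hd0 : 0 < d) (hd : ∀ j, d ≤ D j)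
    (ha : 0 ≤ a) (hA : 0 ≤ A) (k l : Fin p) :
    |gram U D 2 a k l - gram U D 2 A k l| ≤ |a - A| * (2 * (d⁻¹) ^ 3) := by
  simp only [gram, Matrix.of_apply, div_eq_mul_inv, ← Finset.sum_sub_distrib, ← mul_sub]
  refine abs_sum_mul_mul_le hU k l fun j => ?_
  have h1 : d ≤ a + D j := by linarith [hd j]
  have h2 : d ≤ A + D j := by linarith [hd j]
  have h1' : 0 < a + D j := by linarith
  have h3 : 0 < A + D j := by linarith
  rw [inv_sq_sub_inv_sq_eq (δ := a - A) h1'.ne' h3.ne' (by ring), abs_mul, abs_neg,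
    abs_of_pos (a := ((A + D j) ^ 2)⁻¹ / (a + D j) + (A + D j)⁻¹ / (a + D j) ^ 2) (by positivity)]
  gcongr
  have e1 : (a + D j)⁻¹ ≤ d⁻¹ := by gcongr
  have e2 : (A + D j)⁻¹ ≤ d⁻¹ := by gcongr
  calc _ = (A + D j)⁻¹ ^ 2 * (a + D j)⁻¹ + (A + D j)⁻¹ * (a + D j)⁻¹ ^ 2 := by
        simp only [div_eq_mul_inv, inv_pow]
    _ ≤ d⁻¹ ^ 2 * d⁻¹ + d⁻¹ * d⁻¹ ^ 2 := by gcongr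
    _ = _ := by ring

end

/-- The correction of the score is of bounded order and Lipschitz at `A`, in terms of
`loadingBound`. -/
theorem exists_scoreCorrection_le (p : ℕ) {D : ℕ → ℝ} {d d' A : ℝ} (hd0 : 0 < d)
    (hd : ∀ j, d ≤ D j) (hd' : ∀ j, D j ≤ d') (hA : 0 < A) :
    ∃ Γ : ℝ, 0 ≤ Γ ∧ ∀ {m : ℕ} {U : Matrix (Fin m) (Fin p) ℝ}, Uᵀ * U = 1 →
      ∀ (ε : Fin m → ℝ) (a : ℝ), 0 ≤ a →
      (a + (d + d') / 2) ^ 2 * |scoreCorrection U D ε a| ≤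
        Γ * (a + (d + d') / 2 + loadingBound d d' U D A ε ^ 2) ∧
      |scoreCorrection U D ε a - scoreCorrection U D ε A| ≤
        Γ * (1 + loadingBound d d' U D A ε ^ 2) * |a - A| := by
  have hdd' := (hd 0).trans (hd' 0)
  set c := (d + d') / 2 with hc
  have hc0 : 0 < c := by
    rw [hc]
    linarith
  have hdc : d ≤ c := by
    rw [hc]
    linarith
  -- The sum of all constants needed below, so that each of them is at most κ.
  set κ : ℝ := 1 + (c / d) ^ 2 + 2 * (A + c) + (1 / c + 1 / c ^ 2) + d⁻¹ ^ 2 + d⁻¹ * (c / d) +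
    2 * d⁻¹ ^ 3 with hκ
  have hκ0 : 0 ≤ κ := by positivity
  have k1 : (c / d) ^ 2 ≤ κ := by
    have : 0 ≤ 1 + 2 * (A + c) + (1 / c + 1 / c ^ 2) + d⁻¹ ^ 2 + d⁻¹ * (c / d) +
      2 * d⁻¹ ^ 3 := by positivity
    linarith
  have k2 : 2 * (A + c) ≤ κ := by
    have : 0 ≤ 1 + (c / d) ^ 2 + (1 / c + 1 / c ^ 2) + d⁻¹ ^ 2 + d⁻¹ * (c / d) +
      2 * d⁻¹ ^ 3 := by positivity
    linarith
  have k3 : 1 / c + 1 / c ^ 2 ≤ κ := by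
    have : 0 ≤ 1 + (c / d) ^ 2 + 2 * (A + c) + d⁻¹ ^ 2 + d⁻¹ * (c / d) +
      2 * d⁻¹ ^ 3 := by positivity
    linarith
  have k4 : d⁻¹ ^ 2 ≤ κ := by
    have : 0 ≤ 1 + (c / d) ^ 2 + 2 * (A + c) + (1 / c + 1 / c ^ 2) + d⁻¹ * (c / d) +
      2 * d⁻¹ ^ 3 := by positivity
    linarith
  have k5 : d⁻¹ * (c / d) ≤ κ := by
    have : 0 ≤ 1 + (c / d) ^ 2 + 2 * (A + c) + (1 / c + 1 / c ^ 2) + d⁻¹ ^ 2 +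
      2 * d⁻¹ ^ 3 := by positivity
    linarith
  have k6 : 2 * d⁻¹ ^ 3 ≤ κ := by
    have : 0 ≤ 1 + (c / d) ^ 2 + 2 * (A + c) + (1 / c + 1 / c ^ 2) + d⁻¹ ^ 2 +
      d⁻¹ * (c / d) := by positivity
    linarith
  have hsz : ∀ s, c ≤ s → 1 / s ≤ κ ∧ 1 / s ^ 2 ≤ κ ∧ 1 / s + 1 / s ^ 2 ≤ κ := fun s hs => by
    have hs0 : 0 < s := hc0.trans_le hs
    have e1 : 1 / s ≤ 1 / c := by gcongr
    have e2 : 1 / s ^ 2 ≤ 1 / c ^ 2 := by gcongr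
    have e3 : 0 ≤ 1 / c := by positivity
    have e4 : 0 ≤ 1 / c ^ 2 := by positivity
    exact ⟨by linarith, by linarith, by linarith⟩
  obtain ⟨Γ, hΓ0, hΓ⟩ := exists_abs_quadratic_sub_le p hκ0
  refine ⟨Γ + p ^ 2 * κ + (2 * p ^ 2 + 2 * p ^ 4 * κ), by positivity, ?_⟩
  intro m U hU ε a ha
  set E := loadingBound d d' U D A ε with hE
  have hE0 : 0 ≤ E := loadingBound_nonneg hd0 hdd'
  have hpos : ∀ b, 0 ≤ b → ∀ j : Fin m, 0 < b + D j := fun b hb j => by linarith [hd j]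
  have hH : ∀ b, 0 ≤ b → ∀ k l, |(gram U D 1 b)⁻¹ k l| ≤ 2 * (b + c) := fun b hb k l => by
    refine (abs_inv_gram_le hU (hpos b hb) hd' (by linarith) k l).trans ?_
    rw [hc]
    linarith
  have hs : 0 < a + c := by linarith
  have hb1 : ∀ b, 0 ≤ b → ∀ k, |loading U D ε 1 b k| ≤ E / (b + c) :=
    fun b hb k => abs_loading_one_le hd0 hd hd' hb k
  have hb2 : ∀ b, 0 ≤ b → ∀ k, |loading U D ε 2 b k| ≤ E / (b + c) ^ 2 :=
    fun b hb k => abs_loading_two_le hd0 hd hd' hb k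
  have hb1' : ∀ b, 0 ≤ b → ∀ k, |loading U D ε 1 b k| ≤ κ * E := fun b hb k => by
    refine (hb1 b hb k).trans ?_
    rw [div_eq_mul_one_div, mul_comm]
    gcongr
    exact (hsz _ (by linarith)).1
  have hb2' : ∀ b, 0 ≤ b → ∀ k, |loading U D ε 2 b k| ≤ κ * E := fun b hb k => by
    refine (hb2 b hb k).trans ?_
    rw [div_eq_mul_one_div, mul_comm]
    gcongr
    exact (hsz _ (by linarith)).2.1
  have hK1 : ∀ b, 0 ≤ b → ∀ j, (b + D j)⁻¹ ≤ c / d / (b + c) :=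
    fun b hb j => inv_add_le_div hd0 hd hd' hb j
  have hK2 : ∀ b, 0 ≤ b → ∀ j, (b + D j)⁻¹ ≤ d⁻¹ := fun b hb j => by
    gcongr
    linarith [hd j]
  have hG' : ∀ b, 0 ≤ b → ∀ k l, |gram U D 2 b k l| ≤ κ := fun b hb k l =>
    (abs_gram_two_le hU hd0 hd hb (hK2 b hb) k l).trans k4
  constructor
  · have h1 := abs_quadratic_le (G := gram U D 2 a) hs (hH a ha) (κ := κ) (fun k l => by
      refine (abs_gram_two_le hU hd0 hd ha (hK1 a ha) k l).trans ?_
      rw [div_pow _ (a + c)]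
      gcongr) (hb1 a ha) (hb2 a ha)
    rw [scoreCorrection, gls]
    refine h1.trans ?_
    have e1 : 0 ≤ Γ * (a + c + E ^ 2) := by positivity
    have e2 : 0 ≤ p ^ 2 * κ * E ^ 2 := by positivity
    have e3 : 0 ≤ (2 * p ^ 2 + 2 * p ^ 4 * κ) * (a + c) := by positivity
    linarith
  · have hres : (gram U D 1 a)⁻¹ - (gram U D 1 A)⁻¹ =
        -((gram U D 1 a)⁻¹ * (gram U D 1 a - gram U D 1 A) * (gram U D 1 A)⁻¹) := by
      have u1 := isUnit_det_gram hU (hpos a ha) hd'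
      have u2 := isUnit_det_gram hU (hpos A hA.le) hd'
      rw [Matrix.mul_sub, Matrix.nonsing_inv_mul _ u1, Matrix.sub_mul, Matrix.one_mul,
        Matrix.mul_assoc, Matrix.mul_nonsing_inv _ u2, Matrix.mul_one, neg_sub]
    have h1 := hΓ hs (abs_nonneg (a - A)) hE0 hres (hH a ha)
      (fun k l => (hH A hA.le k l).trans k2) (hb1 a ha) (hb1' a ha) (hb1' A hA.le)
      (hb2' A hA.le) (hG' a ha) (hG' A hA.le)
      (fun k l => by
        refine (abs_gram_one_sub_le hU hd0 hd ha hA.le (hK1 a ha) k l).trans ?_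
        rw [mul_div_assoc, ← mul_div_assoc d⁻¹]
        gcongr)
      (fun k l => by
        refine (abs_gram_two_sub_le hU hd0 hd ha hA.le k l).trans ?_
        gcongr)
      (fun k => by
        refine (abs_loading_one_sub_le hd0 hd hd' ha hA.le k).trans ?_
        rw [mul_assoc]
        gcongr
        rw [← hE, ← hc, div_eq_mul_one_div, mul_comm]
        gcongr
        exact (hsz _ (by linarith)).1)
      (fun k => by
        refine (abs_loading_two_sub_le hd0 hd hd' ha hA.le k).trans ?_
        rw [mul_assoc]
        gcongr
        rw [← hE, ← hc, div_eq_mul_one_div E, div_eq_mul_one_div E ((a + c) ^ 2), ← mul_add,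
          mul_comm]
        gcongr
        exact (hsz _ (by linarith)).2.2)
    rw [scoreCorrection, gls, scoreCorrection, gls]
    refine h1.trans ?_
    gcongr
    have : 0 ≤ p ^ 2 * κ + (2 * p ^ 2 + 2 * p ^ 4 * κ) := by positivity
    linarith

end FayHerriot

/-! ### The stationary equation: crude rate and second-order expansion. -/

namespace FayHerriot

section AddFactor

variable {Ladd : ℕ → ℝ → ℝ} {m : ℕ}

theorem AddFactor.deriv_le_deriv (h : AddFactor Ladd) (hm : 1 ≤ m) {a b : ℝ} (ha : 0 < a)
    (hab : a ≤ b) :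
    deriv (fun t => Real.log (Ladd m t)) b ≤ deriv (fun t => Real.log (Ladd m t)) a :=
  (h.concaveOn m hm).antitoneOn_deriv (fun _ ht => h.differentiableAt hm ht) ha (ha.trans_le hab)
    hab

theorem AddFactor.deriv_nonneg (h : AddFactor Ladd) (hm : 1 ≤ m) {a : ℝ} (ha : 0 < a) :
    0 ≤ deriv (fun t => Real.log (Ladd m t)) a := by
  rw [← derivWithin_of_isOpen isOpen_Ioi ha]
  exact (h.strictMonoOn m hm).monotoneOn.derivWithin_nonneg

theorem AddFactor.tendsto_deriv (h : AddFactor Ladd) {a : ℝ} (ha : 0 < a) :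
    Tendsto (fun m => deriv (fun t => Real.log (Ladd m t)) a) atTop (𝓝 0) := by
  simpa only [iteratedDeriv_one] using h.tendsto 1 (by norm_num) a ha

/-- By concavity g(a)(a - A) is at most the increase of the log factor from A to a, and this is
bounded by log C' + 1 once the log factor at A exceeds -1. -/
theorem AddFactor.exists_deriv_mul_le (h : AddFactor Ladd) {A : ℝ} (hA : 0 < A) :
    ∃ K : ℝ, 0 ≤ K ∧ ∀ᶠ m in atTop, ∀ a, A ≤ a →
      deriv (fun t => Real.log (Ladd m t)) a * (a - A) ≤ K := by
  obtain ⟨C', hC', hLC⟩ := h.bounded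
  refine ⟨|Real.log C'| + 1, by positivity, ?_⟩
  have h0 := h.tendsto 0 (by norm_num) A hA
  simp only [iteratedDeriv_zero] at h0
  filter_upwards [h0.eventually (lt_mem_nhds (show (-1 : ℝ) < 0 by norm_num)),
    eventually_ge_atTop 1] with m hlog hm a ha
  rcases ha.eq_or_lt with rfl | hlt
  · rw [sub_self, mul_zero]
    positivity
  have ha0 : 0 < a := hA.trans hlt
  have h1 := (h.concaveOn m hm).deriv_le_slope (x := A) (y := a) hA ha0 hlt
    (h.differentiableAt hm ha0)
  rw [slope_def_field, le_div_iff₀ (sub_pos.2 hlt)] at h1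
  have h2 : Real.log (Ladd m a) ≤ Real.log C' :=
    Real.log_le_log (h.pos m hm a ha0) (hLC m hm a ha0).le
  linarith [le_abs_self (Real.log C')]

end AddFactor

section

variable {m p : ℕ} {U : Matrix (Fin m) (Fin p) ℝ} {D : ℕ → ℝ} {ε : Fin m → ℝ} {a d d' A : ℝ}

/-- A common bound for the random sums in the remainder terms. -/
def errorBound (d d' : ℝ) (U : Matrix (Fin m) (Fin p) ℝ) (D : ℕ → ℝ) (A : ℝ) (ε : Fin m → ℝ) : ℝ :=
  unifBound d d' D (fun j => ε j ^ 2 - (A + D j)) +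
    unifBound d d' D (fun j => ((A + D j) ^ 2)⁻¹ * (ε j ^ 2 - (A + D j))) +
    unifBound d d' D (fun j => ((A + D j) ^ 3)⁻¹ * (ε j ^ 2 - (A + D j))) +
    (loadingBound d d' U D A ε ^ 2 + 1)

/-- Since d' ≤ d + d', one has a + D_j ≤ 2(a + c): each term is at least ½ · ¼. -/
theorem div_le_sq_mul_sum (hd0 : 0 < d) (hd : ∀ j, d ≤ D j) (hd' : ∀ j, D j ≤ d') (ha : 0 ≤ a) :
    (m : ℝ) / 8 ≤ (a + (d + d') / 2) ^ 2 * (1 / 2 * ∑ j : Fin m, ((a + D j) ^ 2)⁻¹) := by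
  have h : ∀ j : Fin m, 1 / 8 ≤ (a + (d + d') / 2) ^ 2 * (1 / 2 * ((a + D j) ^ 2)⁻¹) := fun j => by
    have h1 := hd j
    have h2 := hd' j
    have h3 : 0 < a + D j := by linarith
    rw [← mul_assoc, ← div_eq_mul_inv, div_le_div_iff₀ (by norm_num) (by positivity)]
    nlinarith
  calc (m : ℝ) / 8 = ∑ _j : Fin m, (1 / 8 : ℝ) := by simp; ring
    _ ≤ ∑ j : Fin m, (a + (d + d') / 2) ^ 2 * (1 / 2 * ((a + D j) ^ 2)⁻¹) :=
        Finset.sum_le_sum fun j _ => h j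
    _ = _ := by rw [Finset.mul_sum, Finset.mul_sum]

/-- The equation is multiplied by s² = (a + c)², which normalizes the information to order M for
every a. For Δ ≥ 0 the right side still grows with s = s₀ + Δ, but only linearly in Δ, and is
absorbed for large M. For Δ ≤ 0 the terms κ and g have a favourable sign and s ≤ s₀. -/
theorem abs_mul_le_of_stationary {Δ s s₀ T Q r g κ Z Γ K c' E M : ℝ} (hs : 0 < s)
    (hs₀ : s = s₀ + Δ) (hs₀0 : 0 ≤ s₀) (hM : M / 8 ≤ s ^ 2 * T) (hQ : s ^ 2 * |Q| ≤ Z)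
    (hr : s ^ 2 * |r| ≤ Γ * (s + E)) (hΓ : 0 ≤ Γ) (hE : 0 ≤ E) (hκ : 0 ≤ κ) (hκs : s * κ ≤ c')
    (hg : 0 ≤ g) (hK : 0 ≤ Δ → g * Δ ≤ K ∧ g ≤ 1) (hK0 : 0 ≤ K) (hc' : 0 ≤ c') (hZ : 0 ≤ Z)
    (hMlarge : 16 * (Γ + c' + K) ≤ M) (h : Δ * T = 1 / 2 * Q + r + κ + g) :
    |Δ| * M ≤ 16 * (Z + Γ * E + (Γ + c' + 2 * K) * s₀ + s₀ ^ 2) := by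
  have hsum : (s ^ 2 * T) * Δ = 1 / 2 * (s ^ 2 * Q) + s ^ 2 * r + s * (s * κ) + s ^ 2 * g := by
    linear_combination s ^ 2 * h
  have hs2 : 0 ≤ s ^ 2 := sq_nonneg s
  have hQ' := abs_le.1 (show |s ^ 2 * Q| ≤ Z by rw [abs_mul, abs_of_nonneg hs2]; exact hQ)
  have hr' := abs_le.1 (show |s ^ 2 * r| ≤ Γ * (s + E) by rw [abs_mul, abs_of_nonneg hs2]; exact hr)
  have hΓE : 0 ≤ Γ * E := mul_nonneg hΓ hE
  rcases le_total 0 Δ with hΔ | hΔ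
  · obtain ⟨hK1, hK2⟩ := hK hΔ
    rw [abs_of_nonneg hΔ]
    have e1 : M / 8 * Δ ≤ (s ^ 2 * T) * Δ := mul_le_mul_of_nonneg_right hM hΔ
    have e2 : s * (s * κ) ≤ s * c' := mul_le_mul_of_nonneg_left hκs hs.le
    -- Only g and g Δ are bounded, so s² is split as sΔ + s₀Δ + s₀².
    have e3 : s ^ 2 * g ≤ s * K + s₀ * K + s₀ ^ 2 := by
      have : s ^ 2 * g = s * (g * Δ) + s₀ * (g * Δ) + s₀ ^ 2 * g := by rw [hs₀]; ring
      rw [this]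
      have a1 := mul_le_mul_of_nonneg_left hK1 hs.le
      have a2 := mul_le_mul_of_nonneg_left hK1 hs₀0
      have a3 := mul_le_mul_of_nonneg_left hK2 (sq_nonneg s₀)
      linarith
    -- The terms proportional to Δ use up at most half of M Δ/8, hence the factor 16 in the
    -- conclusion.
    have e4 : 16 * (Γ + c' + K) * Δ ≤ M * Δ := mul_le_mul_of_nonneg_right hMlarge hΔ
    have e5 : (s : ℝ) * (Γ + c' + K) = Γ * Δ + c' * Δ + K * Δ + (Γ + c' + K) * s₀ := by
      rw [hs₀]
      ring
    nlinarith
  · rw [abs_of_nonpos hΔ]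
    have e1 : M / 8 * -Δ ≤ (s ^ 2 * T) * -Δ := mul_le_mul_of_nonneg_right hM (by linarith)
    have e2 : 0 ≤ s * (s * κ) := by positivity
    have e3 : 0 ≤ s ^ 2 * g := by positivity
    have e4 : Γ * s ≤ Γ * s₀ := mul_le_mul_of_nonneg_left (by linarith) hΓ
    have e5 : 0 ≤ (c' + 2 * K) * s₀ := by positivity
    have e6 : 0 ≤ Γ * s₀ := by positivity
    nlinarith [sq_nonneg s₀]

theorem stationary_eq (hd0 : 0 < d) (hd : ∀ j, d ≤ D j) (ha : 0 ≤ a) {κ r g : ℝ}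
    (h : κ + g +
      (1 / 2 * ∑ j, ε j ^ 2 / (a + D j) ^ 2 - 1 / 2 * ∑ j : Fin m, (a + D j)⁻¹ + r) = 0) :
    (a - A) * (1 / 2 * ∑ j : Fin m, ((a + D j) ^ 2)⁻¹) =
      1 / 2 * ∑ j : Fin m, (ε j ^ 2 - (A + D j)) / (a + D j) ^ 2 + r + κ + g := by
  have h1 : ∑ j : Fin m, (ε j ^ 2 - (A + D j)) / (a + D j) ^ 2 =
      ∑ j, ε j ^ 2 / (a + D j) ^ 2 - ∑ j : Fin m, (a + D j)⁻¹ +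
        (a - A) * ∑ j : Fin m, ((a + D j) ^ 2)⁻¹ := by
    rw [Finset.mul_sum, ← Finset.sum_sub_distrib, ← Finset.sum_add_distrib]
    refine Finset.sum_congr rfl fun j _ => ?_
    have : a + D j ≠ 0 := by linarith [hd j]
    field_simp
    ring
  rw [h1]
  linear_combination -h

/-- A Taylor expansion with exact remainder, valid term by term as an identity of rational
functions. The remainder in ξ keeps the sums over j intact, so their cancellation remains available
uniformly in a. -/
theorem expansion_eq (hd0 : 0 < d) (hd : ∀ j, d ≤ D j) (ha : 0 ≤ a) (hA : 0 < A)
    (ξ : Fin m → ℝ) :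
    1 / 2 * ∑ j : Fin m, ξ j / (a + D j) ^ 2 - (a - A) * (1 / 2 * ∑ j : Fin m, ((a + D j) ^ 2)⁻¹) =
      1 / 2 * ∑ j : Fin m, ((A + D j) ^ 2)⁻¹ * ξ j
        + (-∑ j : Fin m, ((A + D j) ^ 3)⁻¹ * ξ j) * (a - A)
        - (1 / 2 * ∑ j : Fin m, ((A + D j) ^ 2)⁻¹) * (a - A)
        + (∑ j : Fin m, ((A + D j) ^ 3)⁻¹) * (a - A) ^ 2
        + 1 / 2 * (a - A) ^ 2 * (∑ j : Fin m, ((A + D j) ^ 2)⁻¹ * ξ j / (a + D j) ^ 2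
          + 2 * ∑ j : Fin m, ((A + D j) ^ 3)⁻¹ * ξ j / (a + D j))
        - 1 / 2 * (a - A) ^ 3 * ∑ j : Fin m, (((A + D j) ^ 2)⁻¹ * ((a + D j) ^ 2)⁻¹
          + 2 * (((A + D j) ^ 3)⁻¹ * (a + D j)⁻¹)) := by
  simp only [Finset.mul_sum, Finset.sum_mul, ← Finset.sum_sub_distrib, ← Finset.sum_add_distrib,
    ← Finset.sum_neg_distrib]
  refine Finset.sum_congr rfl fun j _ => ?_
  have h1 : a + D j ≠ 0 := by linarith [hd j]
  have h2 : A + D j ≠ 0 := by linarith [hd j]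
  field_simp
  ring

/-- For a ≥ A/2 monotonicity of g suffices. For a < A/2 the left side is nonpositive and κ ≥ 0, so g
is at most |Q|/2 + |r|; there |Δ| ≥ A/2, so the factor (2/A)² Δ² ≥ 1 can be inserted to obtain a
second-order term. -/
theorem deriv_le_of_stationary {Δ s c T Q r g κ Z Γ E g₀ : ℝ} (hc : 0 < c) (hcs : c ≤ s)
    (hA : 0 < A) (hΔ : a - A = Δ) (hT : 0 ≤ T) (hQ : s ^ 2 * |Q| ≤ Z)
    (hr : s ^ 2 * |r| ≤ Γ * (s + E)) (hΓ : 0 ≤ Γ) (hE : 0 ≤ E) (hκ : 0 ≤ κ) (hZ : 0 ≤ Z)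
    (hg₀ : 0 ≤ g₀) (hg : A / 2 ≤ a → g ≤ g₀) (h : Δ * T = 1 / 2 * Q + r + κ + g) :
    g ≤ g₀ + (2 / A) ^ 2 * (1 / 2 * (c ^ 2)⁻¹ * Z + Γ * (c⁻¹ + (c ^ 2)⁻¹ * E)) * Δ ^ 2 := by
  have hs : 0 < s := hc.trans_le hcs
  have hb : 0 ≤ 1 / 2 * (c ^ 2)⁻¹ * Z + Γ * (c⁻¹ + (c ^ 2)⁻¹ * E) := by positivity
  rcases le_or_gt (A / 2) a with ha | ha
  · have : 0 ≤ (2 / A) ^ 2 * (1 / 2 * (c ^ 2)⁻¹ * Z + Γ * (c⁻¹ + (c ^ 2)⁻¹ * E)) * Δ ^ 2 := by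
      positivity
    linarith [hg ha]
  · have h1 : Δ * T ≤ 0 := mul_nonpos_of_nonpos_of_nonneg (by linarith) hT
    have h2 : |Q| ≤ (c ^ 2)⁻¹ * Z := by
      rw [← div_eq_inv_mul, le_div_iff₀ (by positivity), mul_comm]
      exact le_trans (by gcongr) hQ
    have h3 : |r| ≤ Γ * (c⁻¹ + (c ^ 2)⁻¹ * E) := by
      have e1 : |r| ≤ Γ * (s⁻¹ + (s ^ 2)⁻¹ * E) := by
        have e2 : Γ * (s⁻¹ + (s ^ 2)⁻¹ * E) = Γ * (s + E) / s ^ 2 := by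
          field_simp
        rw [e2, le_div_iff₀ (by positivity), mul_comm]
        exact hr
      exact e1.trans (by gcongr)
    have h4 : 1 ≤ (2 / A) ^ 2 * Δ ^ 2 := by
      have e1 : A / 2 ≤ -Δ := by linarith
      have e2 : (A / 2) ^ 2 ≤ Δ ^ 2 := by nlinarith
      have e3 : (2 / A) ^ 2 * (A / 2) ^ 2 = 1 := by
        field_simp
      calc (1 : ℝ) = (2 / A) ^ 2 * (A / 2) ^ 2 := e3.symm
        _ ≤ _ := by gcongr
    have h5 := mul_le_mul_of_nonneg_left h4 hb
    linarith [neg_abs_le Q, neg_abs_le r]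

theorem add_mul_add_le_mul_add {x y z e γ q : ℝ} (hx : 0 ≤ x) (hy : 0 ≤ y) (hz : 0 ≤ z)
    (he : 0 ≤ e) (hγ : 0 ≤ γ) (hq : 0 ≤ q) :
    x + γ * e + q ≤ (1 + γ + q) * (x + y + z + (e + 1)) := by
  have h : 0 ≤ (1 + γ + q) * (y + z) + (γ + q) * x + e * (1 + q) + γ + 1 := by positivity
  linarith

-- The first bound gives the rate of Δ; the second is the expansion around A, whose remainder
-- becomes o(1) in mean once √m Δ is bounded in every L^q. Both are deterministic.
set_option maxHeartbeats 1000000 in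
theorem exists_stationary_bounds (p : ℕ) {Ladd : ℕ → ℝ → ℝ} {D : ℕ → ℝ} {d d' A : ℝ} (hd0 : 0 < d)
    (hd : ∀ j, d ≤ D j) (hd' : ∀ j, D j ≤ d') (hA : 0 < A) (hL : AddFactor Ladd) (i : ℕ) :
    ∃ Γ : ℝ, 0 ≤ Γ ∧ ∀ᶠ m in atTop, ∀ U : Matrix (Fin m) (Fin p) ℝ, Uᵀ * U = 1 →
      ∀ (ε : Fin m → ℝ) (a : ℝ), 0 < a →
      2 / (a + D i) + deriv (fun b => Real.log (Ladd m b)) a +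
        (1 / 2 * ∑ j, ε j ^ 2 / (a + D j) ^ 2 - 1 / 2 * ∑ j : Fin m, (a + D j)⁻¹ +
          scoreCorrection U D ε a) = 0 →
      |a - A| * m ≤ Γ * errorBound d d' U D A ε ∧
      |(1 / 2 * ∑ j : Fin m, ((A + D j) ^ 2)⁻¹) * (a - A) -
        (1 / 2 * ∑ j : Fin m, ((A + D j) ^ 2)⁻¹ * (ε j ^ 2 - (A + D j)) +
          scoreCorrection U D ε A + 2 / (A + D i) +
          (-∑ j : Fin m, ((A + D j) ^ 3)⁻¹ * (ε j ^ 2 - (A + D j))) * (a - A) +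
          (∑ j : Fin m, ((A + D j) ^ 3)⁻¹) * (a - A) ^ 2)| ≤
        deriv (fun b => Real.log (Ladd m b)) (A / 2) +
          Γ * (m * |a - A| ^ 3 + (a - A) ^ 2 * errorBound d d' U D A ε +
            |a - A| * (1 + loadingBound d d' U D A ε ^ 2)) := by
  have hdd' := (hd 0).trans (hd' 0)
  obtain ⟨Γ, hΓ, hcorr⟩ := exists_scoreCorrection_le p hd0 hd hd' hA
  obtain ⟨K, hK, hLK⟩ := hL.exists_deriv_mul_le hA
  set c := (d + d') / 2 with hc
  have hc0 : 0 < c := by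
    rw [hc]
    linarith
  -- Bounds (a + c) · 2/(a + D_i) for all a ≥ 0.
  set c' := 2 * (c / d) with hc'
  have hc'0 : 0 < c' := by positivity
  set Γ₁ := 16 * (1 + Γ + (Γ + c' + 2 * K) * (A + c) + (A + c) ^ 2) with hΓ₁
  set Γ₂ := (2 / A) ^ 2 * (1 / 2 * (c ^ 2)⁻¹ + Γ * (c⁻¹ + (c ^ 2)⁻¹)) with hΓ₂
  set Γ₃ := 1 / 2 * (c ^ 2)⁻¹ + c⁻¹ with hΓ₃
  set Γ₄ := 3 / 2 * (d⁻¹) ^ 4 with hΓ₄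
  set Γ₅ := Γ + 2 * (d⁻¹) ^ 2 with hΓ₅
  have p1 : 0 ≤ Γ₁ := by positivity
  have p2 : 0 ≤ Γ₂ := by positivity
  have p3 : 0 ≤ Γ₃ := by positivity
  have p4 : 0 ≤ Γ₄ := by positivity
  have p5 : 0 ≤ Γ₅ := by positivity
  refine ⟨Γ₁ + Γ₂ + Γ₃ + Γ₄ + Γ₅, by positivity, ?_⟩
  filter_upwards [hLK, (hL.tendsto_deriv hA).eventually (gt_mem_nhds one_pos),
    eventually_ge_atTop 1,
    tendsto_natCast_atTop_atTop.eventually_ge_atTop (16 * (Γ + c' + K))] with m hLK hLA hm hmlarge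
  intro U hU ε a ha hstat
  have hs : 0 < a + c := by linarith
  obtain ⟨hr, hr'⟩ := hcorr hU ε a ha.le
  -- Centring ε_j² at v_j instead of a + D_j brings out the linear term in a - A.
  have hstat' := stationary_eq (A := A) hd0 hd ha.le hstat
  have hexp := expansion_eq hd0 hd ha.le hA fun j : Fin m => ε j ^ 2 - (A + D j)
  have hZ1 := unifBound_nonneg hd0 hdd' (D := D) fun j : Fin m => ε j ^ 2 - (A + D j)
  have hZ2 := unifBound_nonneg hd0 hdd' (D := D) fun j : Fin m =>
    ((A + D j) ^ 2)⁻¹ * (ε j ^ 2 - (A + D j))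
  have hZ3 := unifBound_nonneg hd0 hdd' (D := D) fun j : Fin m =>
    ((A + D j) ^ 3)⁻¹ * (ε j ^ 2 - (A + D j))
  have hQ := abs_sum_div_add_sq_le hd0 hd hd' ha.le fun j : Fin m => ε j ^ 2 - (A + D j)
  have hP1 := abs_sum_div_add_sq_le hd0 hd hd' ha.le fun j : Fin m =>
    ((A + D j) ^ 2)⁻¹ * (ε j ^ 2 - (A + D j))
  have hP2 := abs_sum_div_add_le hd0 hd hd' ha.le fun j : Fin m =>
    ((A + D j) ^ 3)⁻¹ * (ε j ^ 2 - (A + D j))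
  have hT := div_le_sq_mul_sum (m := m) hd0 hd hd' ha.le
  have hS : |∑ j : Fin m, (((A + D j) ^ 2)⁻¹ * ((a + D j) ^ 2)⁻¹
      + 2 * (((A + D j) ^ 3)⁻¹ * (a + D j)⁻¹))| ≤ m * (3 * (d⁻¹) ^ 4) := by
    refine (Finset.abs_sum_le_sum_abs _ _).trans ?_
    calc _ ≤ ∑ _j : Fin m, 3 * (d⁻¹) ^ 4 := Finset.sum_le_sum fun j _ => ?_
      _ = _ := by simp
    have h1 : d ≤ a + D j := by linarith [hd j]
    have h2 : d ≤ A + D j := by linarith [hd j]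
    have h1' : 0 < a + D j := by linarith
    have h2' : 0 < A + D j := by linarith
    rw [abs_of_pos (by positivity)]
    calc _ ≤ (d ^ 2)⁻¹ * (d ^ 2)⁻¹ + 2 * ((d ^ 3)⁻¹ * d⁻¹) := by gcongr
      _ = _ := by field_simp; norm_num
  have hTnonneg : 0 ≤ 1 / 2 * ∑ j : Fin m, ((a + D j) ^ 2)⁻¹ := by positivity
  rw [← hc] at hQ hP1 hP2 hT
  have hgA2 := hL.deriv_nonneg hm (half_pos hA)
  have hga := hL.deriv_nonneg hm ha
  have hmono : ∀ b, 0 < b → b ≤ a → deriv (fun t => Real.log (Ladd m t)) a ≤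
      deriv (fun t => Real.log (Ladd m t)) b := fun b hb hba => hL.deriv_le_deriv hm hb hba
  have hLKa := hLK a
  have hκ : |2 / (a + D i) - 2 / (A + D i)| ≤ 2 * (d⁻¹) ^ 2 * |a - A| := by
    have h1 : d ≤ a + D i := by linarith [hd i]
    have h2 : d ≤ A + D i := by linarith [hd i]
    have h1' : 0 < a + D i := by linarith
    have h2' : 0 < A + D i := by linarith
    have : 2 / (a + D i) - 2 / (A + D i) = -(2 * ((a + D i)⁻¹ * (A + D i)⁻¹) * (a - A)) := by
      field_simp
      ring
    rw [this, abs_neg, abs_mul, abs_of_pos (a := 2 * ((a + D i)⁻¹ * (A + D i)⁻¹)) (by positivity)]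
    gcongr
    calc _ ≤ d⁻¹ * d⁻¹ := by gcongr
      _ = _ := by ring
  have hκ0 : 0 ≤ 2 / (a + D i) := div_nonneg zero_le_two (by linarith [hd i])
  have hκs : (a + c) * (2 / (a + D i)) ≤ c' := by
    have := inv_add_le_div hd0 hd hd' ha.le i
    rw [← hc, le_div_iff₀ hs] at this
    rw [hc', div_eq_mul_inv]
    linarith
  -- From here on only the collected inequalities about g and the random bounds matter.
  generalize deriv (fun t => Real.log (Ladd m t)) a = g at *
  set E := loadingBound d d' U D A ε with hE
  have hE2 : 0 ≤ E ^ 2 := sq_nonneg E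
  have herr : errorBound d d' U D A ε = _ + _ + _ + (E ^ 2 + 1) := rfl
  rw [herr]
  generalize unifBound d d' D (fun j : Fin m => ε j ^ 2 - (A + D j)) = Z1 at *
  generalize unifBound d d' D (fun j : Fin m =>
    ((A + D j) ^ 2)⁻¹ * (ε j ^ 2 - (A + D j))) = Z2 at *
  generalize unifBound d d' D (fun j : Fin m =>
    ((A + D j) ^ 3)⁻¹ * (ε j ^ 2 - (A + D j))) = Z3 at *
  rw [le_div_iff₀ (by positivity), mul_comm] at hQ
  refine ⟨?_, ?_⟩
  · have h := abs_mul_le_of_stationary (s₀ := A + c) (Δ := a - A) hs (by ring) (by positivity) hT hQ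
      hr hΓ hE2 hκ0 hκs hga
      (fun h => ⟨hLKa (by linarith), (hmono A hA (by linarith)).trans hLA.le⟩) hK hc'0.le hZ1
      hmlarge hstat'
    refine h.trans ?_
    have h2 : 0 ≤ (Γ₂ + Γ₃ + Γ₄ + Γ₅) * (Z1 + Z2 + Z3 + (E ^ 2 + 1)) := by positivity
    have h3 := add_mul_add_le_mul_add hZ1 hZ2 hZ3 hE2 hΓ
      (show 0 ≤ (Γ + c' + 2 * K) * (A + c) + (A + c) ^ 2 by positivity)
    rw [← add_assoc, ← add_assoc] at h3
    have h4 := mul_le_mul_of_nonneg_left h3 (show (0 : ℝ) ≤ 16 by norm_num)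
    have h5 : (Γ₁ + Γ₂ + Γ₃ + Γ₄ + Γ₅) * (Z1 + Z2 + Z3 + (E ^ 2 + 1)) =
        16 * ((1 + Γ + (Γ + c' + 2 * K) * (A + c) + (A + c) ^ 2) * (Z1 + Z2 + Z3 + (E ^ 2 + 1))) +
        (Γ₂ + Γ₃ + Γ₄ + Γ₅) * (Z1 + Z2 + Z3 + (E ^ 2 + 1)) := by
      rw [hΓ₁]
      ring
    rw [h5]
    exact h4.trans (le_add_of_nonneg_right h2)
  · have hg := deriv_le_of_stationary (a := a) (Δ := a - A) hc0 (by linarith : c ≤ a + c) hA rfl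
      hTnonneg hQ hr hΓ hE2 hκ0 hZ1 hgA2 (fun h => hmono _ (half_pos hA) h) hstat'
    set Δ := a - A with hΔ
    set W := Z1 + Z2 + Z3 + (E ^ 2 + 1) with hW
    have hΔ2 : 0 ≤ Δ ^ 2 := sq_nonneg Δ
    have b1 : (2 / A) ^ 2 * (1 / 2 * (c ^ 2)⁻¹ * Z1 + Γ * (c⁻¹ + (c ^ 2)⁻¹ * E ^ 2)) * Δ ^ 2 ≤
        Γ₂ * (Δ ^ 2 * W) := by
      have w1 : Z1 ≤ W := by linarith
      have w2 : 1 ≤ W := by linarith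
      have w3 : E ^ 2 ≤ W := by linarith
      calc _ ≤ (2 / A) ^ 2 * (1 / 2 * (c ^ 2)⁻¹ * W + Γ * (c⁻¹ * W + (c ^ 2)⁻¹ * W)) * Δ ^ 2 := by
            gcongr
            exact le_mul_of_one_le_right (by positivity) w2
        _ = _ := by rw [hΓ₂]; ring
    have b2 : |1 / 2 * Δ ^ 2 *
        (∑ j : Fin m, ((A + D j) ^ 2)⁻¹ * (ε j ^ 2 - (A + D j)) / (a + D j) ^ 2
          + 2 * ∑ j : Fin m, ((A + D j) ^ 3)⁻¹ * (ε j ^ 2 - (A + D j)) / (a + D j))| ≤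
        Γ₃ * (Δ ^ 2 * W) := by
      have w2 : Z2 ≤ W := by linarith
      have w3 : Z3 ≤ W := by linarith
      have q1 : Z2 / (a + c) ^ 2 ≤ (c ^ 2)⁻¹ * W := by
        rw [div_eq_inv_mul]
        gcongr
        linarith
      have q2 : Z3 / (a + c) ≤ c⁻¹ * W := by
        rw [div_eq_inv_mul]
        gcongr
        linarith
      rw [abs_mul, abs_of_nonneg (by positivity)]
      calc _ ≤ 1 / 2 * Δ ^ 2 * ((c ^ 2)⁻¹ * W + 2 * (c⁻¹ * W)) := by
            gcongr
            refine (abs_add_le _ _).trans (add_le_add (hP1.trans q1) ?_)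
            rw [abs_mul, abs_two]
            gcongr
            exact hP2.trans q2
        _ = _ := by rw [hΓ₃]; ring
    have b3 : |1 / 2 * Δ ^ 3 * ∑ j : Fin m, (((A + D j) ^ 2)⁻¹ * ((a + D j) ^ 2)⁻¹
          + 2 * (((A + D j) ^ 3)⁻¹ * (a + D j)⁻¹))| ≤ Γ₄ * (m * |Δ| ^ 3) := by
      rw [abs_mul, abs_mul, abs_pow, abs_of_pos (by norm_num : (0 : ℝ) < 1 / 2)]
      calc _ ≤ 1 / 2 * |Δ| ^ 3 * (m * (3 * (d⁻¹) ^ 4)) := by gcongr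
        _ = _ := by rw [hΓ₄]; ring
    have b4 : |scoreCorrection U D ε a - scoreCorrection U D ε A| +
        |2 / (a + D i) - 2 / (A + D i)| ≤ Γ₅ * (|Δ| * (1 + E ^ 2)) := by
      have q : 2 * d⁻¹ ^ 2 * |Δ| ≤ 2 * d⁻¹ ^ 2 * |Δ| * (1 + E ^ 2) :=
        le_mul_of_one_le_right (by positivity) (by linarith)
      rw [hΓ₅]
      linarith
    have hrest : 0 ≤ (Γ₁ + Γ₂ + Γ₃ + Γ₅) * (m * |Δ| ^ 3) +
        (Γ₁ + Γ₄ + Γ₅) * (Δ ^ 2 * W) + (Γ₁ + Γ₂ + Γ₃ + Γ₄) * (|Δ| * (1 + E ^ 2)) := by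
      have : 0 ≤ W := by linarith
      positivity
    rw [abs_le] at b2 b3
    have b4a := abs_le.1 (le_refl |scoreCorrection U D ε a - scoreCorrection U D ε A|)
    have b4b := abs_le.1 (le_refl |2 / (a + D i) - 2 / (A + D i)|)
    rw [abs_le]
    constructor <;> linarith

end

end FayHerriot

/-! ### From the perturbed quadratic equation to mean and mean square. -/

namespace FayHerriot

section

variable {Ω : Type*} [MeasurableSpace Ω] {μ : Measure Ω}

theorem MomentBounded.eventually_aestronglyMeasurable_of_mul {Y : ℕ → Ω → ℝ} {c : ℕ → ℝ}
    (hc : ∀ᶠ m in atTop, c m ≠ 0) (h : MomentBounded μ fun m ω => c m * Y m ω) :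
    ∀ᶠ m in atTop, AEStronglyMeasurable (Y m) μ := by
  filter_upwards [hc, h.1] with m hm h1
  refine (h1.const_mul (c m)⁻¹).congr (.of_forall fun ω => ?_)
  simp only
  rw [inv_mul_cancel_left₀ hm]

theorem MomentBounded.eventually_integrable_of_mul {Y : ℕ → Ω → ℝ} {c : ℕ → ℝ}
    (hc : ∀ᶠ m in atTop, c m ≠ 0) (h : MomentBounded μ fun m ω => c m * Y m ω) :
    ∀ᶠ m in atTop, Integrable (Y m) μ := by
  filter_upwards [hc, h.eventually_integrable] with m hm h1
  refine (h1.const_mul (c m)⁻¹).congr (.of_forall fun ω => ?_)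
  simp only
  rw [inv_mul_cancel_left₀ hm]

variable [IsProbabilityMeasure μ]

/-- Moments of a random sequence `Δ` that solves a quadratic equation up to a small remainder. -/
theorem exists_abs_moment_sub_le {Δ S N r R : ℕ → Ω → ℝ} {I T η : ℕ → ℝ} {κ c₀ K : ℝ}
    (hc₀ : 0 < c₀) (hI : ∀ᶠ m : ℕ in atTop, c₀ * m ≤ I m) (hT : ∀ᶠ m : ℕ in atTop, |T m| ≤ K * m)
    (hη : Tendsto η atTop (𝓝 0))
    (hS : MomentBounded μ fun m ω => (√(m : ℝ))⁻¹ * S m ω)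
    (hN : MomentBounded μ fun m ω => (√(m : ℝ))⁻¹ * N m ω)
    (hr : MomentBounded μ r) (hR : MomentBounded μ R)
    (hΔ : MomentBounded μ fun m ω => √(m : ℝ) * Δ m ω)
    (hrem : ∀ᶠ m in atTop, ∀ ω, |I m * Δ m ω - (S m ω + r m ω + κ + N m ω * Δ m ω +
      T m * Δ m ω ^ 2)| ≤ η m + (√(m : ℝ))⁻¹ * R m ω)
    (hES : ∀ m, ∫ ω, S m ω ∂μ = 0) (hEr : ∀ᶠ m in atTop, ∫ ω, r m ω ∂μ = 0)
    (hESS : ∀ m, ∫ ω, S m ω * S m ω ∂μ = I m) (hENS : ∀ m, ∫ ω, N m ω * S m ω ∂μ = -T m) :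
    ∃ C : ℝ, ∀ᶠ m in atTop,
      |I m * ∫ ω, Δ m ω ∂μ - κ| ≤ |η m| + C * (√(m : ℝ))⁻¹ ∧
      |I m ^ 2 * ∫ ω, Δ m ω ^ 2 ∂μ - I m| ≤ C * √(m : ℝ) := by
  have hq : ∀ᶠ m : ℕ in atTop, √(m : ℝ) ≠ 0 := by
    filter_upwards [eventually_ge_atTop 1] with m hm
    have : (0 : ℝ) < m := by exact_mod_cast hm
    positivity
  have hq' : ∀ᶠ m : ℕ in atTop, (√(m : ℝ))⁻¹ ≠ 0 := hq.mono fun m h => inv_ne_zero h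
  have hqle : ∀ᶠ m : ℕ in atTop, |(√(m : ℝ))⁻¹| ≤ 1 := by
    filter_upwards [eventually_ge_atTop 1] with m hm
    have : (1 : ℝ) ≤ m := by exact_mod_cast hm
    rw [abs_of_nonneg (by positivity)]
    exact inv_le_one_of_one_le₀ (Real.one_le_sqrt.2 this)
  have hIm : ∀ᶠ m : ℕ in atTop, |(m : ℝ) / I m| ≤ c₀⁻¹ := by
    filter_upwards [hI, eventually_ge_atTop 1] with m h1 hm
    have hm' : (0 : ℝ) < m := by exact_mod_cast hm
    have hI0 : 0 < I m := lt_of_lt_of_le (by positivity) h1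
    rw [abs_of_nonneg (by positivity), div_le_iff₀ hI0, ← div_eq_inv_mul, le_div_iff₀ hc₀]
    linarith
  -- The error of the linearization Δ ≈ S/I, of order 1 although both terms are of order √m.
  set ρ : ℕ → Ω → ℝ := fun m ω => I m * Δ m ω - S m ω with hρdef
  have hρ : MomentBounded μ ρ := by
    refine MomentBounded.mono (Z := fun m ω => (1 + |κ|) + |R m ω| + |r m ω| +
      |(√(m : ℝ))⁻¹ * N m ω * (√(m : ℝ) * Δ m ω)| + K * (√(m : ℝ) * Δ m ω) ^ 2) ?_ ?_ ?_
    · exact ((((MomentBounded.const (c := fun _ => 1 + |κ|) (.of_forall fun _ => le_rfl)).add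
        hR.abs).add hr.abs).add (hN.mul hΔ).abs).add
        ((MomentBounded.const (c := fun _ => K) (.of_forall fun _ => le_rfl)).mul (hΔ.pow 2))
    · filter_upwards [hΔ.eventually_aestronglyMeasurable_of_mul hq,
        hS.eventually_aestronglyMeasurable_of_mul hq'] with m h1 h2 using (h1.const_mul _).sub h2
    · filter_upwards [hrem, hT, hqle, hq, hη.eventually (gt_mem_nhds one_pos)]
        with m h1 h2 h3 h4 h5 ω
      have e1 := h1 ω
      have e2 : (√(m : ℝ))⁻¹ * R m ω ≤ |R m ω| := by
        refine (le_abs_self _).trans ?_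
        rw [abs_mul]
        exact mul_le_of_le_one_left (abs_nonneg _) h3
      have e3 : (√(m : ℝ))⁻¹ * N m ω * (√(m : ℝ) * Δ m ω) = N m ω * Δ m ω := by
        field_simp
      have e4 : |T m * Δ m ω ^ 2| ≤ K * (√(m : ℝ) * Δ m ω) ^ 2 := by
        rw [mul_pow, Real.sq_sqrt m.cast_nonneg, ← mul_assoc, abs_mul, abs_of_nonneg
          (sq_nonneg (Δ m ω))]
        gcongr
      rw [e3]
      have e5 : ρ m ω = (I m * Δ m ω - (S m ω + r m ω + κ + N m ω * Δ m ω + T m * Δ m ω ^ 2)) +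
          r m ω + κ + N m ω * Δ m ω + T m * Δ m ω ^ 2 := by
        simp only [hρdef]
        ring
      rw [e5]
      refine (abs_add_le _ _).trans (add_le_add ?_ e4)
      refine (abs_add_le _ _).trans (add_le_add ?_ le_rfl)
      refine (abs_add_le _ _).trans ?_
      have := abs_add_le (I m * Δ m ω - (S m ω + r m ω + κ + N m ω * Δ m ω + T m * Δ m ω ^ 2))
        (r m ω)
      linarith
  -- `F₁` and `F₂` are the normalized corrections when Δ is replaced by S/I: N Δ = N S/I + F₁/√m and
  -- I² Δ² = S² + √m F₂.
  have hF₁ : MomentBounded μ fun m ω => (√(m : ℝ))⁻¹ * N m ω * ρ m ω * ((m : ℝ) / I m) :=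
    (hN.mul hρ).mul (.const hIm)
  have hF₂ : MomentBounded μ fun m ω => 2 * ((√(m : ℝ))⁻¹ * S m ω * ρ m ω) +
      (√(m : ℝ))⁻¹ * ρ m ω ^ 2 :=
    ((MomentBounded.const (c := fun _ => 2) (.of_forall fun _ => le_rfl)).mul (hS.mul hρ)).add
      ((MomentBounded.const hqle).mul (hρ.pow 2))
  obtain ⟨C₁, hC₁, hb₁⟩ := hF₁.exists_abs_integral_le
  obtain ⟨C₂, hC₂, hb₂⟩ := hF₂.exists_abs_integral_le
  obtain ⟨C₃, hC₃, hb₃⟩ := hR.exists_abs_integral_le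
  have hSS : ∀ᶠ m in atTop, Integrable (fun ω => S m ω * S m ω) μ :=
    MomentBounded.eventually_integrable_of_mul (c := fun m => (√(m : ℝ))⁻¹ * (√(m : ℝ))⁻¹)
      (hq'.mono fun m h => mul_ne_zero h h) (by
        simpa only [mul_mul_mul_comm] using hS.mul hS)
  have hNS : ∀ᶠ m in atTop, Integrable (fun ω => N m ω * S m ω) μ :=
    MomentBounded.eventually_integrable_of_mul (c := fun m => (√(m : ℝ))⁻¹ * (√(m : ℝ))⁻¹)
      (hq'.mono fun m h => mul_ne_zero h h) (by
        simpa only [mul_mul_mul_comm] using hN.mul hS)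
  have hΔΔ : ∀ᶠ m in atTop, Integrable (fun ω => Δ m ω ^ 2) μ :=
    MomentBounded.eventually_integrable_of_mul (c := fun m => √(m : ℝ) ^ 2)
      (hq.mono fun m h => pow_ne_zero 2 h) (by
        simpa only [mul_pow] using hΔ.pow 2)
  refine ⟨C₁ + K / c₀ ^ 2 * C₂ + C₂ + C₃, ?_⟩
  filter_upwards [hb₁, hb₂, hb₃, hSS, hNS, hΔΔ, hF₁.eventually_integrable,
    hF₂.eventually_integrable, hR.eventually_integrable, hr.eventually_integrable, hEr,
    hS.eventually_integrable_of_mul hq', hΔ.eventually_integrable_of_mul hq, hrem, hI, hT,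
    eventually_ge_atTop 1] with m hb₁ hb₂ hb₃ iSS iNS iΔΔ iF₁ iF₂ iR ir hEr iS iΔ hrem hI hT hm
  have hm0 : (0 : ℝ) < m := by exact_mod_cast hm
  have hI0 : 0 < I m := lt_of_lt_of_le (by positivity) hI
  have hqm : √(m : ℝ) ^ 2 = m := Real.sq_sqrt hm0.le
  have hq0 : 0 < √(m : ℝ) := Real.sqrt_pos.2 hm0
  have hK : 0 ≤ K := by
    have := (abs_nonneg _).trans hT
    exact nonneg_of_mul_nonneg_left this hm0
  set q := √(m : ℝ) with hqdef
  set F₁ : Ω → ℝ := fun ω => q⁻¹ * N m ω * ρ m ω * ((m : ℝ) / I m) with hF₁def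
  set F₂ : Ω → ℝ := fun ω => 2 * (q⁻¹ * S m ω * ρ m ω) + q⁻¹ * ρ m ω ^ 2 with hF₂def
  have eΔΔ : I m ^ 2 * ∫ ω, Δ m ω ^ 2 ∂μ = I m + q * ∫ ω, F₂ ω ∂μ := by
    have h : ∀ ω, I m ^ 2 * Δ m ω ^ 2 = S m ω * S m ω + q * F₂ ω := fun ω => by
      simp only [hF₂def, hρdef]
      field_simp
      ring
    rw [← integral_const_mul, ← integral_const_mul]
    simp only [h]
    rw [integral_add iSS (iF₂.const_mul q), hESS]
  have eNΔ : ∀ ω, N m ω * Δ m ω = (I m)⁻¹ * (N m ω * S m ω) + q⁻¹ * F₁ ω := fun ω => by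
    simp only [hF₁def, hρdef]
    rw [← hqm]
    field_simp
    ring
  have iNΔ : Integrable (fun ω => N m ω * Δ m ω) μ := by
    simp only [eNΔ]
    exact (iNS.const_mul _).add (iF₁.const_mul _)
  have eNΔ' : ∫ ω, N m ω * Δ m ω ∂μ = -((I m)⁻¹ * T m) + q⁻¹ * ∫ ω, F₁ ω ∂μ := by
    simp only [eNΔ]
    rw [integral_add (iNS.const_mul _) (iF₁.const_mul _), integral_const_mul, integral_const_mul,
      hENS]
    ring
  set P : Ω → ℝ := fun ω => S m ω + r m ω + κ + N m ω * Δ m ω + T m * Δ m ω ^ 2 with hP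
  have i₁ : Integrable (fun ω => S m ω + r m ω) μ := iS.add ir
  have i₂ : Integrable (fun ω => S m ω + r m ω + κ) μ := i₁.add (integrable_const κ)
  have i₃ : Integrable (fun ω => S m ω + r m ω + κ + N m ω * Δ m ω) μ := i₂.add iNΔ
  have iP : Integrable P μ := i₃.add (iΔΔ.const_mul (T m))
  have eP : ∫ ω, P ω ∂μ = κ + ∫ ω, N m ω * Δ m ω ∂μ + T m * ∫ ω, Δ m ω ^ 2 ∂μ := by
    simp only [hP]
    rw [integral_add i₃ (iΔΔ.const_mul (T m)), integral_add i₂ iNΔ,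
      integral_add i₁ (integrable_const κ), integral_add iS ir, hES, hEr, integral_const_mul]
    simp
  have eRem : |∫ ω, (I m * Δ m ω - P ω) ∂μ| ≤ |η m| + q⁻¹ * C₃ := by
    have i₄ : Integrable (fun ω => η m + q⁻¹ * R m ω) μ :=
      (integrable_const _).add (iR.const_mul _)
    have h1 : |∫ ω, (I m * Δ m ω - P ω) ∂μ| ≤ ∫ ω, (η m + q⁻¹ * R m ω) ∂μ := by
      rw [← Real.norm_eq_abs]
      exact norm_integral_le_of_norm_le i₄ (.of_forall fun ω => hrem ω)
    rw [integral_add (integrable_const _) (iR.const_mul _), integral_const_mul] at h1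
    simp only [integral_const, probReal_univ, one_smul] at h1
    have h2 : q⁻¹ * ∫ ω, R m ω ∂μ ≤ q⁻¹ * C₃ := by
      gcongr
      exact (le_abs_self _).trans hb₃
    linarith [le_abs_self (η m)]
  rw [integral_sub (iΔ.const_mul _) iP, integral_const_mul, eP, eNΔ'] at eRem
  -- The leading part T/I cancels the -T/I of E[N Δ] in `eNΔ'`, so only κ survives in the mean.
  have eT : T m * ∫ ω, Δ m ω ^ 2 ∂μ = (I m)⁻¹ * T m + T m * q / I m ^ 2 * ∫ ω, F₂ ω ∂μ := by
    have : ∫ ω, Δ m ω ^ 2 ∂μ = (I m + q * ∫ ω, F₂ ω ∂μ) / I m ^ 2 := by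
      rw [eq_div_iff (by positivity), ← eΔΔ]
      ring
    rw [this]
    field_simp
  have bT : |T m * q / I m ^ 2 * ∫ ω, F₂ ω ∂μ| ≤ q⁻¹ * (K / c₀ ^ 2 * C₂) := by
    rw [abs_mul, abs_div, abs_mul, abs_of_pos hq0, abs_of_pos (by positivity : 0 < I m ^ 2)]
    calc _ ≤ K * m * q / (c₀ * m) ^ 2 * C₂ := by gcongr
      _ = _ := by
        rw [← hqm]
        field_simp
  have bF₁ : |q⁻¹ * ∫ ω, F₁ ω ∂μ| ≤ q⁻¹ * C₁ := by
    rw [abs_mul, abs_of_pos (inv_pos.2 hq0)]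
    gcongr
  have hKC : 0 ≤ K / c₀ ^ 2 * C₂ := by positivity
  constructor
  · rw [eT] at eRem
    have h0 : 0 ≤ C₂ * q⁻¹ := by positivity
    rw [abs_le] at eRem bT bF₁ ⊢
    constructor <;> linarith
  · rw [eΔΔ, add_sub_cancel_left, abs_mul, abs_of_pos hq0, mul_comm]
    gcongr
    linarith

theorem isLittleO_sub_div_of_abs_le {I E η : ℕ → ℝ} {κ c₀ C : ℝ} (hc₀ : 0 < c₀)
    (hI : ∀ᶠ m : ℕ in atTop, c₀ * m ≤ I m) (hη : Tendsto η atTop (𝓝 0))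
    (h : ∀ᶠ m in atTop, |I m * E m - κ| ≤ |η m| + C * (√(m : ℝ))⁻¹) :
    (fun m => E m - κ / I m) =o[atTop] fun m : ℕ => (m : ℝ)⁻¹ := by
  have hsqrt : Tendsto (fun m : ℕ => (√(m : ℝ))⁻¹) atTop (𝓝 0) :=
    (Real.tendsto_sqrt_atTop.comp tendsto_natCast_atTop_atTop).inv_tendsto_atTop
  have hlim : Tendsto (fun m : ℕ => c₀⁻¹ * (|η m| + C * (√(m : ℝ))⁻¹)) atTop (𝓝 0) := by
    simpa using ((hη.abs.add (hsqrt.const_mul C)).const_mul c₀⁻¹)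
  have ho : (fun m : ℕ => c₀⁻¹ * (|η m| + C * (√(m : ℝ))⁻¹) * (m : ℝ)⁻¹) =o[atTop]
      fun m : ℕ => (m : ℝ)⁻¹ := by
    simpa using ((isLittleO_one_iff ℝ).2 hlim).mul_isBigO
      (isBigO_refl (fun m : ℕ => (m : ℝ)⁻¹) atTop)
  refine IsBigO.trans_isLittleO (IsBigO.of_bound' ?_) ho
  filter_upwards [hI, h, eventually_ge_atTop 1] with m hI h hm
  have hm0 : (0 : ℝ) < m := by exact_mod_cast hm
  have hI0 : 0 < I m := lt_of_lt_of_le (by positivity) hI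
  have e : E m - κ / I m = (I m * E m - κ) / I m := by
    field_simp
  rw [e, Real.norm_eq_abs, abs_div, abs_of_pos hI0]
  refine le_trans ?_ (le_abs_self _)
  calc _ ≤ (|η m| + C * (√(m : ℝ))⁻¹) / (c₀ * m) := by
        have := (abs_nonneg _).trans h
        gcongr
    _ = _ := by field_simp

end

end FayHerriot

/-! ### Moment bounds for the random sums and the mean of the score correction. -/

namespace FayHerriot

section

variable {Ω : Type*} [MeasurableSpace Ω] {μ : Measure Ω}
  {X : ℕ → Ω → ℝ} {D : ℕ → ℝ} {τ K d d' A : ℝ} {p : ℕ}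

theorem unifBound_const_mul {m : ℕ} (c : ℝ) (X : Fin m → ℝ) :
    unifBound d d' D (fun j => c * X j) = |c| * unifBound d d' D X := by
  have h : ∀ n : ℕ, ∑ j : Fin m, c * X j * relPos d d' D j ^ n =
      c * ∑ j : Fin m, X j * relPos d d' D j ^ n := fun n => by
    simp only [mul_assoc, Finset.mul_sum]
  have h2 : ∑ j : Fin m, |c * X j| = |c| * ∑ j : Fin m, |X j| := by
    simp only [abs_mul, Finset.mul_sum]
  rw [unifBound, unifBound, seriesBound, seriesBound, h2, mul_add, Finset.mul_sum (Finset.range m)]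
  simp only [h, abs_mul c]
  refine congrArg₂ _ (Finset.sum_congr rfl fun n _ => mul_left_comm _ _ _) (mul_left_comm _ _ _)

theorem IndepSubexponential.memLp_loading {m : ℕ} {U : Matrix (Fin m) (Fin p) ℝ} {a : ℝ}
    (h : IndepSubexponential μ X τ K) (n : ℕ) (k : Fin p) :
    MemLp (fun ω => loading U D (fun j => X j ω) n a k) 2 μ := by
  refine memLp_finsetSum _ fun j _ => ?_
  simpa only [div_eq_mul_inv, mul_assoc, mul_comm, mul_left_comm] using
    (h.memLp_two j).const_mul (U j k / (a + D j) ^ n)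

theorem MomentBounded.congr {Y Z : ℕ → Ω → ℝ} (hZ : MomentBounded μ Z)
    (h : ∀ᶠ m in atTop, ∀ ω, Z m ω = Y m ω) : MomentBounded μ Y := by
  have h' : ∀ᶠ m in atTop, Z m = Y m := h.mono fun m hm => funext hm
  refine ⟨?_, fun q hq => ?_⟩
  · filter_upwards [hZ.1, h'] with m h1 h2 using h2 ▸ h1
  · obtain ⟨C, hC⟩ := hZ.2 q hq
    exact ⟨C, by filter_upwards [hC, h'] with m h1 h2 using h2 ▸ h1⟩

variable [IsProbabilityMeasure μ]

theorem MomentBounded.const_mul {Y : ℕ → Ω → ℝ} (hY : MomentBounded μ Y) (c : ℝ) :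
    MomentBounded μ fun m ω => c * Y m ω :=
  (MomentBounded.const (c := fun _ => c) (.of_forall fun _ => le_rfl)).mul hY

theorem IndepSubexponential.momentBounded_unifBound (h : IndepSubexponential μ X τ K)
    (hd0 : 0 < d) (hd : ∀ j, d ≤ D j) (hd' : ∀ j, D j ≤ d') {W : ℝ} {w : ∀ m, Fin m → ℝ}
    (hW : ∀ᶠ m in atTop, ∀ j, |w m j| ≤ W) :
    MomentBounded μ fun m ω => (√(m : ℝ))⁻¹ * unifBound d d' D fun j => w m j * X j ω := by
  have hdd' := (hd 0).trans (hd' 0)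
  exact h.momentBounded_seriesBound (theta_nonneg hd0 hdd') (theta_lt_one hd0 hdd')
    (fun j => abs_relPos_le hd0 hd hd' j) (abs_nonneg W)
    (hW.mono fun m hm j => (hm j).trans (le_abs_self W))

/-- Entries of U are O(m^{-1/2}) by the leverage condition, so these sums are of order 1 rather than
√m. -/
theorem IndepSubexponential.momentBounded_loadingBound (h : IndepSubexponential μ X τ K)
    (hd0 : 0 < d) (hd : ∀ j, d ≤ D j) (hd' : ∀ j, D j ≤ d') (hA : 0 < A)
    {U : ∀ m, Matrix (Fin m) (Fin p) ℝ} {W : ℝ}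
    (hW : ∀ᶠ m : ℕ in atTop, ∀ j k, |√(m : ℝ) * U m j k| ≤ W) :
    MomentBounded μ fun m ω => loadingBound d d' (U m) D A fun j => X j ω := by
  have key : ∀ (k : Fin p) (f : ℕ → ℝ) (B : ℝ), (∀ j, |f j| ≤ B) →
      MomentBounded μ fun m ω => unifBound d d' D fun j => U m j k * f j * X j ω := by
    intro k f B hf
    have h1 := h.momentBounded_unifBound hd0 hd hd' (W := W * B)
      (w := fun m j => √(m : ℝ) * U m j k * f j) (by
        filter_upwards [hW] with m hm j
        rw [abs_mul]
        exact mul_le_mul (hm j k) (hf j) (abs_nonneg _) ((abs_nonneg _).trans (hm j k)))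
    refine h1.congr ?_
    filter_upwards [eventually_ge_atTop 1] with m hm ω
    have hm0 : (0 : ℝ) < m := by exact_mod_cast hm
    have hq0 : 0 < √(m : ℝ) := Real.sqrt_pos.2 hm0
    simp only [mul_assoc]
    rw [unifBound_const_mul, abs_of_pos hq0, inv_mul_cancel_left₀ hq0.ne']
  have hv : ∀ j, |(A + D j)⁻¹| ≤ A⁻¹ := fun j => by
    have := hd j
    rw [abs_of_pos (inv_pos.2 (by linarith))]
    gcongr
    linarith
  have hv2 : ∀ j, |((A + D j) ^ 2)⁻¹| ≤ A⁻¹ ^ 2 := fun j => by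
    rw [← inv_pow, abs_pow]
    exact pow_le_pow_left₀ (abs_nonneg _) (hv j) 2
  refine MomentBounded.sum Finset.univ fun k _ => ((?_ : MomentBounded μ _).add
    (key k (fun j => (A + D j)⁻¹) _ hv)).add (key k (fun j => ((A + D j) ^ 2)⁻¹) _ hv2)
  simpa only [mul_one] using key k (fun _ => 1) 1 (by simp)

theorem IndepSubexponential.integral_loading_mul_loading {m : ℕ} {U : Matrix (Fin m) (Fin p) ℝ}
    (h : IndepSubexponential μ X τ K) (hv : ∀ j, ∫ ω, X j ω ^ 2 ∂μ = A + D j)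
    (hA : ∀ j, A + D j ≠ 0) (n : ℕ) (k l : Fin p) :
    ∫ ω, loading U D (fun j => X j ω) n A k * loading U D (fun j => X j ω) 1 A l ∂μ =
      gram U D n A k l := by
  have e : ∀ (ω : Ω) (n : ℕ) (k : Fin p), loading U D (fun j => X j ω) n A k =
      ∑ j : Fin m, U j k / (A + D j) ^ n * X j ω := fun ω n k =>
    Finset.sum_congr rfl fun j _ => by ring
  simp only [e, h.integral_sum_mul_sum, hv, gram, Matrix.of_apply]
  refine Finset.sum_congr rfl fun j _ => ?_
  have := hA j
  field_simp

/-- As a bilinear form in the loadings with nonrandom coefficients, the correction can be averaged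
entry by entry. -/
theorem scoreCorrection_eq {m : ℕ} (U : Matrix (Fin m) (Fin p) ℝ) (D : ℕ → ℝ) (ε : Fin m → ℝ)
    (a : ℝ) :
    scoreCorrection U D ε a = 1 / 2 * ((gram U D 1 a)⁻¹ * gram U D 2 a).trace -
      ∑ k, ∑ l, (gram U D 1 a)⁻¹ k l * (loading U D ε 2 a k * loading U D ε 1 a l) +
      1 / 2 * ∑ k, ∑ l, ((gram U D 1 a)⁻¹ * gram U D 2 a * (gram U D 1 a)⁻¹) k l *
        (loading U D ε 1 a k * loading U D ε 1 a l) := by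
  have hsymm : ((gram U D 1 a)⁻¹)ᵀ = (gram U D 1 a)⁻¹ := by
    ext k l
    exact inv_gram_comm l k
  have hbil : ∀ (M : Matrix (Fin p) (Fin p) ℝ) (v w : Fin p → ℝ),
      v ⬝ᵥ (M *ᵥ w) = ∑ k, ∑ l, M k l * (v k * w l) := fun M v w => by
    simp only [dotProduct, Matrix.mulVec, Finset.mul_sum]
    exact Finset.sum_congr rfl fun k _ => Finset.sum_congr rfl fun l _ => by ring
  rw [scoreCorrection, gls, hbil]
  congr 2
  rw [← hbil]
  nth_rewrite 1 [← hsymm]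
  rw [Matrix.mulVec_transpose, ← Matrix.dotProduct_mulVec, Matrix.mulVec_mulVec,
    Matrix.mulVec_mulVec, Matrix.mul_assoc]

/-- Unbiasedness of the residual score: with t = tr[G₁⁻¹G₂], the three terms have means t/2, -t and
t/2. -/
theorem IndepSubexponential.integral_scoreCorrection {m : ℕ} {U : Matrix (Fin m) (Fin p) ℝ}
    (h : IndepSubexponential μ X τ K) (hv : ∀ j, ∫ ω, X j ω ^ 2 ∂μ = A + D j)
    (hA : ∀ j, 0 < A + D j) (hU : Uᵀ * U = 1) (hd' : ∀ j, D j ≤ d') :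
    ∫ ω, scoreCorrection U D (fun j => X j ω) A ∂μ = 0 := by
  have hu := isUnit_det_gram hU (fun j => hA j) hd'
  set H := (gram U D 1 A)⁻¹ with hH
  have hint : ∀ n k l, Integrable (fun ω => loading U D (fun j => X j ω) n A k *
      loading U D (fun j => X j ω) 1 A l) μ := fun n k l =>
    (h.memLp_loading n k).integrable_mul (h.memLp_loading 1 l)
  have hsum : ∀ (M : Matrix (Fin p) (Fin p) ℝ) (n : ℕ), Integrable (fun ω => ∑ k, ∑ l, M k l *
      (loading U D (fun j => X j ω) n A k * loading U D (fun j => X j ω) 1 A l)) μ := fun M n =>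
    integrable_finsetSum _ fun k _ => integrable_finsetSum _ fun l _ => (hint n k l).const_mul _
  have heval : ∀ (M : Matrix (Fin p) (Fin p) ℝ) (n : ℕ), ∫ ω, ∑ k, ∑ l, M k l *
      (loading U D (fun j => X j ω) n A k * loading U D (fun j => X j ω) 1 A l) ∂μ =
      (M * gram U D n A).trace := fun M n => by
    refine (integral_finsetSum _ fun k _ =>
      integrable_finsetSum _ fun l _ => (hint n k l).const_mul _).trans ?_
    simp only [Matrix.trace, Matrix.diag_apply, Matrix.mul_apply]
    refine Finset.sum_congr rfl fun k _ => ?_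
    refine (integral_finsetSum _ fun l _ => (hint n k l).const_mul _).trans ?_
    refine Finset.sum_congr rfl fun l _ => ?_
    rw [integral_const_mul, h.integral_loading_mul_loading hv (fun j => (hA j).ne'), gram_comm]
  simp only [scoreCorrection_eq]
  refine (integral_add ((integrable_const _).sub (hsum _ _)) ((hsum _ _).const_mul _)).trans ?_
  refine (congrArg₂ _ (integral_sub (integrable_const _) (hsum _ _))
    (integral_const_mul _ _)).trans ?_
  rw [heval, heval, Matrix.mul_assoc, Matrix.nonsing_inv_mul _ hu, Matrix.mul_one]
  simp
  ring

theorem continuous_scoreCorrection {m : ℕ} (U : Matrix (Fin m) (Fin p) ℝ) (D : ℕ → ℝ) (a : ℝ) :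
    Continuous fun ε => scoreCorrection U D ε a := by
  simp only [scoreCorrection, gls, loading, dotProduct, Matrix.mulVec]
  fun_prop

end

end FayHerriot

/-! ### Application to the Fay–Herriot model. -/

namespace FayHerriot

section

variable {Ω : Type*} {p : ℕ} {x : ℕ → Fin p → ℝ} {D : ℕ → ℝ} {d d' A : ℝ} {u e : ℕ → Ω → ℝ}

/-- The information `tr[V⁻²] / 2` about `A` in the data of `m` areas. -/
def information (D : ℕ → ℝ) (A : ℝ) (m : ℕ) : ℝ :=
  1 / 2 * ∑ j : Fin m, ((A + D j) ^ 2)⁻¹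

theorem trace_inv_covMatrix_sq (hD : ∀ j, A + D j ≠ 0) (m : ℕ) :
    ((covMatrix D m A)⁻¹ ^ 2).trace = 2 * information D A m := by
  rw [covMatrix_inv fun j => hD j, Matrix.diagonal_pow, Matrix.trace_diagonal, information,
    ← mul_assoc]
  norm_num

theorem mul_le_information (hA : 0 < A) (hd0 : 0 < d) (hd : ∀ j, d ≤ D j) (hd' : ∀ j, D j ≤ d')
    (m : ℕ) : 1 / 2 * ((A + d') ^ 2)⁻¹ * m ≤ information D A m := by
  calc 1 / 2 * ((A + d') ^ 2)⁻¹ * m = 1 / 2 * ∑ _j : Fin m, ((A + d') ^ 2)⁻¹ := by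
        simp
        ring
    _ ≤ _ := by
        rw [information]
        gcongr with j
        · have := hd j
          have : 0 < A + D j := by linarith
          positivity
        · linarith [hd j]
        · exact hd' j

theorem exists_orthonormal_factors (hrank : ∀ᶠ m in atTop, (designMatrix x m).rank = p)
    (hlev : ∃ K : ℝ, ∀ᶠ m : ℕ in atTop, ∀ j : Fin m,
      x j ⬝ᵥ (((designMatrix x m)ᵀ * designMatrix x m)⁻¹ *ᵥ x j) ≤ K / m) :
    ∃ (U : ∀ m, Matrix (Fin m) (Fin p) ℝ) (W : ℝ), ∀ᶠ m : ℕ in atTop,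
      (∃ B : Matrix (Fin p) (Fin p) ℝ, designMatrix x m = U m * B ∧ IsUnit B.det) ∧
      (U m)ᵀ * U m = 1 ∧ ∀ j k, |√(m : ℝ) * U m j k| ≤ W := by
  have h : ∀ m, ∃ U : Matrix (Fin m) (Fin p) ℝ, (designMatrix x m).rank = p →
      (∃ B : Matrix (Fin p) (Fin p) ℝ, designMatrix x m = U * B ∧ IsUnit B.det) ∧ Uᵀ * U = 1 ∧
      ∀ j : Fin m, ∑ k, U j k ^ 2 =
        x j ⬝ᵥ (((designMatrix x m)ᵀ * designMatrix x m)⁻¹ *ᵥ x j) := fun m => by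
    by_cases hr : (designMatrix x m).rank = p
    · obtain ⟨U, B, h1, h2, h3, h4⟩ := exists_orthonormal_factor _ hr
      exact ⟨U, fun _ => ⟨⟨B, h1, h2⟩, h3, h4⟩⟩
    -- An arbitrary choice for the m of deficient rank, which are eventually absent.
    · exact ⟨0, fun h => absurd h hr⟩
  choose U hU using h
  obtain ⟨K, hK⟩ := hlev
  refine ⟨U, √K, ?_⟩
  filter_upwards [hrank, hK, eventually_ge_atTop 1] with m hr hK hm
  obtain ⟨h1, h2, h3⟩ := hU m hr
  refine ⟨h1, h2, fun j k => Real.abs_le_sqrt ?_⟩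
  have hm0 : (0 : ℝ) < m := by exact_mod_cast hm
  have h4 : U m j k ^ 2 ≤ K / m :=
    (Finset.single_le_sum (fun l _ => sq_nonneg (U m j l)) (Finset.mem_univ k)).trans
      ((h3 j).trans_le (hK j))
  rw [mul_pow, Real.sq_sqrt hm0.le]
  rwa [le_div_iff₀ hm0, mul_comm] at h4

theorem data_eq (x : ℕ → Fin p → ℝ) (β : Fin p → ℝ) (u e : ℕ → Ω → ℝ) (m : ℕ) (ω : Ω) :
    data x β u e m ω = designMatrix x m *ᵥ β + fun j : Fin m => u j ω + e j ω := by
  ext j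
  simp only [data, add_assoc, Pi.add_apply]
  rfl

theorem eventually_stationary (hreg : Regular x D A) (β : Fin p → ℝ) (u e : ℕ → Ω → ℝ)
    {C : ℝ} (hC : 0 < C) {Ladd : ℕ → ℝ → ℝ} (hLadd : AddFactor Ladd) {i : ℕ}
    {Ahat : (m : ℕ) → (Fin m → ℝ) → ℝ} (hAhat : IsAdjustedEstimator x D C Ladd i Ahat)
    {U : ∀ m, Matrix (Fin m) (Fin p) ℝ} (hU : ∀ᶠ m in atTop,
      (∃ B : Matrix (Fin p) (Fin p) ℝ, designMatrix x m = U m * B ∧ IsUnit B.det) ∧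
      (U m)ᵀ * U m = 1) :
    ∀ᶠ m in atTop, ∀ ω, 0 < Ahat m (data x β u e m ω) ∧
      2 / (Ahat m (data x β u e m ω) + D i) +
        deriv (fun b => Real.log (Ladd m b)) (Ahat m (data x β u e m ω)) +
        (1 / 2 * ∑ j : Fin m, (u j ω + e j ω) ^ 2 / (Ahat m (data x β u e m ω) + D j) ^ 2 -
          1 / 2 * ∑ j : Fin m, (Ahat m (data x β u e m ω) + D j)⁻¹ +
          scoreCorrection (U m) D (fun j => u j ω + e j ω) (Ahat m (data x β u e m ω))) = 0 := by
  obtain ⟨d, hd0, hd⟩ := hreg.D_lower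
  obtain ⟨d', hd'⟩ := hreg.D_upper
  filter_upwards [hU, hreg.rank_eq, eventually_gt_atTop (p + 4)] with m hU hr hm ω
  have hmem := hAhat.mem_argmax m (data x β u e m ω)
    (adjustedArgmax_nonempty hC hLadd hm hr hd0 hd hd' _)
  have hpos := adjustedArgmax_pos hC hLadd (by omega) hr hd0 hd hd' _ hmem
  obtain ⟨⟨B, hB, hBu⟩, hUU⟩ := hU
  refine ⟨hpos, adjustedArgmax_stationary hC hLadd (by omega) hB hBu hUU hd0 hd hd' β
    (fun j => u j ω + e j ω) hpos ?_⟩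
  rwa [← data_eq]

variable [MeasurableSpace Ω] {μ : Measure Ω}

theorem Errors.aemeasurable_errors (h : Errors μ D A u e) (m : ℕ) :
    AEMeasurable (fun ω (j : Fin m) => u j ω + e j ω) μ :=
  aemeasurable_pi_lambda _ fun j => h.aemeasurable_add j

theorem Errors.aemeasurable_data (h : Errors μ D A u e) (x : ℕ → Fin p → ℝ) (β : Fin p → ℝ)
    (m : ℕ) : AEMeasurable (data x β u e m) μ := by
  have : data x β u e m = fun ω => designMatrix x m *ᵥ β + fun j : Fin m => u j ω + e j ω :=
    funext fun ω => data_eq x β u e m ω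
  rw [this]
  exact (h.aemeasurable_errors m).const_add _

variable [IsProbabilityMeasure μ]

theorem Errors.momentBounded_errorBound (h : Errors μ D A u e) (hA : 0 < A) (hd0 : 0 < d)
    (hd : ∀ j, d ≤ D j) (hd' : ∀ j, D j ≤ d') {U : ∀ m, Matrix (Fin m) (Fin p) ℝ}
    (hE : MomentBounded μ fun m ω => loadingBound d d' (U m) D A fun j => u j ω + e j ω) :
    MomentBounded μ fun m ω =>
      (√(m : ℝ))⁻¹ * errorBound d d' (U m) D A fun j => u j ω + e j ω := by
  obtain ⟨τ, K, hξ⟩ := h.exists_indepSubexponential_sq_sub hA (fun j => hd0.trans_le (hd j)) hd'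
  have key : ∀ n : ℕ, MomentBounded μ fun m ω => (√(m : ℝ))⁻¹ * unifBound d d' D
      fun j : Fin m => ((A + D j) ^ n)⁻¹ * ((u j ω + e j ω) ^ 2 - (A + D j)) := fun n =>
    hξ.momentBounded_unifBound hd0 hd hd' (w := fun m j => ((A + D j) ^ n)⁻¹) (W := (A ^ n)⁻¹)
      (.of_forall fun m j => by
        have : A ≤ A + D j := by linarith [hd j]
        have : 0 < A + D j := by linarith
        rw [abs_of_pos (by positivity)]
        gcongr)
  have h0 := key 0
  simp only [pow_zero, inv_one, one_mul] at h0
  have hq : ∀ᶠ m : ℕ in atTop, |(√(m : ℝ))⁻¹| ≤ 1 := by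
    filter_upwards [eventually_ge_atTop 1] with m hm
    rw [abs_of_nonneg (by positivity)]
    exact inv_le_one_of_one_le₀ (Real.one_le_sqrt.2 (by exact_mod_cast hm))
  refine (((h0.add (key 2)).add (key 3)).add ((MomentBounded.const hq).mul ((hE.pow 2).add
    (.const (c := fun _ => 1) (.of_forall fun _ => le_rfl))))).congr (.of_forall fun m ω => ?_)
  simp only [errorBound, mul_add]

theorem Errors.momentBounded_scoreCorrection (h : Errors μ D A u e) (hA : 0 < A) (hd0 : 0 < d)
    (hd : ∀ j, d ≤ D j) (hd' : ∀ j, D j ≤ d') {U : ∀ m, Matrix (Fin m) (Fin p) ℝ}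
    (hU : ∀ᶠ m in atTop, (U m)ᵀ * U m = 1)
    (hE : MomentBounded μ fun m ω => loadingBound d d' (U m) D A fun j => u j ω + e j ω) :
    MomentBounded μ fun m ω => scoreCorrection (U m) D (fun j => u j ω + e j ω) A := by
  obtain ⟨Γ, hΓ, hcorr⟩ := exists_scoreCorrection_le p hd0 hd hd' hA
  have hc : 0 < A + (d + d') / 2 := by linarith [(hd 0).trans (hd' 0)]
  refine MomentBounded.mono (((MomentBounded.const (c := fun _ => A + (d + d') / 2)
    (.of_forall fun _ => le_rfl)).add (hE.pow 2)).const_mul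
      (((A + (d + d') / 2) ^ 2)⁻¹ * Γ)) (.of_forall fun m => ?_) ?_
  · exact ((continuous_scoreCorrection (U m) D A).comp_aestronglyMeasurable
      (h.aemeasurable_errors m).aestronglyMeasurable)
  · filter_upwards [hU] with m hm ω
    have := (hcorr hm (fun j => u j ω + e j ω) A hA.le).1
    rwa [mul_assoc, ← div_eq_inv_mul, le_div_iff₀ (by positivity), mul_comm]

theorem Errors.momentBounded_sum (h : Errors μ D A u e) (hA : 0 < A) (hd0 : 0 < d)
    (hd : ∀ j, d ≤ D j) (hd' : ∀ j, D j ≤ d') (n : ℕ) (b : ℝ) :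
    MomentBounded μ fun m ω => (√(m : ℝ))⁻¹ * (b * ∑ j : Fin m, ((A + D j) ^ n)⁻¹ *
      ((u j ω + e j ω) ^ 2 - (A + D j))) := by
  obtain ⟨τ, K, hξ⟩ := h.exists_indepSubexponential_sq_sub hA (fun j => hd0.trans_le (hd j)) hd'
  have hc : 0 < A + (d + d') / 2 := by linarith [(hd 0).trans (hd' 0)]
  -- The extra factor A + D_j in the weights undoes the division by A + D_j when the uniform bound
  -- is evaluated at a = A.
  have hZ := hξ.momentBounded_unifBound hd0 hd hd' (W := (A + d') * (A ^ n)⁻¹)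
      (w := fun m j => (A + D j) * ((A + D j) ^ n)⁻¹) (.of_forall fun m j => by
        have h1 : A ≤ A + D j := by linarith [hd j]
        have h2 : 0 < A + D j := by linarith
        have h3 := hd' j
        have h4 : 0 < A + d' := by linarith
        rw [abs_of_pos (by positivity)]
        gcongr)
  refine (hZ.const_mul (|b| * (A + (d + d') / 2)⁻¹)).mono (.of_forall fun m => ?_)
    (.of_forall fun m ω => ?_)
  · have hcont : Continuous fun ε : Fin m → ℝ => (√(m : ℝ))⁻¹ * (b * ∑ j : Fin m,
        ((A + D j) ^ n)⁻¹ * (ε j ^ 2 - (A + D j))) := by fun_prop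
    exact hcont.comp_aestronglyMeasurable (h.aemeasurable_errors m).aestronglyMeasurable
  · have := abs_sum_div_add_le hd0 hd hd' hA.le (m := m) fun j : Fin m =>
      (A + D j) * ((A + D j) ^ n)⁻¹ * ((u j ω + e j ω) ^ 2 - (A + D j))
    have e1 : ∀ j : Fin m, (A + D j) * ((A + D j) ^ n)⁻¹ * ((u j ω + e j ω) ^ 2 - (A + D j)) /
        (A + D j) = ((A + D j) ^ n)⁻¹ * ((u j ω + e j ω) ^ 2 - (A + D j)) := fun j => by
      have : 0 < A + D j := by linarith [hd j]
      field_simp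
    simp only [e1] at this
    rw [abs_mul, abs_mul, abs_of_nonneg (by positivity)]
    refine (mul_le_mul_of_nonneg_left (mul_le_mul_of_nonneg_left this (abs_nonneg b))
      (by positivity)).trans_eq ?_
    rw [div_eq_mul_inv]
    ring

/-- Var ξ_j = 2 v_j² cancels the weight v_j⁻². The case n = 2 gives E S² = I, the case n = 3 gives
E[N S] = -T. -/
theorem Errors.integral_sum_mul_sum (h : Errors μ D A u e) (hA : 0 < A) (hd0 : 0 < d)
    (hd : ∀ j, d ≤ D j) (hd' : ∀ j, D j ≤ d') (m n : ℕ) (b b' : ℝ) :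
    ∫ ω, (b * ∑ j : Fin m, ((A + D j) ^ n)⁻¹ * ((u j ω + e j ω) ^ 2 - (A + D j))) *
      (b' * ∑ j : Fin m, ((A + D j) ^ 2)⁻¹ * ((u j ω + e j ω) ^ 2 - (A + D j))) ∂μ =
      2 * b * b' * ∑ j : Fin m, ((A + D j) ^ n)⁻¹ := by
  have hD : ∀ j, 0 < D j := fun j => hd0.trans_le (hd j)
  obtain ⟨τ, K, hξ⟩ := h.exists_indepSubexponential_sq_sub hA hD hd'
  simp only [mul_mul_mul_comm b]
  rw [integral_const_mul, hξ.integral_sum_mul_sum, Finset.mul_sum, Finset.mul_sum]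
  refine Finset.sum_congr rfl fun j _ => ?_
  have : 0 < A + D j := by linarith [hD j]
  rw [h.integral_sq_sub_sq hA (hD j)]
  field_simp

theorem moments_estimator (hreg : Regular x D A) (β : Fin p → ℝ) (hmodel : Errors μ D A u e)
    {C : ℝ} (hC : 0 < C) {Ladd : ℕ → ℝ → ℝ} (hLadd : AddFactor Ladd) {i : ℕ}
    {Ahat : (m : ℕ) → (Fin m → ℝ) → ℝ} (hAhat : IsAdjustedEstimator x D C Ladd i Ahat) :
    (MomentBounded μ fun m ω => √(m : ℝ) * (Ahat m (data x β u e m ω) - A)) ∧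
    ∃ (η : ℕ → ℝ) (c : ℝ), Tendsto η atTop (𝓝 0) ∧ ∀ᶠ m in atTop,
      |information D A m * ∫ ω, (Ahat m (data x β u e m ω) - A) ∂μ - 2 / (A + D i)| ≤
        |η m| + c * (√(m : ℝ))⁻¹ ∧
      |information D A m ^ 2 * ∫ ω, (Ahat m (data x β u e m ω) - A) ^ 2 ∂μ -
        information D A m| ≤ c * √(m : ℝ) := by
  obtain ⟨d, hd0, hd⟩ := hreg.D_lower
  obtain ⟨d', hd'⟩ := hreg.D_upper
  have hA := hreg.A_pos
  have hD : ∀ j, 0 < D j := fun j => hd0.trans_le (hd j)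
  obtain ⟨U, W, hUW⟩ := exists_orthonormal_factors hreg.rank_eq hreg.leverage
  obtain ⟨τ, K, hε⟩ := hmodel.exists_indepSubexponential hA hD hd'
  have hE : MomentBounded μ fun m ω => loadingBound d d' (U m) D A fun j => u j ω + e j ω :=
    hε.momentBounded_loadingBound hd0 hd hd' hA (hUW.mono fun m h => h.2.2)
  have hW := hmodel.momentBounded_errorBound hA hd0 hd hd' hE
  obtain ⟨Γ, hΓ, hbounds⟩ := exists_stationary_bounds p hd0 hd hd' hA hLadd i
  set Δ : ℕ → Ω → ℝ := fun m ω => Ahat m (data x β u e m ω) - A with hΔdef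
  have hb := (hbounds.and ((hUW.mono fun m h => h.2.1).and
    (eventually_stationary hreg β u e hC hLadd hAhat (hUW.mono fun m h => ⟨h.1, h.2.1⟩)))).mono
    fun m h ω => h.1 (U m) h.2.1 _ _ (h.2.2 ω).1 (h.2.2 ω).2
  have hΔ : MomentBounded μ fun m ω => √(m : ℝ) * Δ m ω := by
    refine (hW.const_mul Γ).mono (.of_forall fun m => ?_) ?_
    · exact ((((hAhat.measurable m).comp_aemeasurable
        (hmodel.aemeasurable_data x β m)).sub_const A).const_mul _).aestronglyMeasurable
    · filter_upwards [hb, eventually_ge_atTop 1] with m h hm ω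
      have hm0 : (0 : ℝ) < m := by exact_mod_cast hm
      have hq0 : 0 < √(m : ℝ) := Real.sqrt_pos.2 hm0
      have h1 := (h ω).1
      rw [abs_mul, abs_of_pos hq0, mul_left_comm, ← div_eq_inv_mul, le_div_iff₀ hq0]
      calc _ = |Δ m ω| * √(m : ℝ) ^ 2 := by ring
        _ = |Δ m ω| * m := by rw [Real.sq_sqrt hm0.le]
        _ ≤ _ := h1
  -- R is √m times the remainder of `exists_stationary_bounds`, written in the bounded variables √m
  -- Δ and W/√m: for instance m|Δ|³ = |√m Δ|³/√m.
  refine ⟨hΔ, _, (exists_abs_moment_sub_le (Δ := Δ)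
    (S := fun m ω => 1 / 2 * ∑ j : Fin m, ((A + D j) ^ 2)⁻¹ * ((u j ω + e j ω) ^ 2 - (A + D j)))
    (N := fun m ω => -1 * ∑ j : Fin m, ((A + D j) ^ 3)⁻¹ * ((u j ω + e j ω) ^ 2 - (A + D j)))
    (r := fun m ω => scoreCorrection (U m) D (fun j => u j ω + e j ω) A)
    (R := fun m ω => Γ * (|√(m : ℝ) * Δ m ω| ^ 3 + (√(m : ℝ) * Δ m ω) ^ 2 *
      ((√(m : ℝ))⁻¹ * errorBound d d' (U m) D A fun j => u j ω + e j ω) +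
      |√(m : ℝ) * Δ m ω| * (1 + loadingBound d d' (U m) D A (fun j => u j ω + e j ω) ^ 2)))
    (I := information D A) (T := fun m => ∑ j : Fin m, ((A + D j) ^ 3)⁻¹)
    (η := fun m => deriv (fun b => Real.log (Ladd m b)) (A / 2)) (κ := 2 / (A + D i))
    (c₀ := 1 / 2 * ((A + d') ^ 2)⁻¹) (K := (A⁻¹) ^ 3)
    ?_ (.of_forall (mul_le_information hA hd0 hd hd')) ?_ (hLadd.tendsto_deriv (half_pos hA))
    (hmodel.momentBounded_sum hA hd0 hd hd' 2 _) (hmodel.momentBounded_sum hA hd0 hd hd' 3 _)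
    (hmodel.momentBounded_scoreCorrection hA hd0 hd hd' (hUW.mono fun m h => h.2.1) hE) ?_ hΔ
    ?_ ?_ ?_ ?_ ?_).imp fun c h => ⟨hLadd.tendsto_deriv (half_pos hA), h⟩⟩
  · have : 0 < A + d' := by linarith [hD 0, hd' 0]
    positivity
  · refine .of_forall fun m => (Finset.abs_sum_le_sum_abs _ _).trans ?_
    calc _ ≤ ∑ _j : Fin m, (A⁻¹) ^ 3 := Finset.sum_le_sum fun j _ => ?_
      _ = _ := by simp [mul_comm]
    have : A ≤ A + D j := by linarith [hD j]
    have : 0 < A + D j := by linarith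
    rw [abs_of_pos (by positivity), ← inv_pow]
    gcongr
  · exact (((hΔ.abs.pow 3).add ((hΔ.pow 2).mul hW)).add (hΔ.abs.mul ((MomentBounded.const
      (c := fun _ => 1) (.of_forall fun _ => le_rfl)).add (hE.pow 2)))).const_mul Γ
  · filter_upwards [hb, eventually_ge_atTop 1] with m h hm ω
    have hm0 : (0 : ℝ) < m := by exact_mod_cast hm
    have hq0 : 0 < √(m : ℝ) := Real.sqrt_pos.2 hm0
    have hqm : √(m : ℝ) ^ 2 = m := Real.sq_sqrt hm0.le
    rw [neg_one_mul]
    refine (h ω).2.trans (le_of_eq ?_)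
    have e1 : Ahat m (data x β u e m ω) - A = Δ m ω := rfl
    rw [e1, abs_mul, abs_of_pos hq0]
    generalize √(m : ℝ) = q at hq0 hqm ⊢
    rw [← hqm]
    field_simp
  · intro m
    obtain ⟨τ, K, hξ⟩ := hmodel.exists_indepSubexponential_sq_sub hA hD hd'
    rw [integral_const_mul, hξ.integral_sum_eq_zero, mul_zero]
  · filter_upwards [hUW] with m hU
    exact hε.integral_scoreCorrection (fun j => hmodel.integral_add_sq hA (hD j))
      (fun j => by linarith [hD j]) hU.2.1 hd'
  · intro m
    rw [hmodel.integral_sum_mul_sum hA hd0 hd hd', information]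
    ring
  · intro m
    rw [hmodel.integral_sum_mul_sum hA hd0 hd hd']
    ring

end

end FayHerriot

end

theorem theorem2 {Ω : Type*} [MeasurableSpace Ω] (μ : Measure Ω) [IsProbabilityMeasure μ]
    {p : ℕ} (x : ℕ → Fin p → ℝ) (β : Fin p → ℝ) (D : ℕ → ℝ) (A : ℝ)
    (hreg : FayHerriot.Regular x D A)
    (u e : ℕ → Ω → ℝ) (hmodel : FayHerriot.Errors μ D A u e)
    (C : ℝ) (hC : 0 < C) (Ladd : ℕ → ℝ → ℝ) (hLadd : FayHerriot.AddFactor Ladd)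
    (i : ℕ) (Ahat : (m : ℕ) → (Fin m → ℝ) → ℝ)
    (hAhat : FayHerriot.IsAdjustedEstimator x D C Ladd i Ahat) :
    ((∀ᶠ m in atTop, Integrable (fun ω => Ahat m (FayHerriot.data x β u e m ω) - A) μ) ∧
      (fun m : ℕ => (∫ ω, (Ahat m (FayHerriot.data x β u e m ω) - A) ∂μ) -
          4 / (((FayHerriot.covMatrix D m A)⁻¹ ^ 2).trace * (A + D i)))
        =o[atTop] (fun m : ℕ => (m : ℝ)⁻¹)) ∧
    ((∀ᶠ m in atTop, Integrable (fun ω => (Ahat m (FayHerriot.data x β u e m ω) - A) ^ 2) μ) ∧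
      (fun m : ℕ => (∫ ω, (Ahat m (FayHerriot.data x β u e m ω) - A) ^ 2 ∂μ) -
          2 / ((FayHerriot.covMatrix D m A)⁻¹ ^ 2).trace)
        =o[atTop] (fun m : ℕ => (m : ℝ)⁻¹)) ∧
    (∀ m : ℕ, p + 4 < m → i < m → (FayHerriot.designMatrix x m).rank = p →
      ∀ y : Fin m → ℝ,
        (FayHerriot.adjustedArgmax x D C Ladd i m y).Nonempty ∧ 0 < Ahat m y) := by
  obtain ⟨d, hd0, hd⟩ := hreg.D_lower
  obtain ⟨d', hd'⟩ := hreg.D_upper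
  have hA := hreg.A_pos
  have hD : ∀ j, 0 < A + D j := fun j => by linarith [hd j]
  have hq : ∀ᶠ m : ℕ in atTop, √(m : ℝ) ≠ 0 := by
    filter_upwards [eventually_ge_atTop 1] with m hm
    exact (Real.sqrt_pos.2 (by exact_mod_cast hm)).ne'
  obtain ⟨hΔ, η, c, hη, hmoments⟩ :=
    FayHerriot.moments_estimator hreg β hmodel hC hLadd hAhat
  have hc₀ : 0 < 1 / 2 * ((A + d') ^ 2)⁻¹ := by
    have : 0 < A + d' := (hD 0).trans_le (by linarith [hd' 0])
    positivity
  have hI := FayHerriot.mul_le_information hA hd0 hd hd'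
  refine ⟨⟨hΔ.eventually_integrable_of_mul hq, ?_⟩, ⟨?_, ?_⟩, fun m hm _ hX y => ?_⟩
  · have h := FayHerriot.isLittleO_sub_div_of_abs_le hc₀ (.of_forall hI) hη
      (hmoments.mono fun m h => h.1)
    -- With I = ½ tr V⁻², the quotient κ/I is 4/(tr[V⁻²](A + D_i)).
    refine h.congr_left fun m => ?_
    rw [FayHerriot.trace_inv_covMatrix_sq (fun j => (hD j).ne'), div_div,
      mul_assoc, ← mul_div_mul_left 2 _ (two_ne_zero (α := ℝ)),
      mul_comm (A + D i) (FayHerriot.information D A m)]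
    norm_num
  · refine FayHerriot.MomentBounded.eventually_integrable_of_mul (c := fun m => √(m : ℝ) ^ 2)
      (hq.mono fun m h => pow_ne_zero 2 h) ?_
    simpa only [mul_pow] using hΔ.pow 2
  -- Dividing the second-moment estimate by I puts it in the same form, with κ = 1, η = 0 and error
  -- O(m^{-1/2}).
  · have h := FayHerriot.isLittleO_sub_div_of_abs_le (κ := 1) hc₀ (.of_forall hI)
      (E := fun m => ∫ ω, (Ahat m (FayHerriot.data x β u e m ω) - A) ^ 2 ∂μ)
      (C := (1 / 2 * ((A + d') ^ 2)⁻¹)⁻¹ * c) tendsto_const_nhds (by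
        filter_upwards [hmoments, eventually_ge_atTop 1] with m h hm
        have hm0 : (0 : ℝ) < m := by exact_mod_cast hm
        have hI0 := (mul_pos hc₀ hm0).trans_le (hI m)
        have e1 : FayHerriot.information D A m *
            ∫ ω, (Ahat m (FayHerriot.data x β u e m ω) - A) ^ 2 ∂μ - 1 =
            (FayHerriot.information D A m ^ 2 *
              ∫ ω, (Ahat m (FayHerriot.data x β u e m ω) - A) ^ 2 ∂μ -
              FayHerriot.information D A m) / FayHerriot.information D A m := by
          field_simp
        rw [e1, abs_div, abs_of_pos hI0, abs_zero, zero_add]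
        have hc : 0 ≤ c * √(m : ℝ) := (abs_nonneg _).trans h.2
        calc _ ≤ c * √(m : ℝ) / (1 / 2 * ((A + d') ^ 2)⁻¹ * m) := by
              gcongr
              · exact h.2
              · exact hI m
          _ = (1 / 2 * ((A + d') ^ 2)⁻¹)⁻¹ * c * (√(m : ℝ) / m) := by
              rw [mul_comm c, div_eq_mul_inv, mul_inv, div_eq_mul_inv]
              ring
          _ = _ := by rw [Real.sqrt_div_self])
    refine h.congr_left fun m => ?_
    rw [FayHerriot.trace_inv_covMatrix_sq (fun j => (hD j).ne'),
      ← mul_div_mul_left 1 _ (two_ne_zero (α := ℝ)), mul_one]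
  · have hne := FayHerriot.adjustedArgmax_nonempty (i := i) hC hLadd hm hX hd0 hd hd' y
    exact ⟨hne, FayHerriot.adjustedArgmax_pos hC hLadd (by omega) hX hd0 hd hd' y
      (hAhat.mem_argmax m y hne)⟩
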